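/- Let $k$ be a field, $X$ a projective scheme over $k$, and let $(\mathcal L_1,\sigma_1),\dots,(\mathcal L_s,\sigma_s)$ be pairs consisting of an invertible $\mathcal O_X$-module $\mathcal L_i$ and a $k$-automorphism $\sigma_i$ of $X$. For pairs $\mathcal L_\sigma=(\mathcal L,\sigma)$, $\mathcal M_\tau=(\mathcal M,\tau)$ put $\mathcal L_\sigma\mathcal M_\tau=(\mathcal L\otimes\sigma^*\mathcal M)_{\tau\sigma}$; this product is associative and unital, with unit $(\mathcal O_X)_{\mathrm{id}}$, up to canonical isomorphism. The $H^0$ of a pair is the $H^0$ of its underlying sheaf. Suppose that the pairs commute: $\sigma_i\sigma_j=\sigma_j\sigma_i$ for all $i,j$, and for all $i<j$ an isomorphism of sheaves $$\varphi_{ij}\colon (\mathcal L_j)_{\sigma_j}(\mathcal L_i)_{\sigma_i}=\mathcal L_j\otimes\sigma_j^*\mathcal L_i\longrightarrow \mathcal L_i\otimes\sigma_i^*\mathcal L_j=(\mathcal L_i)_{\sigma_i}(\mathcal L_j)_{\sigma_j}$$ is given. These commutation relations are called compatible if for all $i<j<l$ $$(\varphi_{ij}\otimes 1_l)\circ(1_j\otimes\varphi_{il})\circ(\varphi_{jl}\otimes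 1_i)=(1_i\otimes\varphi_{jl})\circ(\varphi_{il}\otimes 1_j)\circ(1_l\otimes\varphi_{ij})$$ as maps $(\mathcal L_l)_{\sigma_l}(\mathcal L_j)_{\sigma_j}(\mathcal L_i)_{\sigma_i}\to(\mathcal L_i)_{\sigma_i}(\mathcal L_j)_{\sigma_j}(\mathcal L_l)_{\sigma_l}$. The pairs $((\sigma_i^{-1})^*\mathcal L_i)_{\sigma_i^{-1}}$ then commute as well, with the induced commutation relations $\psi_{ij}$ ($i<j$): pulling back $\varphi_{ij}^{-1}\colon \mathcal L_i\otimes\sigma_i^*\mathcal L_j\to\mathcal L_j\otimes\sigma_j^*\mathcal L_i$ along $\sigma_i^{-1}\sigma_j^{-1}$ and interchanging the tensor factors on both sides gives $$\psi_{ij}\colon (\sigma_j^{-1})^*\mathcal L_j\otimes(\sigma_j^{-1})^*(\sigma_i^{-1})^*\mathcal L_i\longrightarrow(\sigma_i^{-1})^*\mathcal L_i\otimes(\sigma_i^{-1})^*(\sigma_j^{-1})^*\mathcal L_j .$$ For compatible commutation relations, the twisted multi-homogeneous coordinate ring $B(X;\{(\mathcal L_i)_{\sigma_i}\})$ is the $k$-vector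 space $$\bigoplus_{\overline n\in\mathbb N^s}H^0\bigl(X,(\mathcal L_1)_{\sigma_1}^{n_1}\cdots(\mathcal L_s)_{\sigma_s}^{n_s}\bigr)$$ with the biadditive multiplication given by $a\cdot b=a\otimes\sigma^{\overline m}(b)$ for $a$ of degree $\overline m$ and $b$ of degree $\overline n$. Here $\sigma^{\overline m}=\sigma_1^{m_1}\cdots\sigma_s^{m_s}$ acts on sections by pullback, and the product of $(\mathcal L_1)_{\sigma_1}^{m_1}\cdots(\mathcal L_s)_{\sigma_s}^{m_s}$ and $(\mathcal L_1)_{\sigma_1}^{n_1}\cdots(\mathcal L_s)_{\sigma_s}^{n_s}$ is identified with $(\mathcal L_1)_{\sigma_1}^{m_1+n_1}\cdots(\mathcal L_s)_{\sigma_s}^{m_s+n_s}$ by reordering the factors with the maps $\varphi_{ij}$. The identity element is $1\in H^0(X,\mathcal O_X)$. Assume that both the relations $\varphi_{ij}$ and the induced relations $\psi_{ij}$ are compatible. Put $$B'=B(X;\{(\mathcal L_i)_{\sigma_i}\}),\qquad B=B(X;\{((\sigma_i^{-1})^*\mathcal L_i)_{\sigma_i^{-1}}\}),$$ formed with $\varphi$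 and $\psi$, respectively. Then $B$ and $B'$ are associative unital $k$-algebras, and there is a $k$-linear isomorphism of rings $$\tau\colon B\longrightarrow (B')^{\mathrm{op}},\qquad \tau(a)=\sigma^{\overline n}(a)=\sigma_1^{n_1}\cdots\sigma_s^{n_s}(a)\quad\text{for } a\in B_{\overline n}.$$ Here $\sigma^{\overline n}(a)$ is the pullback of the section $a$, regarded as an element of $B'_{\overline n}$ by the canonical isomorphism from the pullback along $\sigma^{\overline n}$ of the sheaf underlying the product $((\sigma_1^{-1})^*\mathcal L_1)_{\sigma_1^{-1}}^{n_1}\cdots((\sigma_s^{-1})^*\mathcal L_s)_{\sigma_s^{-1}}^{n_s}$ to the sheaf underlying $(\mathcal L_s)_{\sigma_s}^{n_s}\cdots(\mathcal L_1)_{\sigma_1}^{n_1}$, followed by reordering the factors to $(\mathcal L_1)_{\sigma_1}^{n_1}\cdots(\mathcal L_s)_{\sigma_s}^{n_s}$ with the maps $\varphi_{ij}$. -/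

import Mathlib

open CategoryTheory AlgebraicGeometry MonoidalCategory Opposite TensorProduct

universe u v w

namespace TwistedCoordinateRing

/-- Elements of `M ⊗ N` in terms of a finite generating family of `M`. -/
theorem exists_sum_tmul {R M N ι : Type*} [CommRing R] [AddCommGroup M] [Module R M]
    [AddCommGroup N] [Module R N] [Fintype ι] (g : ι → M)
    (hg : Submodule.span R (Set.range g) = ⊤) (t : M ⊗[R] N) :
    ∃ n : ι → N, t = ∑ i, g i ⊗ₜ[R] n i := by
  induction t using TensorProduct.induction_on with
  | zero => exact ⟨0, by simp⟩
  | tmul m x =>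
    have hm : m ∈ Submodule.span R (Set.range g) := hg ▸ Submodule.mem_top
    obtain ⟨c, rfl⟩ := (Submodule.mem_span_range_iff_exists_fun R).1 hm
    exact ⟨fun i => c i • x, by simp [TensorProduct.sum_tmul, TensorProduct.smul_tmul]⟩
  | add a b ha hb =>
    obtain ⟨n, rfl⟩ := ha
    obtain ⟨n', rfl⟩ := hb
    exact ⟨n + n', by simp [TensorProduct.tmul_add, Finset.sum_add_distrib]⟩

/-- A tensor killed by `M ⊗ f` is killed for an explicit reason, given by finitely many equations. -/
theorem exists_trivialization {R M N N' : Type*} [CommRing R] [AddCommGroup M] [Module R M]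
    [AddCommGroup N] [Module R N] [AddCommGroup N'] [Module R N'] (f : N →ₗ[R] N')
    (t : M ⊗[R] N) (ht : f.lTensor M t = 0) :
    ∃ (p q : ℕ) (m : Fin p → M) (n : Fin p → N) (a : Fin p → Fin q → R) (y : Fin q → N'),
      t = ∑ i, m i ⊗ₜ[R] n i ∧ (∀ i, f (n i) = ∑ j, a i j • y j) ∧
      ∀ j, ∑ i, a i j • m i = 0 := by
  obtain ⟨P, hP, u, rfl⟩ := TensorProduct.exists_of_fg t
  have h1 : P.subtype.rTensor N' (f.lTensor P u) = 0 := by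
    rw [← ht, ← LinearMap.comp_apply, ← LinearMap.comp_apply, LinearMap.rTensor_comp_lTensor,
      LinearMap.lTensor_comp_rTensor]
  obtain ⟨Q, hPQ, hQ, hz⟩ := TensorProduct.eq_zero_of_fg_of_subtype_eq_zero hP h1
  obtain ⟨p, g, hg⟩ := Submodule.fg_iff_exists_fin_generating_family.1 hQ
  have hgm (i) : g i ∈ Q := hg ▸ Submodule.subset_span ⟨i, rfl⟩
  let g' : Fin p → Q := fun i => ⟨g i, hgm i⟩
  have hg' : Submodule.span R (Set.range g') = ⊤ := by
    apply Submodule.map_injective_of_injective Q.injective_subtype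
    rw [Submodule.map_span, ← Set.range_comp, Submodule.map_top, Submodule.range_subtype]
    exact hg
  obtain ⟨n, hn⟩ := exists_sum_tmul g' hg' ((Submodule.inclusion hPQ).rTensor N u)
  have hz' : ∑ i, g' i ⊗ₜ[R] f (n i) = 0 := by
    have : f.lTensor Q ((Submodule.inclusion hPQ).rTensor N u) = 0 := by
      rw [← hz, ← LinearMap.comp_apply, ← LinearMap.comp_apply, LinearMap.rTensor_comp_lTensor,
        LinearMap.lTensor_comp_rTensor]
    rw [hn] at this
    simpa using this
  obtain ⟨q, a, y, h1, h2⟩ := TensorProduct.vanishesTrivially_of_sum_tmul_eq_zero R hg' hz'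
  refine ⟨p, q, g, n, a, y, ?_, h1, fun j => ?_⟩
  · have : P.subtype.rTensor N u = Q.subtype.rTensor N ((Submodule.inclusion hPQ).rTensor N u) := by
      rw [← LinearMap.comp_apply, ← LinearMap.rTensor_comp]
      rfl
    rw [this, hn]
    simp [g']
  · simpa [g'] using congrArg Q.subtype (h2 j)

theorem exists_cover_le {C : Type w} [Category.{v} C] (J : GrothendieckTopology C) {U : C}
    (q : ℕ) (S : Fin q → Sieve U) (hS : ∀ i, S i ∈ J U) : ∃ T ∈ J U, ∀ i, T ≤ S i := by
  induction q with
  | zero => exact ⟨⊤, J.top_mem U, fun i => i.elim0⟩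
  | succ q ih =>
    obtain ⟨T, hT, h⟩ := ih (fun i => S i.succ) (fun i => hS _)
    refine ⟨T ⊓ S 0, J.intersection_covering hT (hS 0), fun i => ?_⟩
    refine Fin.cases inf_le_right (fun j => inf_le_left.trans (h j)) i

variable {C : Type w} [Category.{v} C] (J : GrothendieckTopology C) {R : Cᵒᵖ ⥤ CommRingCat.{u}}

/-- Restriction maps of a presheaf of modules, as additive maps. -/
noncomputable def resHom (M : PresheafOfModules.{u} (R ⋙ forget₂ CommRingCat RingCat)) {U V : Cᵒᵖ} (i : U ⟶ V) :
    (M.obj U : Type u) →+ (M.obj V : Type u) where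
  toFun x := M.map i x
  map_zero' := map_zero (M.map i).hom
  map_add' := map_add (M.map i).hom

theorem resHom_smul (M : PresheafOfModules.{u} (R ⋙ forget₂ CommRingCat RingCat)) {U V : Cᵒᵖ}
    (i : U ⟶ V) (r : R.obj U) (x : M.obj U) :
    resHom M i (r • x) = (R.map i).hom r • resHom M i x :=
  M.map_smul i r x

theorem resHom_comp (M : PresheafOfModules.{u} (R ⋙ forget₂ CommRingCat RingCat)) {U V W : Cᵒᵖ}
    (i : U ⟶ V) (j : V ⟶ W) (x : M.obj U) :
    resHom M (i ≫ j) x = resHom M j (resHom M i x) := by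
  change ((PresheafOfModules.toPresheaf _).obj M).map (i ≫ j) x = _
  rw [Functor.map_comp]
  rfl

/-- Restriction maps of the tensor product of two presheaves of modules. -/
noncomputable def tensorResHom (M N : PresheafOfModules.{u} (R ⋙ forget₂ CommRingCat RingCat))
    {U V : Cᵒᵖ} (i : U ⟶ V) :
    (M.obj U : Type u) ⊗[R.obj U] (N.obj U : Type u) →+
      (M.obj V : Type u) ⊗[R.obj V] (N.obj V : Type u) :=
  resHom (M ⊗ N) i

theorem tensorResHom_tmul (M N : PresheafOfModules.{u} (R ⋙ forget₂ CommRingCat RingCat))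
    {U V : Cᵒᵖ} (i : U ⟶ V) (x : M.obj U) (y : N.obj U) :
    tensorResHom M N i (x ⊗ₜ[R.obj U] y) = resHom M i x ⊗ₜ[R.obj V] resHom N i y :=
  rfl

theorem tensorResHom_comp (M N : PresheafOfModules.{u} (R ⋙ forget₂ CommRingCat RingCat))
    {U V W : Cᵒᵖ} (i : U ⟶ V) (j : V ⟶ W) (x : (M.obj U : Type u) ⊗[R.obj U] (N.obj U : Type u)) :
    tensorResHom M N (i ≫ j) x = tensorResHom M N j (tensorResHom M N i x) :=
  resHom_comp (M ⊗ N) i j x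

/-- Components of a morphism of presheaves of modules, as linear maps. -/
noncomputable def appHom {M N : PresheafOfModules.{u} (R ⋙ forget₂ CommRingCat RingCat)} (f : M ⟶ N) (U : Cᵒᵖ) :
    (M.obj U : Type u) →ₗ[R.obj U] (N.obj U : Type u) :=
  (f.app U).hom

theorem appHom_resHom {M N : PresheafOfModules.{u} (R ⋙ forget₂ CommRingCat RingCat)} (f : M ⟶ N)
    {U V : Cᵒᵖ} (i : U ⟶ V) (x : M.obj U) :
    appHom f V (resHom M i x) = resHom N i (appHom f U x) :=
  PresheafOfModules.naturality_apply f i x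

theorem locallyInjective_whiskerLeft (M : PresheafOfModules.{u} (R ⋙ forget₂ CommRingCat RingCat))
    {N N' : PresheafOfModules.{u} (R ⋙ forget₂ CommRingCat RingCat)} (f : N ⟶ N')
    [Presheaf.IsLocallyInjective J ((PresheafOfModules.toPresheaf _).map f)]
    [Presheaf.IsLocallySurjective J ((PresheafOfModules.toPresheaf _).map f)] :
    Presheaf.IsLocallyInjective J ((PresheafOfModules.toPresheaf _).map (M ◁ f)) := by
  suffices H : ∀ (U : Cᵒᵖ) (t : (M.obj U : Type u) ⊗[R.obj U] (N.obj U : Type u)),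
      LinearMap.lTensor (M.obj U) (appHom f U) t = 0 →
      ∃ T ∈ J U.unop, ∀ ⦃V⦄ (i : V ⟶ U.unop), T i → tensorResHom M N i.op t = 0 by
    constructor
    intro U x y hxy
    let x' : (M.obj U : Type u) ⊗[R.obj U] (N.obj U : Type u) := x
    let y' : (M.obj U : Type u) ⊗[R.obj U] (N.obj U : Type u) := y
    have hxy' : LinearMap.lTensor (M.obj U) (appHom f U) x' =
      LinearMap.lTensor (M.obj U) (appHom f U) y' := hxy
    obtain ⟨T, hT, h⟩ := H U (x' - y') (by rw [map_sub, hxy', sub_self])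
    refine J.superset_covering (fun V i hi => ?_) hT
    exact sub_eq_zero.1 ((map_sub (tensorResHom M N i.op) x' y').symm.trans (h i hi))
  intro U t ht
  obtain ⟨p, q, m, n, a, y, rfl, h1, h2⟩ := exists_trivialization _ t ht
  obtain ⟨T, hT, hT'⟩ := exists_cover_le J q
    (fun j => Presheaf.imageSieve ((PresheafOfModules.toPresheaf _).map f) (y j))
    (fun j => Presheaf.imageSieve_mem J _ _)
  let S : Sieve U.unop :=
    { arrows := fun V i => tensorResHom M N i.op (∑ i, m i ⊗ₜ[R.obj U] n i) = 0
      downward_closed := fun {V W} i hi j => by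
        rw [op_comp, tensorResHom_comp, hi, map_zero] }
  refine ⟨S, J.transitive hT _ fun V i hi => ?_, fun V i hi => hi⟩
  have hz (j : Fin q) : ∃ z : N.obj (op V), appHom f (op V) z = resHom N' i.op (y j) := hT' j _ hi
  choose z hz using hz
  have hk (k : Fin p) : appHom f (op V) (resHom N i.op (n k)) =
      appHom f (op V) (∑ j, (R.map i.op).hom (a k j) • z j) := by
    rw [appHom_resHom, h1, map_sum, map_sum]
    simp only [resHom_smul, map_smul, hz]
  obtain ⟨T', hT'', hT3⟩ := exists_cover_le J p
    (fun k => Presheaf.equalizerSieve (F := (PresheafOfModules.toPresheaf _).obj N)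
      (resHom N i.op (n k)) (∑ j, (R.map i.op).hom (a k j) • z j))
    (fun k => Presheaf.equalizerSieve_mem J ((PresheafOfModules.toPresheaf _).map f) _ _ (hk k))
  refine J.superset_covering (fun W l hl => ?_) hT''
  have hl' (k : Fin p) : resHom N l.op (resHom N i.op (n k)) =
    resHom N l.op (∑ j, (R.map i.op).hom (a k j) • z j) := hT3 k _ hl
  change tensorResHom M N (l ≫ i).op _ = 0
  rw [op_comp, tensorResHom_comp, map_sum, map_sum]
  simp only [tensorResHom_tmul, hl', map_sum, resHom_smul, TensorProduct.tmul_sum]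
  rw [Finset.sum_comm]
  refine Finset.sum_eq_zero fun j _ => ?_
  simp only [TensorProduct.tmul_smul, TensorProduct.smul_tmul']
  rw [← TensorProduct.sum_tmul]
  have h0 := congrArg (resHom M l.op) (congrArg (resHom M i.op) (h2 j))
  simp only [map_sum, resHom_smul, map_zero] at h0
  rw [h0, TensorProduct.zero_tmul]

theorem locallySurjective_whiskerLeft (M : PresheafOfModules.{u} (R ⋙ forget₂ CommRingCat RingCat))
    {N N' : PresheafOfModules.{u} (R ⋙ forget₂ CommRingCat RingCat)} (f : N ⟶ N')
    [Presheaf.IsLocallySurjective J ((PresheafOfModules.toPresheaf _).map f)] :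
    Presheaf.IsLocallySurjective J ((PresheafOfModules.toPresheaf _).map (M ◁ f)) := by
  suffices H : ∀ (U : Cᵒᵖ) (t : (M.obj U : Type u) ⊗[R.obj U] (N'.obj U : Type u)),
      ∃ T ∈ J U.unop, ∀ ⦃V⦄ (i : V ⟶ U.unop), T i →
        ∃ s : (M.obj (op V) : Type u) ⊗[R.obj (op V)] (N.obj (op V) : Type u),
          LinearMap.lTensor (M.obj (op V)) (appHom f (op V)) s = tensorResHom M N' i.op t by
    constructor
    intro U s
    obtain ⟨T, hT, h⟩ := H (op U) s
    exact J.superset_covering (fun V i hi => h i hi) hT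
  intro U t
  induction t using TensorProduct.induction_on with
  | zero => exact ⟨⊤, J.top_mem _, fun V i _ => ⟨0, (map_zero _).trans (map_zero _).symm⟩⟩
  | tmul m n =>
    refine ⟨_, Presheaf.imageSieve_mem J ((PresheafOfModules.toPresheaf _).map f) n,
      fun V i hi => ?_⟩
    have hi' : ∃ z : N.obj (op V), appHom f (op V) z = resHom N' i.op n := hi
    obtain ⟨z, hz⟩ := hi'
    exact ⟨resHom M i.op m ⊗ₜ z, by rw [LinearMap.lTensor_tmul, tensorResHom_tmul, hz]⟩
  | add a b ha hb =>
    obtain ⟨T, hT, h⟩ := ha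
    obtain ⟨T', hT', h'⟩ := hb
    refine ⟨T ⊓ T', J.intersection_covering hT hT', fun V i hi => ?_⟩
    obtain ⟨s, hs⟩ := h i hi.1
    obtain ⟨s', hs'⟩ := h' i hi.2
    exact ⟨s + s', by rw [map_add, hs, hs']; exact (map_add (tensorResHom M N' i.op) a b).symm⟩

/-- Local isomorphisms are stable under tensor products. -/
instance isMonoidal_W [J.WEqualsLocallyBijective AddCommGrpCat.{u}] :
    (J.W.inverseImage (PresheafOfModules.toPresheaf.{u}
      (R ⋙ forget₂ CommRingCat RingCat))).IsMonoidal where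
  toIsMultiplicative := inferInstance
  whiskerLeft M N N' f hf := by
    rw [MorphismProperty.inverseImage_iff, J.W_iff_isLocallyBijective] at hf ⊢
    obtain ⟨_, _⟩ := hf
    exact ⟨locallyInjective_whiskerLeft J M f, locallySurjective_whiskerLeft J M f⟩
  whiskerRight {N N'} f hf M := by
    have h : J.W ((PresheafOfModules.toPresheaf _).map (M ◁ f)) := by
      rw [MorphismProperty.inverseImage_iff, J.W_iff_isLocallyBijective] at hf
      rw [J.W_iff_isLocallyBijective]
      obtain ⟨_, _⟩ := hf
      exact ⟨locallyInjective_whiskerLeft J M f, locallySurjective_whiskerLeft J M f⟩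
    refine ((MorphismProperty.arrow_mk_iso_iff
      (J.W.inverseImage (PresheafOfModules.toPresheaf (R ⋙ forget₂ CommRingCat RingCat)))
      (Arrow.isoMk (β_ N M) (β_ N' M) ?_)).2 h)
    simp

noncomputable section

open Functor.LaxMonoidal in
theorem bijective_μ_restrictScalars {A B : Type u} [CommRing A] [CommRing B] (f : A →+* B)
    (hf : Function.Bijective f) (M N : ModuleCat.{u} B) :
    IsIso (μ (ModuleCat.restrictScalars f) M N) := by
  let M' := (ModuleCat.restrictScalars f).obj M
  let N' := (ModuleCat.restrictScalars f).obj N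
  let g' : M' →+ N' →+ (M' : Type u) ⊗[A] (N' : Type u) :=
    AddMonoidHom.mk' (fun m => AddMonoidHom.mk' (fun n => m ⊗ₜ[A] n) (TensorProduct.tmul_add m))
      (fun m m' => by ext n; exact TensorProduct.add_tmul m m' n)
  let g : (M : Type u) ⊗[B] (N : Type u) →+ (M' : Type u) ⊗[A] (N' : Type u) :=
    TensorProduct.liftAddHom (R := B) (M := M) (N := N) g'
      (fun b m n => by
        obtain ⟨a, rfl⟩ := hf.2 b
        let m' : M' := m
        let n' : N' := n
        exact TensorProduct.smul_tmul a m' n')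
  have h1 (x) : g ((μ (ModuleCat.restrictScalars f) M N).hom x) = x := by
    induction x using TensorProduct.induction_on with
    | zero => exact (congrArg g (map_zero _)).trans (map_zero g)
    | tmul m n =>
      exact congrArg g (ModuleCat.restrictScalars_μ_tmul f M N m n)
    | add a b ha hb =>
      refine (congrArg g (map_add _ _ _)).trans ((map_add g _ _).trans ?_)
      exact congrArg₂ (· + ·) ha hb
  rw [ConcreteCategory.isIso_iff_bijective]
  refine ⟨Function.LeftInverse.injective h1, fun y => ?_⟩
  induction y using TensorProduct.induction_on with
  | zero => exact ⟨0, map_zero _⟩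
  | tmul m n => exact ⟨_, ModuleCat.restrictScalars_μ_tmul f M N m n⟩
  | add a b ha hb =>
    obtain ⟨x, hx⟩ := ha
    obtain ⟨y, hy⟩ := hb
    refine ⟨x + y, (map_add _ _ _).trans ?_⟩
    exact congrArg₂ (· + ·) hx hy

open Functor.LaxMonoidal in
theorem bijective_ε_restrictScalars {A B : Type u} [CommRing A] [CommRing B] (f : A →+* B)
    (hf : Function.Bijective f) : IsIso (ε (ModuleCat.restrictScalars.{u} f)) := by
  rw [ConcreteCategory.isIso_iff_bijective]
  have : (ConcreteCategory.hom (ε (ModuleCat.restrictScalars.{u} f)) : A → B) = f :=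
    funext fun r => ModuleCat.restrictScalars_η f r
  erw [this]
  exact hf

variable {S : Cᵒᵖ ⥤ CommRingCat.{u}} (α : R ⟶ S)

/-- Restriction of scalars of presheaves of modules along a morphism of presheaves of rings. -/
abbrev rsFunctor : PresheafOfModules.{u} (S ⋙ forget₂ CommRingCat RingCat) ⥤
    PresheafOfModules.{u} (R ⋙ forget₂ CommRingCat RingCat) :=
  PresheafOfModules.restrictScalars (Functor.whiskerRight α (forget₂ CommRingCat RingCat))

theorem bij [IsIso α] (U : Cᵒᵖ) : Function.Bijective (α.app U).hom :=
  (ConcreteCategory.isIso_iff_bijective (α.app U)).1 inferInstance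

/-- Restriction of scalars along a bijective ring homomorphism commutes with tensor products. -/
def μIsoRS {A B : Type u} [CommRing A] [CommRing B] (f : A →+* B)
    (hf : Function.Bijective f) (M N : ModuleCat.{u} B) :
    (ModuleCat.restrictScalars f).obj M ⊗ (ModuleCat.restrictScalars f).obj N ≅
      (ModuleCat.restrictScalars f).obj (M ⊗ N) :=
  haveI := bijective_μ_restrictScalars f hf M N
  asIso (Functor.LaxMonoidal.μ (ModuleCat.restrictScalars f) M N)

theorem μIsoRS_tmul {A B : Type u} [CommRing A] [CommRing B] (f : A →+* B)
    (hf : Function.Bijective f) (M N : ModuleCat.{u} B) (m : M) (n : N) :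
    (μIsoRS f hf M N).hom (TensorProduct.tmul A (M := (ModuleCat.restrictScalars f).obj M)
      (N := (ModuleCat.restrictScalars f).obj N) m n) = TensorProduct.tmul B m n :=
  ModuleCat.restrictScalars_μ_tmul f M N m n

/-- Restriction of scalars along a bijective ring homomorphism preserves the unit module. -/
def εIsoRS {A B : Type u} [CommRing A] [CommRing B] (f : A →+* B)
    (hf : Function.Bijective f) :
    𝟙_ (ModuleCat.{u} A) ≅ (ModuleCat.restrictScalars f).obj (𝟙_ (ModuleCat.{u} B)) :=
  haveI := bijective_ε_restrictScalars f hf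
  asIso (Functor.LaxMonoidal.ε (ModuleCat.restrictScalars.{u} f))

theorem εIsoRS_apply {A B : Type u} [CommRing A] [CommRing B] (f : A →+* B)
    (hf : Function.Bijective f) (a : A) : (εIsoRS f hf).hom a = f a :=
  ModuleCat.restrictScalars_η f a

open ModuleCat.MonoidalCategory in
/-- Restriction of scalars along an isomorphism of presheaves of rings commutes with tensor
products. -/
def rsμ [IsIso α] (M N : PresheafOfModules.{u} (S ⋙ forget₂ CommRingCat RingCat)) :
    (rsFunctor α).obj M ⊗ (rsFunctor α).obj N ≅ (rsFunctor α).obj (M ⊗ N) :=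
  PresheafOfModules.isoMk
    (fun U => μIsoRS (α.app U).hom (bij α U) (M.obj U) (N.obj U))
    (fun U V i => tensor_ext (fun m n => by
      exact (μIsoRS_tmul (α.app V).hom (bij α V) (M.obj V) (N.obj V) (M.map i m) (N.map i n)).trans
        (congrArg (fun x => (M ⊗ N).map i x)
          (μIsoRS_tmul (α.app U).hom (bij α U) (M.obj U) (N.obj U) m n)).symm))

/-- Restriction of scalars along an isomorphism of presheaves of rings preserves the unit. -/
def rsε [IsIso α] :
    𝟙_ (PresheafOfModules.{u} (R ⋙ forget₂ CommRingCat RingCat)) ≅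
      (rsFunctor α).obj (𝟙_ (PresheafOfModules.{u} (S ⋙ forget₂ CommRingCat RingCat))) :=
  PresheafOfModules.isoMk
    (fun U => εIsoRS (α.app U).hom (bij α U))
    (fun U V i => by
       ext
       refine (εIsoRS_apply (α.app V).hom (bij α V) ((R.map i).hom 1)).trans ?_
       refine Eq.trans ?_ (congrArg (fun x => (S.map i).hom x)
          (εIsoRS_apply (α.app U).hom (bij α U) 1)).symm
       simp only [map_one]
       rfl)

open Functor.LaxMonoidal ModuleCat.MonoidalCategory in
instance monoidalRS [IsIso α] : (rsFunctor α).Monoidal :=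
  Functor.CoreMonoidal.toMonoidal
    { εIso := rsε α
      μIso := rsμ α
      μIso_hom_natural_left {M N} f K := by
        ext1 U
        refine tensor_ext (fun m n => ?_)
        refine (μIsoRS_tmul (α.app U).hom (bij α U) (N.obj U) (K.obj U) (f.app U m) n).trans ?_
        exact (congrArg (fun x => (f ▷ K).app U x)
          (μIsoRS_tmul (α.app U).hom (bij α U) (M.obj U) (K.obj U) m n)).symm
      μIso_hom_natural_right {M N} K f := by
        ext1 U
        refine tensor_ext (fun m n => ?_)
        refine (μIsoRS_tmul (α.app U).hom (bij α U) (K.obj U) (N.obj U) m (f.app U n)).trans ?_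
        exact (congrArg (fun x => (K ◁ f).app U x)
          (μIsoRS_tmul (α.app U).hom (bij α U) (K.obj U) (M.obj U) m n)).symm
      associativity M N K := by
        ext1 U
        exact Functor.LaxMonoidal.associativity (F := ModuleCat.restrictScalars.{u} (α.app U).hom)
          (M.obj U) (N.obj U) (K.obj U)
      left_unitality M := by
        ext1 U
        exact Functor.LaxMonoidal.left_unitality (F := ModuleCat.restrictScalars.{u} (α.app U).hom)
          (M.obj U)
      right_unitality M := by
        ext1 U
        exact Functor.LaxMonoidal.right_unitality (F := ModuleCat.restrictScalars.{u} (α.app U).hom)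
          (M.obj U) }

variable (X : Scheme.{u})

instance : MonoidalCategory X.PresheafOfModules :=
  inferInstanceAs (MonoidalCategory
    (PresheafOfModules.{u} (X.presheaf ⋙ forget₂ CommRingCat RingCat)))

instance : SymmetricCategory X.PresheafOfModules :=
  inferInstanceAs (SymmetricCategory
    (PresheafOfModules.{u} (X.presheaf ⋙ forget₂ CommRingCat RingCat)))

/-- The class of morphisms of presheaves of modules which are locally bijective, i.e. which become
isomorphisms after sheafification. -/
abbrev locIso : MorphismProperty X.PresheafOfModules :=
  (Opens.grothendieckTopology X).W.inverseImage (PresheafOfModules.toPresheaf X.ringCatSheaf.obj)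

instance : (locIso X).IsMonoidal :=
  isMonoidal_W (Opens.grothendieckTopology X) (R := X.presheaf)

/-- Sheafification of presheaves of modules on a scheme. -/
def sheafifyModules : X.PresheafOfModules ⥤ X.Modules :=
  PresheafOfModules.sheafification (𝟙 X.ringCatSheaf.obj)

/-- Sheafification is left adjoint to the inclusion of sheaves in presheaves. -/
def sheafifyAdj : sheafifyModules X ⊣ Scheme.Modules.toPresheafOfModules X :=
  PresheafOfModules.sheafificationAdjunction (𝟙 X.ringCatSheaf.obj)

instance : (sheafifyModules X).IsLocalization (locIso X) :=
  inferInstanceAs ((PresheafOfModules.sheafification (𝟙 X.ringCatSheaf.obj)).IsLocalization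
    ((Opens.grothendieckTopology X).W.inverseImage (PresheafOfModules.toPresheaf _)))

/-- The structure sheaf as a module over itself. -/
def structureModule : X.Modules := SheafOfModules.unit X.ringCatSheaf

instance : IsIso (sheafifyAdj X).counit :=
  inferInstanceAs (IsIso (PresheafOfModules.sheafificationAdjunction (𝟙 X.ringCatSheaf.obj)).counit)

/-- The sheafification of the structure presheaf is the structure sheaf. -/
def sheafifyUnitIso : (sheafifyModules X).obj (𝟙_ X.PresheafOfModules) ≅ structureModule X :=
  (asIso (sheafifyAdj X).counit).app (structureModule X)

/-- The tensor product of sheaves of modules, i.e. the sheafification of the tensor product of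
presheaves of modules, with the structure sheaf as unit. -/
instance : MonoidalCategory X.Modules :=
  inferInstanceAs (MonoidalCategory
    (LocalizedMonoidal (sheafifyModules X) (locIso X) (sheafifyUnitIso X)))

instance : SymmetricCategory X.Modules :=
  inferInstanceAs (SymmetricCategory
    (LocalizedMonoidal (sheafifyModules X) (locIso X) (sheafifyUnitIso X)))

instance : (sheafifyModules X).Monoidal :=
  inferInstanceAs (Localization.Monoidal.toMonoidalCategory (sheafifyModules X) (locIso X)
    (sheafifyUnitIso X)).Monoidal

instance : (sheafifyModules X).Braided :=
  inferInstanceAs (Localization.Monoidal.toMonoidalCategory (sheafifyModules X) (locIso X)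
    (sheafifyUnitIso X)).Braided

section Mate

variable {C₁ D₁ C₂ D₂ : Type*} [Category* C₁] [Category* D₁] [Category* C₂] [Category* D₂]
  {L₁ : C₁ ⥤ D₁} {R₁ : D₁ ⥤ C₁} {L₂ : C₂ ⥤ D₂} {R₂ : D₂ ⥤ C₂} (adj₁ : L₁ ⊣ R₁) (adj₂ : L₂ ⊣ R₂)
  (G : C₁ ⥤ C₂) (H : D₁ ⥤ D₂) (e : R₁ ⋙ G ≅ H ⋙ R₂)

/-- The natural transformation `G ⋙ L₂ ⟶ L₁ ⋙ H` obtained by adjunction from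
`R₁ ⋙ G ≅ H ⋙ R₂`. -/
def adjointMate : G ⋙ L₂ ⟶ L₁ ⋙ H where
  app P := L₂.map (G.map (adj₁.unit.app P) ≫ e.hom.app (L₁.obj P)) ≫
    adj₂.counit.app (H.obj (L₁.obj P))
  naturality P Q g := by
    have h1 := adj₁.unit.naturality g
    have h2 := adj₂.counit.naturality (H.map (L₁.map g))
    have h3 := e.hom.naturality (L₁.map g)
    dsimp at h1 h2 h3 ⊢
    have h4 : G.map g ≫ G.map (adj₁.unit.app Q) ≫ e.hom.app (L₁.obj Q) =
        (G.map (adj₁.unit.app P) ≫ e.hom.app (L₁.obj P)) ≫ R₂.map (H.map (L₁.map g)) := by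
      rw [← Functor.map_comp_assoc, h1, Functor.map_comp, Category.assoc, h3, Category.assoc]
    rw [← Functor.map_comp_assoc, h4, Functor.map_comp, Category.assoc, h2, Category.assoc]

theorem isIso_adjointMate [IsIso adj₂.counit]
    (h : ∀ P, IsIso (L₂.map (G.map (adj₁.unit.app P)))) :
    IsIso (adjointMate adj₁ adj₂ G H e) := by
  rw [NatTrans.isIso_iff_isIso_app]
  intro P
  have := h P
  dsimp [adjointMate]
  rw [Functor.map_comp]
  infer_instance

end Mate

section Pushforward
variable {X} {Y : Scheme.{u}} (f : X ⟶ Y)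

/-- The pushforward of presheaves of modules. -/
def prePush : X.PresheafOfModules ⥤ Y.PresheafOfModules :=
  PresheafOfModules.pushforward f.toRingCatSheafHom.hom

instance [IsIso f] : (prePush f).Monoidal :=
  haveI : IsIso f.c := inferInstance
  haveI : (rsFunctor f.c).Monoidal := monoidalRS (R := Y.presheaf)
    (S := (TopologicalSpace.Opens.map f.base).op ⋙ X.presheaf) f.c
  inferInstanceAs ((PresheafOfModules.pushforward₀OfCommRingCat
    (TopologicalSpace.Opens.map f.base) X.presheaf ⋙ rsFunctor f.c).Monoidal)

theorem isCocontinuous_opensMap [IsIso f] : (TopologicalSpace.Opens.map f.base).IsCocontinuous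
    (Opens.grothendieckTopology Y) (Opens.grothendieckTopology X) where
  cover_lift {U S} hS := by
    intro y hy
    have hxy (z) : f ((inv f) z) = z := by
      rw [← Scheme.Hom.comp_apply]; simp
    obtain ⟨V, i, hi, hV⟩ := hS ((inv f) y) (show f _ ∈ U by rw [hxy]; exact hy)
    have hle : f ⁻¹ᵁ ((inv f) ⁻¹ᵁ V) = V := by
      rw [← Scheme.Hom.comp_preimage]; simp
    refine ⟨(inv f) ⁻¹ᵁ V, homOfLE ?_, ?_, hV⟩
    · intro z hz
      have : f ((inv f) z) ∈ U := leOfHom i hz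
      rwa [hxy] at this
    · exact S.downward_closed hi (homOfLE hle.le)

theorem locIso_prePush [IsIso f] {P Q : X.PresheafOfModules} (g : P ⟶ Q) (hg : locIso X g) :
    locIso Y ((prePush f).map g) := by
  have hg' : (Opens.grothendieckTopology X).W
    ((PresheafOfModules.toPresheaf X.ringCatSheaf.obj).map g) := hg
  rw [GrothendieckTopology.W_iff_isLocallyBijective] at hg'
  obtain ⟨_, _⟩ := hg'
  have := isCocontinuous_opensMap f
  refine ((Opens.grothendieckTopology Y).W_iff_isLocallyBijective _).2 ⟨
    Presheaf.isLocallyInjective_whisker (Opens.grothendieckTopology Y)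
      (Opens.grothendieckTopology X) (TopologicalSpace.Opens.map f.base)
      ((PresheafOfModules.toPresheaf X.ringCatSheaf.obj).map g),
    Presheaf.isLocallySurjective_whisker (Opens.grothendieckTopology Y)
      (Opens.grothendieckTopology X) (TopologicalSpace.Opens.map f.base)
      ((PresheafOfModules.toPresheaf X.ringCatSheaf.obj).map g)⟩

/-- Pushforward of presheaves of modules is compatible with the inclusion of sheaves. -/
def inclusionPush : Scheme.Modules.toPresheafOfModules X ⋙ prePush f ≅
    Scheme.Modules.pushforward f ⋙ Scheme.Modules.toPresheafOfModules Y :=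
  Iso.refl _

/-- The comparison map between the direct image of the sheafification and the sheafification of the
direct image. -/
def sheafifyPush : prePush f ⋙ sheafifyModules Y ⟶
    sheafifyModules X ⋙ Scheme.Modules.pushforward f :=
  adjointMate (sheafifyAdj X) (sheafifyAdj Y) _ _ (inclusionPush f)

theorem locIso_unit (P : X.PresheafOfModules) : locIso X ((sheafifyAdj X).unit.app P) :=
  (Opens.grothendieckTopology X).W_toSheafify P.presheaf

instance [IsIso f] : IsIso (sheafifyPush f) :=
  isIso_adjointMate _ _ _ _ _ fun P =>
    Localization.inverts (sheafifyModules Y) (locIso Y) _ (locIso_prePush f _ (locIso_unit P))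

instance [IsIso f] : Localization.Lifting (sheafifyModules X) (locIso X)
    (prePush f ⋙ sheafifyModules Y) (Scheme.Modules.pushforward f) where
  iso := (asIso (sheafifyPush f)).symm

/-- The direct image along an isomorphism commutes with tensor products of sheaves of modules. -/
instance [IsIso f] : (Scheme.Modules.pushforward f).Monoidal :=
  Localization.Monoidal.functorMonoidalOfComp (sheafifyModules X) (locIso X)
    (Scheme.Modules.pushforward f) (prePush f ⋙ sheafifyModules Y)

end Pushforward

/-- The canonical map from the tensor product of presheaves to the tensor product of sheaves. -/
instance laxMonoidalInclusion : (Scheme.Modules.toPresheafOfModules X).LaxMonoidal :=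
  (sheafifyAdj X).rightAdjointLaxMonoidal

/-- The pure tensor `a ⊗ b` of two sections of presheaves of modules, as a biadditive map. -/
def preTensor (M N : PresheafOfModules.{u} (R ⋙ forget₂ CommRingCat RingCat)) (U : Cᵒᵖ) :
    (M.obj U : Type u) →+ (N.obj U : Type u) →+ ((M ⊗ N).obj U : Type u) :=
  letI t (a : M.obj U) (b : N.obj U) : ((M ⊗ N).obj U : Type u) := a ⊗ₜ[R.obj U] b
  AddMonoidHom.mk' (fun a => AddMonoidHom.mk' (t a) (TensorProduct.tmul_add a))
    (fun a a' => by ext b; exact TensorProduct.add_tmul a a' b)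

section Sections
variable {X}

/-- The global sections `H⁰(X, M) = Γ(X, M)` of a sheaf of modules. -/
abbrev H0 (M : X.Modules) : Type u := Γ(M, ⊤)

/-- The map on global sections induced by a morphism of sheaves of modules. -/
def H0map {M N : X.Modules} (g : M ⟶ N) : H0 M →+ H0 N := (g.app ⊤).hom

/-- The tensor product `a ⊗ b ∈ H⁰(X, M ⊗ N)` of global sections `a ∈ H⁰(X, M)`, `b ∈ H⁰(X, N)`:
the image of `a ⊗ b ∈ M(X) ⊗ N(X)` under the canonical map from the presheaf tensor product to the
tensor product of sheaves. -/
def H0tensor (M N : X.Modules) : H0 M →+ H0 N →+ H0 (M ⊗ N) :=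
  letI m : ((((Scheme.Modules.toPresheafOfModules X).obj M ⊗
        (Scheme.Modules.toPresheafOfModules X).obj N :
      X.PresheafOfModules)).obj (op ⊤) : Type u) →+ H0 (M ⊗ N) :=
    ((Functor.LaxMonoidal.μ (Scheme.Modules.toPresheafOfModules X) M N).app
      (op ⊤)).hom.toAddMonoidHom
  (AddMonoidHom.compHom m).comp (preTensor (R := X.presheaf) M.val N.val (op ⊤))

end Sections

section Aut
variable {X}

/-- The pullback `σ^*` of sheaves of modules along an automorphism `σ`, realized as the direct
image along `σ⁻¹`, so that `(σ^* M)(U) = M(σ(U))`. -/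
def pull (σ : X ≅ X) : X.Modules ⥤ X.Modules := Scheme.Modules.pushforward σ.inv

instance (σ : X ≅ X) : (pull σ).Monoidal :=
  inferInstanceAs (Scheme.Modules.pushforward σ.inv).Monoidal

/-- Direct image along `σ⁻¹` is an equivalence with inverse the direct image along `σ`. -/
def pushforwardEquivalence (σ : X ≅ X) : X.Modules ≌ X.Modules :=
  CategoryTheory.Equivalence.mk (Scheme.Modules.pushforward σ.inv)
    (Scheme.Modules.pushforward σ.hom)
    ((Scheme.Modules.pushforwardId X).symm ≪≫ Scheme.Modules.pushforwardCongr (by simp) ≪≫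
      (Scheme.Modules.pushforwardComp _ _).symm)
    (Scheme.Modules.pushforwardComp _ _ ≪≫ Scheme.Modules.pushforwardCongr (by simp) ≪≫
      Scheme.Modules.pushforwardId X)

/-- The functor `pull σ` agrees with the inverse image functor `σ^*`. -/
def pullIsoPullback (σ : X ≅ X) : pull σ ≅ Scheme.Modules.pullback σ.hom :=
  Adjunction.leftAdjointUniq (pushforwardEquivalence σ).toAdjunction
    (Scheme.Modules.pullbackPushforwardAdjunction σ.hom)

/-- The isomorphism `id^* ≅ id`. -/
def pullRefl : pull (Iso.refl X) ≅ 𝟭 _ := Scheme.Modules.pushforwardId X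

/-- The isomorphism `σ^* τ^* ≅ (τ σ)^*`. -/
def pullTrans (σ τ : X ≅ X) : pull τ ⋙ pull σ ≅ pull (σ ≪≫ τ) :=
  Scheme.Modules.pushforwardComp τ.inv σ.inv

/-- The isomorphism between the pullbacks along equal automorphisms. -/
def pullCongr {σ τ : X ≅ X} (h : σ = τ) : pull σ ≅ pull τ := eqToIso (congrArg pull h)

/-- The pullback `σ : H⁰(X, M) → H⁰(X, σ^* M)` of global sections. -/
def H0pull (σ : X ≅ X) (M : X.Modules) : H0 M →+ H0 ((pull σ).obj M) :=
  (M.presheaf.map (homOfLE le_top : σ.inv ⁻¹ᵁ ⊤ ⟶ ⊤).op).hom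
end Aut

section Bimodules
variable {X}

/-- A sheaf of modules is invertible if it is locally free of rank one, i.e. locally isomorphic to
the structure sheaf. -/
def IsInvertible (M : X.Modules) : Prop :=
  ∀ x : X, ∃ U : X.Opens, x ∈ U ∧ Nonempty (M.restrict U.ι ≅ structureModule U)

variable (X) in
/-- A bimodule `L_σ` on `X`: a sheaf of modules `L` together with an automorphism `σ` of `X`. -/
structure TwistedBimod where
  /-- the underlying sheaf `L` -/
  sheaf : X.Modules
  /-- the automorphism `σ` -/
  aut : X ≅ X

namespace TwistedBimod

/-- The left action `L_σ ⊗ F = L ⊗ σ^* F` of a bimodule on a sheaf. -/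
def act (A : TwistedBimod X) (F : X.Modules) : X.Modules := A.sheaf ⊗ (pull A.aut).obj F

/-- Functoriality of `L_σ ⊗ F` in `F`; on isomorphisms this is `1 ⊗ e`. -/
def actMap (A : TwistedBimod X) {F G : X.Modules} (e : F ≅ G) : A.act F ≅ A.act G :=
  whiskerLeftIso A.sheaf ((pull A.aut).mapIso e)

/-- The tensor product `L_σ ⊗ M_τ = (L ⊗ σ^* M)_{τ σ}`. -/
def tensor (A B : TwistedBimod X) : TwistedBimod X := ⟨A.act B.sheaf, A.aut ≪≫ B.aut⟩

variable (X) in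
/-- The unit bimodule, with underlying sheaf the structure sheaf. -/
def unit : TwistedBimod X := ⟨𝟙_ X.Modules, Iso.refl X⟩

/-- The canonical isomorphism `L_σ ⊗ (M_τ ⊗ F) ≅ (L_σ ⊗ M_τ) ⊗ F`. -/
def actAct (A B : TwistedBimod X) (F : X.Modules) : A.act (B.act F) ≅ (A.tensor B).act F :=
  whiskerLeftIso A.sheaf
      (Functor.Monoidal.μIso (pull A.aut) B.sheaf ((pull B.aut).obj F)).symm ≪≫
    (α_ _ _ _).symm ≪≫ whiskerLeftIso _ ((pullTrans A.aut B.aut).app F)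

/-- The canonical isomorphism between the action of the unit bimodule and the identity. -/
def unitAct (F : X.Modules) : (unit X).act F ≅ F :=
  whiskerLeftIso _ (pullRefl.app F) ≪≫ λ_ F

/-- The action on a fixed sheaf of an isomorphism `φ` of bimodules with equal automorphisms;
this is `φ ⊗ 1_F`. -/
def mapAct {A B : TwistedBimod X} (φ : A.sheaf ≅ B.sheaf) (h : A.aut = B.aut) (F : X.Modules) :
    A.act F ≅ B.act F :=
  φ ⊗ᵢ (pullCongr h).app F

/-- Given an isomorphism `φ : A ⊗ B ≅ B ⊗ A`, the isomorphism
`φ ⊗ 1_F : A ⊗ (B ⊗ F) ≅ B ⊗ (A ⊗ F)`. -/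
def swapAct {A B : TwistedBimod X} (φ : (A.tensor B).sheaf ≅ (B.tensor A).sheaf)
    (h : A.aut ≪≫ B.aut = B.aut ≪≫ A.aut) (F : X.Modules) :
    A.act (B.act F) ≅ B.act (A.act F) :=
  actAct A B F ≪≫ mapAct φ h F ≪≫ (actAct B A F).symm

/-- For a bimodule `L_σ`, the bimodule `((σ⁻¹)^* L)_{σ⁻¹}`. -/
def flip (A : TwistedBimod X) : TwistedBimod X := ⟨(pull A.aut.symm).obj A.sheaf, A.aut.symm⟩

/-- Functoriality of `flip` for isomorphisms of bimodules with equal automorphisms. -/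
def flipMap {A B : TwistedBimod X} (φ : A.sheaf ≅ B.sheaf) (h : A.aut = B.aut) :
    A.flip.sheaf ≅ B.flip.sheaf :=
  (pull A.aut.symm).mapIso φ ≪≫ (pullCongr (congrArg Iso.symm h)).app B.sheaf

/-- The canonical isomorphism `σ^* (σ⁻¹)^* M ≅ M`. -/
def pullSymm (σ : X ≅ X) (M : X.Modules) : (pull σ).obj ((pull σ.symm).obj M) ≅ M :=
  (pullTrans σ σ.symm).app M ≪≫ (pullCongr σ.self_symm_id).app M ≪≫ pullRefl.app M

/-- The canonical isomorphism `(A ⊗ B)^flip ≅ B^flip ⊗ A^flip`, i.e. for `A = L_σ` and `B = M_τ`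
the isomorphism
`((τ σ)⁻¹)^* (L ⊗ σ^* M) ≅ (τ⁻¹)^* (σ⁻¹)^* L ⊗ (τ⁻¹)^* M ≅ (τ⁻¹)^* M ⊗ (τ⁻¹)^* (σ⁻¹)^* L`. -/
def flipTensor (A B : TwistedBimod X) :
    (A.tensor B).flip.sheaf ≅ (B.flip.tensor A.flip).sheaf :=
  ((pullTrans B.aut.symm A.aut.symm).app _).symm ≪≫
    (pull B.aut.symm).mapIso
      ((Functor.Monoidal.μIso (pull A.aut.symm) A.sheaf ((pull A.aut).obj B.sheaf)).symm ≪≫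
        whiskerLeftIso _ (pullSymm A.aut.symm B.sheaf)) ≪≫
    (Functor.Monoidal.μIso (pull B.aut.symm) A.flip.sheaf B.sheaf).symm ≪≫
    β_ _ _

/-- The product `L_{i₁} ⊗ ⋯ ⊗ L_{iᵣ}` of bimodules indexed by a word `[i₁, …, iᵣ]`. -/
def prod {ι : Type*} (L : ι → TwistedBimod X) : List ι → TwistedBimod X
  | [] => unit X
  | i :: w => (L i).tensor (prod L w)

/-- The canonical isomorphism between `P_v ⊗ P_w` and `P_{v ++ w}`, for products of bimodules
indexed by words `v` and `w`. -/
def prodAppend {ι : Type*} (L : ι → TwistedBimod X) :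
    (v w : List ι) → ((prod L v).tensor (prod L w)).sheaf ≅ (prod L (v ++ w)).sheaf
  | [], w => unitAct (prod L w).sheaf
  | i :: v, w => (actAct (L i) (prod L v) (prod L w).sheaf).symm ≪≫
      (L i).actMap (prodAppend L v w)

theorem prod_append_aut {ι : Type*} (L : ι → TwistedBimod X) (v w : List ι) :
    (prod L (v ++ w)).aut = (prod L v).aut ≪≫ (prod L w).aut := by
  induction v with
  | nil => exact (Iso.refl_trans _).symm
  | cons i v ih =>
    change (L i).aut ≪≫ (prod L (v ++ w)).aut = ((L i).aut ≪≫ (prod L v).aut) ≪≫ (prod L w).aut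
    rw [ih, Iso.trans_assoc]

/-- The isomorphism between products over equal words. -/
def prodCongr {ι : Type*} (L : ι → TwistedBimod X) {v w : List ι} (h : v = w) :
    (prod L v).sheaf ≅ (prod L w).sheaf :=
  eqToIso (by rw [h])

end TwistedBimod

/-- Pairwise commutation relations on a finite family of bimodules `(L_i)_{σ_i}`: the automorphisms
commute, and for all `i < j` there is a chosen isomorphism `φ_{ij} : L_j ⊗ L_i ≅ L_i ⊗ L_j` of
bimodules. -/
structure CommRel {s : ℕ} (L : Fin s → TwistedBimod X) where
  /-- the automorphisms commute -/
  comm (i j : Fin s) : (L i).aut ≪≫ (L j).aut = (L j).aut ≪≫ (L i).aut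
  /-- the isomorphisms `φ_{ij}` for `i < j` -/
  iso (i j : Fin s) (h : i < j) : ((L j).tensor (L i)).sheaf ≅ ((L i).tensor (L j)).sheaf

namespace CommRel
variable {s : ℕ} {L : Fin s → TwistedBimod X} (φ : CommRel L)

/-- The isomorphism `φ_{ij} ⊗ 1_F`. -/
def swap {i j : Fin s} (h : i < j) (F : X.Modules) :
    (L j).act ((L i).act F) ≅ (L i).act ((L j).act F) :=
  TwistedBimod.swapAct (φ.iso i j h) (φ.comm j i) F

/-- Compatibility on overlaps: for `i < j < k` the two ways of reordering
`L_k ⊗ L_j ⊗ L_i` to `L_i ⊗ L_j ⊗ L_k` agree. -/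
def Compatible : Prop :=
  ∀ (i j k : Fin s) (hij : i < j) (hjk : j < k),
    φ.swap hjk (L i).sheaf ≪≫ (L j).actMap (φ.iso i k (hij.trans hjk)) ≪≫
        φ.swap hij (L k).sheaf =
      (L k).actMap (φ.iso i j hij) ≪≫ φ.swap (hij.trans hjk) (L j).sheaf ≪≫
        (L i).actMap (φ.iso j k hjk)

/-- The commutation relations on the family `((σ_i⁻¹)^* L_i)_{σ_i⁻¹}` induced by those of
`(L_i)_{σ_i}`: for `i < j` one pulls back the inverse of `φ_{ij}`, which is an isomorphism
`L_i ⊗ σ_i^* L_j ≅ L_j ⊗ σ_j^* L_i`, along `σ_i⁻¹ σ_j⁻¹`. -/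
def flip : CommRel fun i => (L i).flip where
  comm i j := (congrArg Iso.symm (φ.comm j i) :)
  iso i j h := (TwistedBimod.flipTensor (L i) (L j)).symm ≪≫
    TwistedBimod.flipMap (φ.iso i j h).symm (φ.comm i j) ≪≫ TwistedBimod.flipTensor (L j) (L i)

/-- Moving a letter to its place in a product over a word, by means of the commutation
relations. -/
def insertIso (i : Fin s) : (w : List (Fin s)) →
    (TwistedBimod.prod L (i :: w)).sheaf ≅ (TwistedBimod.prod L (w.orderedInsert (· ≤ ·) i)).sheaf
  | [] => Iso.refl _
  | j :: w =>
    if h : i ≤ j then TwistedBimod.prodCongr L (by rw [List.orderedInsert_cons, if_pos h])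
    else φ.swap (not_le.1 h) (TwistedBimod.prod L w).sheaf ≪≫ (L j).actMap (insertIso i w) ≪≫
      TwistedBimod.prodCongr L (v := j :: w.orderedInsert (· ≤ ·) i)
        (by rw [List.orderedInsert_cons, if_neg h])

/-- Reordering the factors of a product over a word in nondecreasing order, by means of the
commutation relations. -/
def sortIso : (w : List (Fin s)) →
    (TwistedBimod.prod L w).sheaf ≅ (TwistedBimod.prod L (w.insertionSort (· ≤ ·))).sheaf
  | [] => Iso.refl _
  | i :: w => (L i).actMap (sortIso w) ≪≫ φ.insertIso i (w.insertionSort (· ≤ ·))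

end CommRel

/-- The word `1 ⋯ 1 2 ⋯ 2 ⋯ s ⋯ s` in which the letter `i` is repeated `n i` times. -/
def multiWord {s : ℕ} (n : Fin s → ℕ) : List (Fin s) :=
  (List.finRange s).flatMap fun i => List.replicate (n i) i

theorem pairwise_multiWord {s : ℕ} (n : Fin s → ℕ) : (multiWord n).Pairwise (· ≤ ·) := by
  refine List.pairwise_flatMap.2 ⟨fun i _ => ?_, ?_⟩
  · exact List.pairwise_replicate.2 (Or.inr le_rfl)
  · refine (List.pairwise_lt_finRange s).imp fun {i j} h x hx y hy => ?_
    rw [List.eq_of_mem_replicate hx, List.eq_of_mem_replicate hy]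
    exact h.le

theorem count_multiWord {s : ℕ} (n : Fin s → ℕ) (i : Fin s) : (multiWord n).count i = n i := by
  simp [multiWord, List.count_flatMap, Function.comp_def, List.count_replicate, ← List.ofFn_eq_map,
    List.sum_ofFn]

theorem insertionSort_eq_multiWord {s : ℕ} (w : List (Fin s)) (n : Fin s → ℕ)
    (h : ∀ i, w.count i = n i) : w.insertionSort (· ≤ ·) = multiWord n := by
  refine List.Perm.eq_of_pairwise' (List.pairwise_insertionSort (· ≤ ·) w) (pairwise_multiWord n) ?_
  refine (List.perm_insertionSort (· ≤ ·) w).trans (List.perm_iff_count.2 fun i => ?_)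
  rw [h, count_multiWord]

namespace CommRel
variable {s : ℕ} {L : Fin s → TwistedBimod X} (φ : CommRel L)

/-- The canonical identification, given by the commutation relations, of the product over a word
`w` containing each letter `i` exactly `n i` times with `L_1^{n_1} ⋯ L_s^{n_s}`. -/
def toMultiWord (w : List (Fin s)) (n : Fin s → ℕ) (h : ∀ i, w.count i = n i) :
    (TwistedBimod.prod L w).sheaf ≅ (TwistedBimod.prod L (multiWord n)).sheaf :=
  φ.sortIso w ≪≫ TwistedBimod.prodCongr L (insertionSort_eq_multiWord w n h)

end CommRel

namespace TwistedBimod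

theorem prod_reverse_cons_aut {s : ℕ} (L : Fin s → TwistedBimod X) (i : Fin s)
    (v : List (Fin s)) :
    (prod L (i :: v).reverse).aut = ((prod L v.reverse).tensor (L i)).aut := by
  rw [List.reverse_cons, prod_append_aut]
  exact congrArg ((prod L v.reverse).aut ≪≫ ·) (Iso.trans_refl _)

/-- The canonical isomorphism `P_v ⊗ L_i ≅ P_{v i}`. -/
def prodSnoc {ι : Type*} (L : ι → TwistedBimod X) (v : List ι) (i : ι) :
    ((prod L v).tensor (L i)).sheaf ≅ (prod L (v ++ [i])).sheaf :=
  (prod L v).actMap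
      ((ρ_ _).symm ≪≫ whiskerLeftIso _ (Functor.Monoidal.εIso (pull (L i).aut))) ≪≫
    prodAppend L v [i]

/-- The canonical isomorphism between `(L_{iᵣ} ⊗ ⋯ ⊗ L_{i₁})^flip` and
`L_{i₁}^flip ⊗ ⋯ ⊗ L_{iᵣ}^flip` for a word `i₁ ⋯ iᵣ`. -/
def flipProd {s : ℕ} (L : Fin s → TwistedBimod X) : (w : List (Fin s)) →
    (prod L w.reverse).flip.sheaf ≅ (prod (fun i => (L i).flip) w).sheaf
  | [] => pullRefl.app (𝟙_ X.Modules)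
  | i :: v =>
    flipMap (prodCongr L List.reverse_cons ≪≫ (prodSnoc L v.reverse i).symm)
        (prod_reverse_cons_aut L i v) ≪≫
      flipTensor (prod L v.reverse) (L i) ≪≫
      (L i).flip.actMap (flipProd L v)

end TwistedBimod

section Ring
attribute [local instance] MvPolynomial.gradedAlgebra
variable {k : Type u} [Field k] {s : ℕ} {L : Fin s → TwistedBimod X}

/-- The ring homomorphism `k → Γ(X, 𝒪_X)` given by a structure morphism `X ⟶ Spec k`. -/
def scalars (f : X ⟶ Spec (.of k)) : k →+* Γ(X, ⊤) :=
  f.appTop.hom.comp (Scheme.ΓSpecIso (.of k)).inv.hom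

/-- A scheme `f : X ⟶ Spec k` over a field is projective if there is a closed immersion of
`k`-schemes of `X` into some projective space `ℙⁿ_k = Proj k[x_0, …, x_n]`. -/
def IsProjectiveOver (f : X ⟶ Spec (.of k)) : Prop :=
  ∃ (n : ℕ) (i : X ⟶ Proj (MvPolynomial.homogeneousSubmodule (Fin (n + 1)) k)),
    IsClosedImmersion i ∧
      i ≫ Proj.toSpecZero (MvPolynomial.homogeneousSubmodule (Fin (n + 1)) k) ≫
        Spec.map (CommRingCat.ofHom
          (algebraMap k (MvPolynomial.homogeneousSubmodule (Fin (n + 1)) k 0))) = f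

/-- The piece `B_n = H⁰(X, L_1^{n_1} ⋯ L_s^{n_s})`. It depends on the structure morphism and on the
commutation relations only through the `k`-module structure and the multiplication below. -/
def Piece (_f : X ⟶ Spec (.of k)) (_φ : CommRel L) (n : Fin s → ℕ) : Type u :=
  H0 (TwistedBimod.prod L (multiWord n)).sheaf

variable (f : X ⟶ Spec (.of k)) (φ : CommRel L)

instance (n : Fin s → ℕ) : AddCommGroup (Piece f φ n) :=
  inferInstanceAs (AddCommGroup (H0 (TwistedBimod.prod L (multiWord n)).sheaf))

instance (n : Fin s → ℕ) : Module k (Piece f φ n) :=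
  Module.compHom (H0 (TwistedBimod.prod L (multiWord n)).sheaf) (scalars f)

theorem count_multiWord_append (m n : Fin s → ℕ) (i : Fin s) :
    (multiWord m ++ multiWord n).count i = (m + n) i := by
  rw [List.count_append, count_multiWord, count_multiWord, Pi.add_apply]

theorem count_multiWord_reverse (n : Fin s → ℕ) (i : Fin s) :
    (multiWord n).reverse.count i = n i := by
  rw [List.count_reverse, count_multiWord]

/-- The multiplication `B_m × B_n → B_{m+n}`, `a · b = a ⊗ σ^m(b)`, where `σ^m` is the automorphism
`σ_1^{m_1} ⋯ σ_s^{m_s}` underlying `L_1^{m_1} ⋯ L_s^{m_s}`, and where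
`L_1^{m_1} ⋯ L_s^{m_s} L_1^{n_1} ⋯ L_s^{n_s}` is identified with
`L_1^{m_1 + n_1} ⋯ L_s^{m_s + n_s}` by the commutation relations. -/
def pieceMul {m n : Fin s → ℕ} (a : Piece f φ m) (b : Piece f φ n) : Piece f φ (m + n) :=
  H0map (TwistedBimod.prodAppend L (multiWord m) (multiWord n) ≪≫
      φ.toMultiWord (multiWord m ++ multiWord n) (m + n) (count_multiWord_append m n)).hom
    (H0tensor _ _ a (H0pull (TwistedBimod.prod L (multiWord m)).aut _ b))

instance : DirectSum.GNonUnitalNonAssocSemiring (Piece f φ) where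
  mul := pieceMul f φ
  mul_zero a := by simp only [pieceMul]; erw [map_zero, map_zero, map_zero]; rfl
  zero_mul b := by simp only [pieceMul]; erw [map_zero, AddMonoidHom.zero_apply, map_zero]; rfl
  mul_add a b c := by simp only [pieceMul]; erw [map_add, map_add, map_add]; rfl
  add_mul a b c := by simp only [pieceMul]; erw [map_add, AddMonoidHom.add_apply, map_add]; rfl

theorem multiWord_zero : multiWord (0 : Fin s → ℕ) = [] := by
  simp [multiWord]

/-- The element `1 ∈ B_0 = H⁰(X, 𝒪_X)`. -/
instance : GradedMonoid.GOne (Piece f φ) where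
  one := H0map (TwistedBimod.prodCongr L (multiWord_zero (s := s)).symm).hom
    (show H0 (structureModule X) from (1 : Γ(X, ⊤)))

/-- The twisted multi-homogeneous coordinate ring `B = ⨁ₙ B_n`. -/
def TwistedRing : Type u := DirectSum (Fin s → ℕ) (Piece f φ)

instance : NonUnitalNonAssocSemiring (TwistedRing f φ) :=
  inferInstanceAs (NonUnitalNonAssocSemiring (DirectSum (Fin s → ℕ) (Piece f φ)))

instance : One (TwistedRing f φ) :=
  inferInstanceAs (One (DirectSum (Fin s → ℕ) (Piece f φ)))

instance : Module k (TwistedRing f φ) :=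
  inferInstanceAs (Module k (DirectSum (Fin s → ℕ) (Piece f φ)))

/-- The inclusion `B_n → B`. -/
def TwistedRing.of (n : Fin s → ℕ) : Piece f φ n →+ TwistedRing f φ :=
  DirectSum.of (Piece f φ) n

/-- The ring axioms (for a biadditive multiplication with a distinguished element `1`), together
with the bilinearity of the multiplication over `k`. -/
structure IsAssocUnitalAlgebra (k A : Type*) [Field k] [NonUnitalNonAssocSemiring A] [One A]
    [Module k A] : Prop where
  mul_assoc (a b c : A) : a * b * c = a * (b * c)
  one_mul (a : A) : 1 * a = a
  mul_one (a : A) : a * 1 = a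
  smul_mul (c : k) (a b : A) : c • a * b = c • (a * b)
  mul_smul (c : k) (a b : A) : a * c • b = c • (a * b)

/-- For the ring `B'` of `(L_i)_{σ_i}` and the ring `B` of `((σ_i⁻¹)^* L_i)_{σ_i⁻¹}`, the map
`B_n → B'_n`, `a ↦ σ_1^{n_1} ⋯ σ_s^{n_s}(a)`. The pullback along `σ^n` of the sheaf underlying
`(L_1^flip)^{n_1} ⋯ (L_s^flip)^{n_s}` is canonically isomorphic to
`L_s^{n_s} ⋯ L_1^{n_1}`, hence by the commutation relations to `L_1^{n_1} ⋯ L_s^{n_s}`. -/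
def twist (n : Fin s → ℕ) (a : Piece f φ.flip n) : Piece f φ n :=
  H0map ((pull (TwistedBimod.prod L (multiWord n).reverse).aut).mapIso
        (TwistedBimod.flipProd L (multiWord n)).symm ≪≫
      TwistedBimod.pullSymm (TwistedBimod.prod L (multiWord n).reverse).aut _ ≪≫
      φ.toMultiWord (multiWord n).reverse n (count_multiWord_reverse n)).hom
    (H0pull (TwistedBimod.prod L (multiWord n).reverse).aut _ a)

end Ring
end Bimodules

end

end TwistedCoordinateRing

open TwistedCoordinateRing

/-! Bimodules `L_σ` with the product of the statement form a monoidal category, and the theorem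
rests on two facts about it: a coherence theorem for reorderings, and the fact that `flip` reverses
tensor products.

Coherence: call a reordering any composite of maps `1 ⊗ φ_{ij}^{±1} ⊗ 1` between products over words
in the letters `1, …, s`. Compatibility is the Yang–Baxter equation for three distinct letters, and
equal letters are never interchanged. Hence there is at most one reordering between two given words
(`WordProd.Reorder.unique`): insertion sort provides a normal form, and
`WordProd.insertIso_insertIso` shows that it absorbs an interchange of neighbours. A section of the
product over any word `w` therefore has a class `ofWord w` in the ring which no reordering changes,
and classes multiply by concatenating words and tensoring sections
(`CommRel.Compatible.ofWord_mul`). Associativity and the unit laws then reduce to the associator and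
the unitors on pure tensors; bilinearity over `k` holds because the `σ_i` are automorphisms over
`k`.

Reversal: `L_σ ↦ ((σ⁻¹)^* L)_{σ⁻¹}` is a functor exchanging the two factors of a tensor product
(`flipReversing`), and `ψ_{ij}` is the image of `φ_{ij}⁻¹`. So it carries the product over a
reversed word to the product over the word, and every reordering by `ψ` comes from one by `φ`
(`ReversingFunctor.exists_reorder`). On global sections this gives a bijection `unpull`, which
undoes the pullback in `τ` and reverses products (`unpull_mul`). Thus `τ` sends the class of `unpull
a` over `w` to the class of `a` over the reversed word, and is an anti-isomorphism.

Underneath lies a calculus of sections. The tensor product of sheaves is a sheafification, so its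
pure tensors generate locally (`Gen.tm`), and an identity of morphisms may be tested on them. The
values of the structure maps on pure tensors are read off from presheaves, the inclusion of sheaves
being lax monoidal and compatible with pullback (`mate_μ`). -/

namespace TwistedCoordinateRing

/-! ### Lax monoidal right adjoints and monoidal mates. -/

section MonoidalAdjunction
open Functor.LaxMonoidal Functor.OplaxMonoidal

variable {C D : Type*} [Category* C] [Category* D] [MonoidalCategory C] [MonoidalCategory D]
  {S : C ⥤ D} {G : D ⥤ C} (adj : S ⊣ G)

/-- The transpose of `μ G` across the adjunction is `δ S` followed by the tensor product of the
counits; both respect braidings, the first because `S` is braided. -/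
theorem rightAdjoint_μ_braiding [BraidedCategory C] [BraidedCategory D] [S.Braided]
    [G.LaxMonoidal] [adj.IsMonoidal] (M N : D) :
    μ G M N ≫ G.map (β_ M N).hom = (β_ _ _).hom ≫ μ G N M := by
  apply (adj.homEquiv _ _).symm.injective
  simp only [Adjunction.homEquiv_counit, Functor.map_comp, Category.assoc,
    Adjunction.counit_naturality, Adjunction.map_μ_comp_counit_app_tensor]
  rw [adj.map_μ_comp_counit_app_tensor_assoc, BraidedCategory.braiding_naturality,
    Functor.map_braiding]
  simp

variable {C' D' : Type*} [Category* C'] [Category* D']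
  {S' : C' ⥤ D'} {G' : D' ⥤ C'} (adj' : S' ⊣ G') (P : C ⥤ C') (F : D ⥤ D') (e : G ⋙ P ≅ F ⋙ G')

-- The unit inside the mate cancels against the counit by the right triangle identity. In this form
-- the mate can replace counits after transposition along `adj'`.
omit [MonoidalCategory C] [MonoidalCategory D] in
theorem mate_counit (M : D) :
    (adjointMate adj adj' P F e).app (G.obj M) ≫ F.map (adj.counit.app M) =
      S'.map (e.hom.app M) ≫ adj'.counit.app (F.obj M) := by
  have h3 := e.hom.naturality (adj.counit.app M)
  have h4 := adj'.counit.naturality (F.map (adj.counit.app M))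
  dsimp [adjointMate] at h3 h4 ⊢
  rw [Category.assoc, ← h4, ← Functor.map_comp_assoc, Category.assoc, ← h3,
    ← Functor.map_comp_assoc, adj.right_triangle_components]
  simp

variable [MonoidalCategory C'] [MonoidalCategory D'] [S.Monoidal] [S'.Monoidal] [G.LaxMonoidal] [G'.LaxMonoidal] [adj.IsMonoidal] [adj'.IsMonoidal]
  [P.Monoidal] [F.Monoidal]

/-- The monoidal structure of `F` is known only through the left adjoints, by the mate being
monoidal. Transposing along `adj'` and exchanging counits for mates turns this into a statement
about the right adjoints, where sections can be computed. -/
theorem mate_μ (h : (adjointMate adj adj' P F e).IsMonoidal) (M N : D) :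
    (e.hom.app M ⊗ₘ e.hom.app N) ≫ μ G' (F.obj M) (F.obj N) ≫ G'.map (μ F M N) =
      μ P (G.obj M) (G.obj N) ≫ P.map (μ G M N) ≫ e.hom.app (M ⊗ N) := by
  have hm := mate_counit adj adj' P F e
  have h1 := h.tensor (G.obj M) (G.obj N)
  have h2 := hm (M ⊗ N)
  apply (adj'.homEquiv _ _).symm.injective
  simp only [Adjunction.homEquiv_counit, Functor.map_comp, Category.assoc]
  dsimp at h1 h2 ⊢
  have h5 := (adjointMate adj adj' P F e).naturality (μ G M N)
  dsimp at h5
  rw [← h2, reassoc_of% h5, ← Functor.map_comp, adj.map_μ_comp_counit_app_tensor,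
    adj'.counit_naturality, adj'.map_μ_comp_counit_app_tensor_assoc]
  -- Since `S'` is strong monoidal, `μ S'` can be cancelled; this brings the goal into the shape of
  -- the tensor axiom `h1` of the mate.
  rw [← cancel_epi (μ S' _ _)]
  simp only [Category.assoc] at h1
  rw [reassoc_of% h1, ← Functor.map_comp, Functor.Monoidal.μ_δ_assoc, ← μ_natural,
    ← Functor.OplaxMonoidal.δ_natural_assoc, Functor.Monoidal.μ_δ_assoc]
  refine (MonoidalCategory.tensorHom_comp_tensorHom_assoc ..).trans ?_
  rw [← hm, ← hm]
  exact (MonoidalCategory.tensorHom_comp_tensorHom_assoc ..).symm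

theorem mate_ε (h : (adjointMate adj adj' P F e).IsMonoidal) :
    ε G' ≫ G'.map (ε F) = ε P ≫ P.map (ε G) ≫ e.hom.app (𝟙_ D) := by
  have h1 := h.unit
  have h5 := (adjointMate adj adj' P F e).naturality (ε G)
  have hm := mate_counit adj adj' P F e (𝟙_ D)
  apply (adj'.homEquiv _ _).symm.injective
  simp only [Adjunction.homEquiv_counit, Functor.map_comp, Category.assoc]
  dsimp at h1 h5 hm ⊢
  simp only [Category.assoc] at h1
  rw [← hm, reassoc_of% h5, ← Functor.map_comp, adj.map_ε_comp_counit_app_unit,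
    adj'.counit_naturality, adj'.map_ε_comp_counit_app_unit_assoc, ← cancel_epi (ε S'),
    reassoc_of% h1, ← Functor.map_comp]
  simp

end MonoidalAdjunction

/-! ### The tensor structure of the pushforward, compared with presheaves. -/

noncomputable section
open Functor.LaxMonoidal Functor.OplaxMonoidal
open Scheme.Modules (toPresheafOfModules)

variable {X Y : Scheme.{u}}

instance : (sheafifyAdj X).IsMonoidal :=
   inferInstanceAs (letI := (sheafifyAdj X).rightAdjointLaxMonoidal; (sheafifyAdj X).IsMonoidal)

theorem inclusion_μ_braiding (M N : X.Modules) :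
    μ (toPresheafOfModules X) M N ≫ (toPresheafOfModules X).map (β_ M N).hom = (β_ _ _).hom ≫ μ (toPresheafOfModules X) N M :=
  rightAdjoint_μ_braiding (sheafifyAdj X) M N

/-- The tensor structure of the pushforward was obtained by descent along the localization, which
makes the lifting isomorphism monoidal; the comparison map is its inverse. -/
theorem isMonoidal_sheafifyPush (f : X ⟶ Y) [IsIso f] : (sheafifyPush f).IsMonoidal := by
  have : (asIso (sheafifyPush f)).symm.hom.IsMonoidal :=
    Localization.Monoidal.lifting_isMonoidal (sheafifyModules X) (locIso X)
      (Scheme.Modules.pushforward f) (prePush f ⋙ sheafifyModules Y)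
  have h : (asIso (sheafifyPush f)).symm.inv.IsMonoidal := inferInstance
  exact h

/-- The identity morphisms are the components of `inclusionPush f`. Through the canonical maps from
presheaf tensor products, the tensor constraint of the pushforward is thus the one of presheaves. -/
theorem pushforward_μ (f : X ⟶ Y) [IsIso f] (M N : X.Modules) :
    (𝟙 _ ⊗ₘ 𝟙 _) ≫ μ (toPresheafOfModules Y) ((Scheme.Modules.pushforward f).obj M)
      ((Scheme.Modules.pushforward f).obj N) ≫
      (toPresheafOfModules Y).map (μ (Scheme.Modules.pushforward f) M N) =
    μ (prePush f) ((toPresheafOfModules X).obj M) ((toPresheafOfModules X).obj N) ≫ (prePush f).map (μ (toPresheafOfModules X) M N) ≫ 𝟙 _ :=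
  mate_μ (sheafifyAdj X) (sheafifyAdj Y) (prePush f) (Scheme.Modules.pushforward f)
    (inclusionPush f) (isMonoidal_sheafifyPush f) M N

theorem pushforward_ε (f : X ⟶ Y) [IsIso f] :
    ε (toPresheafOfModules Y) ≫ (toPresheafOfModules Y).map (ε (Scheme.Modules.pushforward f)) =
      ε (prePush f) ≫ (prePush f).map (ε (toPresheafOfModules X)) ≫ 𝟙 _ :=
  mate_ε (sheafifyAdj X) (sheafifyAdj Y) (prePush f) (Scheme.Modules.pushforward f)
    (inclusionPush f) (isMonoidal_sheafifyPush f)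

/-- The unit isomorphism `sheafifyUnitIso` is the counit at the structure sheaf, so this is the
right triangle identity. -/
theorem inclusion_ε : ε (toPresheafOfModules X) = 𝟙 _ :=
  (sheafifyAdj X).right_triangle_components (structureModule X)

end
-- Values of the structure maps on sections and pure tensors.
noncomputable section
open Functor.LaxMonoidal Functor.OplaxMonoidal
open Scheme.Modules (toPresheafOfModules)

section Presheaf
variable {C : Type w} [Category.{v} C] {R : Cᵒᵖ ⥤ CommRingCat.{u}}
  (M N : PresheafOfModules.{u} (R ⋙ forget₂ CommRingCat RingCat)) (U : Cᵒᵖ)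

theorem preTensor_smul (r : R.obj U) (a : M.obj U) (b : N.obj U) :
    preTensor M N U a (r • b) = preTensor M N U (r • a) b :=
  (TensorProduct.smul_tmul (R := R.obj U) r a b).symm

theorem leftUnitor_preTensor (r : R.obj U) (a : M.obj U) :
    ((λ_ M).hom.app U).hom (preTensor (𝟙_ _) M U r a) = r • a :=
  TensorProduct.lid_tmul (R := R.obj U) (M := M.obj U) a r

variable {M N U} in
theorem preTensor_induction {p : ((M ⊗ N).obj U : Type u) → Prop} (zero : p 0)
    (add : ∀ x y, p x → p y → p (x + y)) (tmul : ∀ a b, p (preTensor M N U a b))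
    (x : (M ⊗ N).obj U) : p x :=
  TensorProduct.induction_on (R := R.obj U) (M := M.obj U) (N := N.obj U) x zero tmul add

end Presheaf

variable {X Y : Scheme.{u}}

theorem prePush_μ (f : X ⟶ Y) [IsIso f] (M N : X.PresheafOfModules) (U : Y.Opens) (a : M.obj (op (f ⁻¹ᵁ U)))
   (b : N.obj (op (f ⁻¹ᵁ U))) : ((μ (prePush f) M N).app (op U)).hom
     (preTensor (R := Y.presheaf) ((prePush f).obj M) ((prePush f).obj N) (op U) a b) =
      preTensor (R := X.presheaf) M N (op (f ⁻¹ᵁ U)) a b := by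
  have : IsIso f.c := inferInstance
  exact μIsoRS_tmul (f.c.app (op U)).hom (bij (R := Y.presheaf) (S := (TopologicalSpace.Opens.map f.base).op ⋙ X.presheaf) f.c (op U)) (M.obj (op (f ⁻¹ᵁ U))) (N.obj (op (f ⁻¹ᵁ U))) a b

theorem prePush_ε (f : X ⟶ Y) [IsIso f] (U : Y.Opens) (r : Γ(Y, U)) : ((ε (prePush f)).app (op U)).hom r =
      f.app U r := by
  have : IsIso f.c := inferInstance
  exact εIsoRS_apply (f.c.app (op U)).hom (bij (R := Y.presheaf) (S := (TopologicalSpace.Opens.map f.base).op ⋙ X.presheaf) f.c (op U)) r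

section Sections

/-- The effect of a morphism of sheaves of modules on sections. -/
def ap {M N : X.Modules} (g : M ⟶ N) {U : X.Opens} : Γ(M, U) →+ Γ(N, U) := (g.app U).hom

/-- Restriction of sections. -/
def rs {M : X.Modules} {U V : X.Opens} (h : V ≤ U) : Γ(M, U) →+ Γ(M, V) :=
  (M.presheaf.map (homOfLE h).op).hom

/-- The pure tensor of two sections. -/
def tm {M N : X.Modules} {U : X.Opens} : Γ(M, U) →+ Γ(N, U) →+ Γ((M ⊗ N : X.Modules), U) :=
  letI m : ((((toPresheafOfModules X).obj M ⊗ (toPresheafOfModules X).obj N : X.PresheafOfModules)).obj (op U) : Type u) →+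
      Γ((M ⊗ N : X.Modules), U) :=
    ((μ (toPresheafOfModules X) M N).app (op U)).hom.toAddMonoidHom
  (AddMonoidHom.compHom m).comp (preTensor (R := X.presheaf) M.val N.val (op U))

variable {M N P Q : X.Modules} {U V W : X.Opens}

theorem hom_ext_ap {f g : M ⟶ N} (h : ∀ (U : X.Opens) (a : Γ(M, U)), ap f a = ap g a) : f = g := by
  ext U a
  exact h U a

@[simp] theorem ap_id (a : Γ(M, U)) : ap (𝟙 M) a = a := rfl
@[simp] theorem ap_comp (f : M ⟶ N) (g : N ⟶ P) (a : Γ(M, U)) : ap (f ≫ g) a = ap g (ap f a) := rfl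

theorem ap_smul (f : M ⟶ N) (r : Γ(X, U)) (a : Γ(M, U)) : ap f (r • a) = r • ap f a :=
  Scheme.Modules.Hom.app_smul f r a

@[simp] theorem ap_hom_inv (e : M ≅ N) (a : Γ(M, U)) : ap e.inv (ap e.hom a) = a := by
  rw [← ap_comp, e.hom_inv_id, ap_id]

theorem ap_inv_eq {e : M ≅ N} {a : Γ(M, U)} {b : Γ(N, U)} (h : ap e.hom a = b) : ap e.inv b = a := by
  rw [← h, ap_hom_inv]

@[simp] theorem ap_rs (f : M ⟶ N) (h : V ≤ U) (a : Γ(M, U)) : ap f (rs h a) = rs h (ap f a) :=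
  PresheafOfModules.naturality_apply f.val (homOfLE h).op a

@[simp] theorem rs_rs (h : V ≤ U) (h' : W ≤ V) (a : Γ(M, U)) :
    rs h' (rs h a) = rs (h'.trans h) a := by
  simp only [rs, ← AddMonoidHom.comp_apply, ← AddCommGrpCat.hom_comp, ← Functor.map_comp]
  rfl

@[simp] theorem rs_self (h : U ≤ U) (a : Γ(M, U)) : rs h a = a := by
  simp [rs]

theorem rs_smul (h : V ≤ U) (r : Γ(X, U)) (a : Γ(M, U)) :
    rs h (r • a) = X.presheaf.map (homOfLE h).op r • rs h a :=
  Scheme.Modules.map_smul M (homOfLE h) r a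

@[simp] theorem rs_tm (h : V ≤ U) (a : Γ(M, U)) (b : Γ(N, U)) :
    rs h (tm a b) = tm (rs h a) (rs h b) :=
  (PresheafOfModules.naturality_apply (μ (toPresheafOfModules X) M N) (homOfLE h).op
    (preTensor (R := X.presheaf) M.val N.val (op U) a b)).symm

theorem smul_tm (r : Γ(X, U)) (a : Γ(M, U)) (b : Γ(N, U)) : tm (r • a) b = r • tm a b :=
  ((μ (toPresheafOfModules X) M N).app (op U)).hom.map_smul r (preTensor (R := X.presheaf) M.val N.val (op U) a b)

theorem tm_smul (r : Γ(X, U)) (a : Γ(M, U)) (b : Γ(N, U)) : tm a (r • b) = r • tm a b := by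
  rw [← smul_tm]
  exact congrArg ((μ (toPresheafOfModules X) M N).app (op U)).hom
    (preTensor_smul (R := X.presheaf) M.val N.val (op U) r a b)

theorem ap_whiskerRight (f : M ⟶ N) (a : Γ(M, U)) (b : Γ(P, U)) :
    ap (f ▷ P) (tm a b) = tm (ap f a) b := by
  have := μ_natural_left (toPresheafOfModules X) f P
  exact congrArg (fun g : (toPresheafOfModules X).obj M ⊗ (toPresheafOfModules X).obj P ⟶ (toPresheafOfModules X).obj (N ⊗ P) => (g.app (op U)).hom
    (preTensor (R := X.presheaf) M.val P.val (op U) a b)) this.symm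

theorem ap_whiskerLeft (f : M ⟶ N) (a : Γ(P, U)) (b : Γ(M, U)) :
    ap (P ◁ f) (tm a b) = tm a (ap f b) := by
  have := μ_natural_right (toPresheafOfModules X) P f
  exact congrArg (fun g : (toPresheafOfModules X).obj P ⊗ (toPresheafOfModules X).obj M ⟶ (toPresheafOfModules X).obj (P ⊗ N) => (g.app (op U)).hom
    (preTensor (R := X.presheaf) P.val M.val (op U) a b)) this.symm

theorem ap_tensorHom (f : M ⟶ N) (g : P ⟶ Q) (a : Γ(M, U)) (b : Γ(P, U)) :
    ap (f ⊗ₘ g) (tm a b) = tm (ap f a) (ap g b) := by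
  rw [MonoidalCategory.tensorHom_def, ap_comp, ap_whiskerRight, ap_whiskerLeft]

theorem ap_braiding (a : Γ(M, U)) (b : Γ(N, U)) : ap (β_ M N).hom (tm a b) = tm b a :=
  congrArg (fun g : (toPresheafOfModules X).obj M ⊗ (toPresheafOfModules X).obj N ⟶ (toPresheafOfModules X).obj (N ⊗ M) => (g.app (op U)).hom
    (preTensor (R := X.presheaf) M.val N.val (op U) a b)) (inclusion_μ_braiding M N)

/-- The associator of sheaves is defined by localization; lax associativity of the inclusion reduces
its value on pure tensors to the associator of presheaves, which is the usual one of modules. -/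
theorem ap_associator (a : Γ(M, U)) (b : Γ(N, U)) (c : Γ(P, U)) :
    ap (α_ M N P).hom (tm (tm a b) c) = tm a (tm b c) :=
  congrArg (fun g : ((toPresheafOfModules X).obj M ⊗ (toPresheafOfModules X).obj N) ⊗ (toPresheafOfModules X).obj P ⟶ (toPresheafOfModules X).obj (M ⊗ N ⊗ P) =>
    (g.app (op U)).hom (preTensor (R := X.presheaf) _ P.val (op U)
      (preTensor (R := X.presheaf) M.val N.val (op U) a b) c))
    (associativity (F := toPresheafOfModules X) M N P)

/-- Sections of the unit. -/
def un (r : Γ(X, U)) : Γ((𝟙_ X.Modules), U) := r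

theorem rs_un (h : V ≤ U) (r : Γ(X, U)) : rs h (un r) = un (X.presheaf.map (homOfLE h).op r) := rfl

theorem ap_leftUnitor (r : Γ(X, U)) (a : Γ(M, U)) : ap (λ_ M).hom (tm (un r) a) = r • a := by
  have h := left_unitality (F := toPresheafOfModules X) M
  rw [inclusion_ε] at h
  exact (congrArg (fun g : 𝟙_ _ ⊗ (toPresheafOfModules X).obj M ⟶ (toPresheafOfModules X).obj M => (g.app (op U)).hom
    (preTensor (R := X.presheaf) (𝟙_ _) M.val (op U) r a)) h).symm.trans
     (leftUnitor_preTensor (R := X.presheaf) M.val (op U) r a)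

theorem ap_rightUnitor (r : Γ(X, U)) (a : Γ(M, U)) : ap (ρ_ M).hom (tm a (un r)) = r • a := by
  rw [← braiding_leftUnitor, ap_comp, ap_braiding, ap_leftUnitor]

section Pull
variable (σ τ : X ≅ X)

/-- Sections of `σ^* M` over `U` are sections of `M` over `σ(U)`. -/
def pl {M : X.Modules} {U : X.Opens} : Γ(M, σ.inv ⁻¹ᵁ U) ≃+ Γ((pull σ).obj M, U) :=
  AddEquiv.refl _

variable {M N P Q : X.Modules} {U V W : X.Opens}

@[simp] theorem ap_pull_map (f : M ⟶ N) (a : Γ(M, σ.inv ⁻¹ᵁ U)) :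
    ap ((pull σ).map f) (pl σ a) = pl σ (ap f a) := rfl

theorem preimage_mono {h : X ⟶ Y} {U V : Y.Opens} (i : U ≤ V) : h ⁻¹ᵁ U ≤ h ⁻¹ᵁ V :=
  fun _ hx => i hx

@[simp] theorem rs_pl (h : V ≤ U) (a : Γ(M, σ.inv ⁻¹ᵁ U)) :
    rs h (pl σ a) = pl σ (rs (preimage_mono h) a) := rfl

theorem pl_smul (r : Γ(X, U)) (a : Γ(M, σ.inv ⁻¹ᵁ U)) :
    pl σ (σ.inv.app U r • a) = r • pl σ a := rfl

theorem H0pull_eq (a : H0 M) : H0pull σ M a = pl σ (U := ⊤) (rs le_top a) := rfl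

/-- By `pushforward_μ` the question moves to presheaves, where the constraint is `a ⊗ b ↦ a ⊗ b`
between tensor products over two isomorphic rings. -/
theorem ap_μ (a : Γ(M, σ.inv ⁻¹ᵁ U)) (b : Γ(N, σ.inv ⁻¹ᵁ U)) :
    ap (μ (pull σ) M N) (tm (pl σ a) (pl σ b)) = pl σ (tm a b) := by
  have h := pushforward_μ σ.inv M N
  rw [MonoidalCategory.tensorHom_id, MonoidalCategory.id_whiskerRight] at h
  rw [Category.id_comp, Category.comp_id] at h
  refine (congrArg (fun g : (prePush σ.inv).obj ((toPresheafOfModules X).obj M) ⊗ (prePush σ.inv).obj ((toPresheafOfModules X).obj N) ⟶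
     (prePush σ.inv).obj ((toPresheafOfModules X).obj (M ⊗ N)) => (g.app (op U)).hom
    (preTensor (R := X.presheaf) ((prePush σ.inv).obj ((toPresheafOfModules X).obj M))
       ((prePush σ.inv).obj ((toPresheafOfModules X).obj N)) (op U) a b)) h).trans ?_
  exact congrArg (((prePush σ.inv).map (μ (toPresheafOfModules X) M N)).app (op U)).hom
    (prePush_μ σ.inv ((toPresheafOfModules X).obj M) ((toPresheafOfModules X).obj N) U a b)

theorem ap_μIso_inv (a : Γ(M, σ.inv ⁻¹ᵁ U)) (b : Γ(N, σ.inv ⁻¹ᵁ U)) :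
    ap (Functor.Monoidal.μIso (pull σ) M N).inv (pl σ (tm a b)) = tm (pl σ a) (pl σ b) :=
  ap_inv_eq (ap_μ σ a b)

theorem ap_ε (r : Γ(X, U)) : ap (ε (pull σ)) (un r) = pl σ (un (σ.inv.app U r)) := by
  have h := pushforward_ε σ.inv
  rw [inclusion_ε] at h
  exact (congrArg (fun g : 𝟙_ _ ⟶ (prePush σ.inv).obj ((toPresheafOfModules X).obj (𝟙_ X.Modules)) =>
    (g.app (op U)).hom r) h).trans (prePush_ε σ.inv U r)

theorem ap_εIso_inv (r : Γ(X, U)) :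
    ap (Functor.Monoidal.εIso (pull σ)).inv (pl σ (un (σ.inv.app U r))) = un r :=
  ap_inv_eq (ap_ε σ r)

theorem preimage_trans (U : X.Opens) :
    (σ ≪≫ τ).inv ⁻¹ᵁ U = τ.inv ⁻¹ᵁ (σ.inv ⁻¹ᵁ U) := rfl

theorem preimage_refl (U : X.Opens) : (Iso.refl X).inv ⁻¹ᵁ U = U := rfl

-- The two open sets agree by definition. The restriction between them is written out so that every
-- change of open set is an `rs`, and consecutive ones merge by `rs_rs`.
@[simp] theorem ap_pullTrans_hom (a : Γ(M, τ.inv ⁻¹ᵁ (σ.inv ⁻¹ᵁ U))) :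
    ap ((pullTrans σ τ).hom.app M) (pl σ (pl τ a)) =
      pl (σ ≪≫ τ) (rs (preimage_trans σ τ U).le a) :=
  (congrArg (pl (σ ≪≫ τ)) (rs_self (U := τ.inv ⁻¹ᵁ (σ.inv ⁻¹ᵁ U)) le_rfl a)).symm

@[simp] theorem ap_pullTrans_inv (a : Γ(M, (σ ≪≫ τ).inv ⁻¹ᵁ U)) :
    ap ((pullTrans σ τ).inv.app M) (pl (σ ≪≫ τ) a) =
      pl σ (pl τ (rs (preimage_trans σ τ U).ge a)) :=
  (congrArg (fun b => pl σ (pl τ b)) (rs_self (U := τ.inv ⁻¹ᵁ (σ.inv ⁻¹ᵁ U)) le_rfl a)).symm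

@[simp] theorem ap_pullRefl_hom (a : Γ(M, (Iso.refl X).inv ⁻¹ᵁ U)) :
    ap (pullRefl.hom.app M) (pl (Iso.refl X) a) = rs (preimage_refl U).ge a :=
  (rs_self (U := U) le_rfl a).symm

variable {σ τ}
@[simp] theorem ap_pullCongr_hom (h : σ = τ) (a : Γ(M, σ.inv ⁻¹ᵁ U)) :
    ap ((pullCongr h).hom.app M) (pl σ a) = pl τ (rs (by rw [h]) a) := by
  subst h
  simp [pullCongr]

end Pull

end Sections
end
-- Local generation by pure tensors.
noncomputable section
open Functor.LaxMonoidal Functor.OplaxMonoidal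
open Scheme.Modules (toPresheafOfModules)

variable {X : Scheme.{u}}

section Generation
variable {M N P Q : X.Modules} {U V W : X.Opens}

/-- A family of sets of sections, stable under restriction, which locally generates a sheaf of
modules as a sheaf of abelian groups. -/
structure Gen (M : X.Modules) (S : ∀ U : X.Opens, Set Γ(M, U)) : Prop where
  rs_mem {U V : X.Opens} (h : V ≤ U) {a : Γ(M, U)} : a ∈ S U → rs h a ∈ S V
  exists_mem_closure {U : X.Opens} (a : Γ(M, U)) (x : X) : x ∈ U → ∃ (V : X.Opens) (h : V ≤ U),
    x ∈ V ∧ rs h a ∈ AddSubgroup.closure (S V)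

theorem Gen.rs_mem_closure {S : ∀ U : X.Opens, Set Γ(M, U)} (hS : Gen M S) (h : V ≤ U)
    {a : Γ(M, U)} (ha : a ∈ AddSubgroup.closure (S U)) : rs h a ∈ AddSubgroup.closure (S V) := by
  have : AddSubgroup.closure (S U) ≤ (AddSubgroup.closure (S V)).comap (rs h) :=
    (AddSubgroup.closure_le _).2 fun a ha => AddSubgroup.subset_closure (hS.rs_mem h ha)
  exact this ha

theorem Gen.all (M : X.Modules) : Gen M fun _ => Set.univ where
  rs_mem _ _ _ := trivial
  exists_mem_closure {U} _ _ hx := ⟨U, le_rfl, hx, AddSubgroup.subset_closure trivial⟩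

theorem section_ext {a b : Γ(M, U)}
    (h : ∀ x ∈ U, ∃ (V : X.Opens) (h : V ≤ U), x ∈ V ∧ rs h a = rs h b) : a = b := by
  choose V hV hx hab using h
  refine TopCat.Sheaf.eq_of_locally_eq' (⟨M.presheaf, M.isSheaf⟩ : TopCat.Sheaf Ab X)
    (fun x : U => V x x.2) U (fun x => homOfLE (hV x x.2)) ?_ a b fun x => hab x x.2
  intro x hxU
  exact TopologicalSpace.Opens.mem_iSup.2 ⟨⟨x, hxU⟩, hx x hxU⟩

/-- Agreement on generators gives agreement near every point, hence everywhere because the target is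
a sheaf. -/
theorem Gen.hom_ext {S : ∀ U : X.Opens, Set Γ(M, U)} (hS : Gen M S) {f g : M ⟶ N}
    (h : ∀ (U : X.Opens), ∀ a ∈ S U, ap f a = ap g a) : f = g := by
  refine hom_ext_ap fun U a => section_ext fun x hx => ?_
  obtain ⟨V, hV, hxV, ha⟩ := hS.exists_mem_closure a x hx
  refine ⟨V, hV, hxV, ?_⟩
  rw [← ap_rs, ← ap_rs]
  have : AddSubgroup.closure (S V) ≤ (ap f : Γ(M, V) →+ _).eqLocus (ap g) :=
    (AddSubgroup.closure_le _).2 fun a ha => h V a ha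
  exact this ha

theorem Gen.pull {S : ∀ U : X.Opens, Set Γ(M, U)} (hS : Gen M S) (σ : X ≅ X) :
    Gen ((pull σ).obj M) fun _ => pl σ '' S _ where
  rs_mem {U V} h a := by
    rintro ⟨a, ha, rfl⟩
    exact ⟨_, hS.rs_mem _ ha, rfl⟩
  exists_mem_closure {U} a x hx := by
    have hx' : σ.inv (σ.hom x) = x := by
      rw [← Scheme.Hom.comp_apply]; simp
    -- The point of `σ.inv ⁻¹ᵁ U` corresponding to `x` is `σ.hom x`; the neighbourhood found there
    -- is carried back by `σ.hom`.
    obtain ⟨V, hV, hxV, ha⟩ := hS.exists_mem_closure (U := σ.inv ⁻¹ᵁ U) ((pl σ).symm a) (σ.hom x)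
      (show σ.inv (σ.hom x) ∈ U by rwa [hx'])
    have hVV : σ.inv ⁻¹ᵁ (σ.hom ⁻¹ᵁ V) = V := by
      rw [← Scheme.Hom.comp_preimage]; simp
    have hle : σ.hom ⁻¹ᵁ V ≤ U := fun y hy => by
      have : σ.inv (σ.hom y) ∈ U := hV hy
      rw [← Scheme.Hom.comp_apply] at this
      simpa using this
    refine ⟨σ.hom ⁻¹ᵁ V, hle, hxV, ?_⟩
    obtain ⟨a, rfl⟩ := (pl σ).surjective a
    have h2 := hS.rs_mem_closure hVV.le ha
    rw [rs_rs] at h2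
    rw [rs_pl]
    have : AddSubgroup.closure (S _) ≤
        (AddSubgroup.closure (pl σ '' S _)).comap (pl σ (M := M) (U := σ.hom ⁻¹ᵁ V)).toAddMonoidHom :=
      (AddSubgroup.closure_le _).2 fun a ha => AddSubgroup.subset_closure ⟨a, ha, rfl⟩
    exact this h2

/-- The canonical map is the unit of sheafification followed by an isomorphism, sheafification being
strong monoidal with invertible counit. Its local surjectivity says that sections of `M ⊗ N` are
locally sums of pure tensors. -/
theorem locIso_inclusion_μ (M N : X.Modules) : locIso X (μ (toPresheafOfModules X) M N) := by
  have h : μ (toPresheafOfModules X) M N = (sheafifyAdj X).unit.app _ ≫ (toPresheafOfModules X).map (δ (sheafifyModules X) _ _ ≫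
      ((sheafifyAdj X).counit.app M ⊗ₘ (sheafifyAdj X).counit.app N)) :=
    (sheafifyAdj X).homEquiv_unit ..
  rw [h]
  exact MorphismProperty.RespectsIso.postcomp (locIso X) _ _ (locIso_unit _)

theorem inclusion_μ_mem_closure (p : ((toPresheafOfModules X).obj M ⊗ (toPresheafOfModules X).obj N).obj (op V)) :
    (show Γ((M ⊗ N : X.Modules), V) from ((μ (toPresheafOfModules X) M N).app (op V)).hom p) ∈
      AddSubgroup.closure (Set.image2 (fun (a : Γ(M, V)) (b : Γ(N, V)) => tm a b)
        Set.univ Set.univ) := by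
  refine preTensor_induction (R := X.presheaf) (M := M.val) (N := N.val) (U := op V)
    (p := fun p => (show Γ((M ⊗ N : X.Modules), V) from ((μ (toPresheafOfModules X) M N).app (op V)).hom p) ∈
      AddSubgroup.closure (Set.image2 (fun (a : Γ(M, V)) (b : Γ(N, V)) => tm a b)
        Set.univ Set.univ)) ?_ ?_ ?_ p
  · convert AddSubgroup.zero_mem _
    exact map_zero ((μ (toPresheafOfModules X) M N).app (op V)).hom
  · intro p q hp hq
    convert add_mem hp hq
    exact map_add ((μ (toPresheafOfModules X) M N).app (op V)).hom p q
  · intro a b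
    exact AddSubgroup.subset_closure ⟨a, trivial, b, trivial, rfl⟩

theorem exists_rs_mem_closure_tm (t : Γ((M ⊗ N : X.Modules), U)) (x : X) (hx : x ∈ U) :
    ∃ (V : X.Opens) (h : V ≤ U), x ∈ V ∧ rs h t ∈
      AddSubgroup.closure (Set.image2 (fun (a : Γ(M, V)) (b : Γ(N, V)) => tm a b)
        Set.univ Set.univ) := by
  have hsurj : Presheaf.IsLocallySurjective (Opens.grothendieckTopology X)
      ((PresheafOfModules.toPresheaf X.ringCatSheaf.obj).map (μ (toPresheafOfModules X) M N)) :=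
    (((Opens.grothendieckTopology X).W_iff_isLocallyBijective _).1 (locIso_inclusion_μ M N)).2
  obtain ⟨V, i, ⟨p, hp⟩, hxV⟩ := Presheaf.imageSieve_mem (Opens.grothendieckTopology X)
    ((PresheafOfModules.toPresheaf X.ringCatSheaf.obj).map (μ (toPresheafOfModules X) M N)) (U := op U) t x hx
  refine ⟨V, leOfHom i, hxV, ?_⟩
  convert inclusion_μ_mem_closure p
  exact hp.symm

theorem Gen.tm {S : ∀ U : X.Opens, Set Γ(M, U)} {T : ∀ U : X.Opens, Set Γ(N, U)}
    (hS : Gen M S) (hT : Gen N T) :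
    Gen (M ⊗ N) fun U => Set.image2 (fun a b => TwistedCoordinateRing.tm a b) (S U) (T U) where
  rs_mem {U V} h t := by
    rintro ⟨a, ha, b, hb, rfl⟩
    exact ⟨_, hS.rs_mem h ha, _, hT.rs_mem h hb, (rs_tm h a b).symm⟩
  exists_mem_closure {U} t x hx := by
    have hrs {U V} (h : V ≤ U) {t : Γ((M ⊗ N : X.Modules), U)} (ht : t ∈ AddSubgroup.closure
        (Set.image2 (fun a b => TwistedCoordinateRing.tm a b) (S U) (T U))) :
        rs h t ∈ AddSubgroup.closure
        (Set.image2 (fun a b => TwistedCoordinateRing.tm a b) (S V) (T V)) := by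
      have : AddSubgroup.closure
        (Set.image2 (fun a b => TwistedCoordinateRing.tm a b) (S U) (T U)) ≤ (AddSubgroup.closure
        (Set.image2 (fun a b => TwistedCoordinateRing.tm a b) (S V) (T V))).comap (rs h) := by
        refine (AddSubgroup.closure_le _).2 ?_
        rintro _ ⟨a, ha, b, hb, rfl⟩
        exact AddSubgroup.subset_closure
          ⟨_, hS.rs_mem h ha, _, hT.rs_mem h hb, (rs_tm h a b).symm⟩
      exact this ht
    obtain ⟨V, i, hxV, ht⟩ := exists_rs_mem_closure_tm t x hx
    -- After the first shrinking `t` is a sum of pure tensors of arbitrary sections. Having a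
    -- smaller neighbourhood as required is stable under sums, so one pure tensor remains to be
    -- treated.
    suffices H : ∃ (W : X.Opens) (h : W ≤ V), x ∈ W ∧ rs h (rs i t) ∈ AddSubgroup.closure
          (Set.image2 (fun a b => TwistedCoordinateRing.tm a b) (S W) (T W)) by
      obtain ⟨W, h, hxW, hW⟩ := H
      exact ⟨W, h.trans i, hxW, by rwa [rs_rs] at hW⟩
    revert ht
    generalize rs i t = t'
    intro ht
    induction ht using AddSubgroup.closure_induction with
    | zero => exact ⟨V, le_rfl, hxV, by rw [map_zero]; exact zero_mem _⟩
    | add p q _ _ hp hq =>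
      obtain ⟨W, h, hxW, hW⟩ := hp
      obtain ⟨W', h', hxW', hW'⟩ := hq
      refine ⟨W ⊓ W', inf_le_left.trans h, ⟨hxW, hxW'⟩, ?_⟩
      rw [map_add]
      refine add_mem ?_ ?_
      · rw [← rs_rs h inf_le_left]
        exact hrs _ hW
      · rw [← rs_rs h' inf_le_right]
        exact hrs _ hW'
    | neg p _ hp =>
      obtain ⟨W, h, hxW, hW⟩ := hp
      exact ⟨W, h, hxW, by rw [map_neg]; exact neg_mem hW⟩
    | mem p hp =>
      obtain ⟨a, -, b, -, rfl⟩ := hp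
      obtain ⟨W, h, hxW, hW⟩ := hS.exists_mem_closure a x hxV
      obtain ⟨W', h', hxW', hW'⟩ := hT.exists_mem_closure b x hxV
      refine ⟨W ⊓ W', inf_le_left.trans h, ⟨hxW, hxW'⟩, ?_⟩
      have h1 := hS.rs_mem_closure (V := W ⊓ W') inf_le_left hW
      have h2 := hT.rs_mem_closure (V := W ⊓ W') inf_le_right hW'
      rw [rs_rs] at h1 h2
      rw [rs_tm]
      -- Biadditivity in two stages: the second factor runs through the closure while the first is a
      -- generator, then the first runs through the closure.
      have h3 (a : Γ(M, W ⊓ W')) (ha : a ∈ S _) : AddSubgroup.closure (T (W ⊓ W')) ≤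
         (AddSubgroup.closure (Set.image2 (fun a b => TwistedCoordinateRing.tm a b)
           (S (W ⊓ W')) (T (W ⊓ W')))).comap (TwistedCoordinateRing.tm a) :=
        (AddSubgroup.closure_le _).2 fun b hb => AddSubgroup.subset_closure ⟨a, ha, b, hb, rfl⟩
      have h4 : AddSubgroup.closure (S (W ⊓ W')) ≤
         (AddSubgroup.closure (Set.image2 (fun a b => TwistedCoordinateRing.tm a b)
           (S (W ⊓ W')) (T (W ⊓ W')))).comap
            (TwistedCoordinateRing.tm.flip (rs (inf_le_right.trans h') b)) :=
        (AddSubgroup.closure_le _).2 fun a ha => h3 a ha h2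
      exact h4 h1

end Generation
end
-- The category of bimodules and its structure maps on sections.
noncomputable section

variable {X : Scheme.{u}}

attribute [local irreducible] ap rs tm

theorem ap_pullTrans_assoc {M N F : X.Modules} {U : X.Opens} {σ τ : X ≅ X} (a : Γ(M, U))
    (b : Γ(N, σ.inv ⁻¹ᵁ U)) (c : Γ(F, τ.inv ⁻¹ᵁ (σ.inv ⁻¹ᵁ U))) :
    ap (M ◁ (Functor.Monoidal.μIso (pull σ) N ((pull τ).obj F)).inv ≫
      (α_ M ((pull σ).obj N) ((pull σ).obj ((pull τ).obj F))).inv ≫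
      (M ⊗ (pull σ).obj N) ◁ (pullTrans σ τ).hom.app F) (tm a (pl σ (tm b (pl τ c)))) =
    tm (tm a (pl σ b)) (pl (σ ≪≫ τ) (rs (preimage_trans σ τ U).le c)) := by
  rw [ap_comp, ap_comp, ap_whiskerLeft, ap_μIso_inv, ap_inv_eq (ap_associator a _ _)]
  exact (ap_whiskerLeft ..).trans (congrArg _ (ap_pullTrans_hom ..))

namespace TwistedBimod

/-- A morphism of bimodules: a morphism of the underlying sheaves, the automorphisms being equal. -/
@[ext]
structure Hom (A B : TwistedBimod X) where
  /-- the automorphisms agree -/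
  aut_eq : A.aut = B.aut
  /-- the morphism of the underlying sheaves -/
  hom : A.sheaf ⟶ B.sheaf

instance : Category (TwistedBimod X) where
  Hom := Hom
  id A := ⟨rfl, 𝟙 _⟩
  comp f g := ⟨f.aut_eq.trans g.aut_eq, f.hom ≫ g.hom⟩

@[simp] theorem id_hom (A : TwistedBimod X) : Hom.hom (𝟙 A) = 𝟙 A.sheaf := rfl
@[simp] theorem comp_hom {A B C : TwistedBimod X} (f : A ⟶ B) (g : B ⟶ C) :
    (f ≫ g).hom = f.hom ≫ g.hom := rfl

theorem hom_ext {A B : TwistedBimod X} {f g : A ⟶ B} (h : f.hom = g.hom) : f = g :=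
  Hom.ext h

/-- An isomorphism of sheaves as an isomorphism of bimodules. -/
def mkIso {A B : TwistedBimod X} (h : A.aut = B.aut) (e : A.sheaf ≅ B.sheaf) : A ≅ B where
  hom := ⟨h, e.hom⟩
  inv := ⟨h.symm, e.inv⟩
  hom_inv_id := hom_ext e.hom_inv_id
  inv_hom_id := hom_ext e.inv_hom_id

/-- The isomorphism of sheaves underlying an isomorphism of bimodules. -/
def sheafIso {A B : TwistedBimod X} (e : A ≅ B) : A.sheaf ≅ B.sheaf where
  hom := e.hom.hom
  inv := e.inv.hom
  hom_inv_id := by rw [← comp_hom, e.hom_inv_id, id_hom]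
  inv_hom_id := by rw [← comp_hom, e.inv_hom_id, id_hom]

/-- The tensor product, unit and structure isomorphisms of the category of bimodules. -/
@[reducible]
def monoidalStruct : MonoidalCategoryStruct (TwistedBimod X) where
  tensorObj := tensor
  tensorUnit := unit X
  whiskerLeft A _ _ f := ⟨congrArg (A.aut ≪≫ ·) f.aut_eq, A.sheaf ◁ (pull A.aut).map f.hom⟩
  whiskerRight f B := ⟨congrArg (· ≪≫ B.aut) f.aut_eq,
    f.hom ⊗ₘ (pullCongr f.aut_eq).hom.app B.sheaf⟩
  associator A B C := mkIso (Iso.trans_assoc ..) (actAct A B C.sheaf).symm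
  leftUnitor A := mkIso (Iso.refl_trans _) (unitAct A.sheaf)
  rightUnitor A := mkIso (Iso.trans_refl _)
    (whiskerLeftIso _ (Functor.Monoidal.εIso (pull A.aut)).symm ≪≫ ρ_ _)

attribute [local instance] monoidalStruct

variable {A B C D : TwistedBimod X} {U : X.Opens}

/-- The pure tensor `a ⊗ σ(b)`, as a section of `L_σ ⊗ F`. -/
def tact {F : X.Modules} (a : Γ(A.sheaf, U)) (b : Γ(F, A.aut.inv ⁻¹ᵁ U)) : Γ(A.act F, U) :=
  tm a (pl A.aut b)

/-- The pure tensor `a ⊗ σ(b)`, as a section of a tensor product of bimodules. -/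
def ta (a : Γ(A.sheaf, U)) (b : Γ(B.sheaf, A.aut.inv ⁻¹ᵁ U)) :
    Γ((A ⊗ B).sheaf, U) := tact a b

theorem preimage_tensor (A B : TwistedBimod X) (U : X.Opens) :
    (A ⊗ B).aut.inv ⁻¹ᵁ U = B.aut.inv ⁻¹ᵁ (A.aut.inv ⁻¹ᵁ U) := rfl

theorem preimage_unit (U : X.Opens) : (𝟙_ (TwistedBimod X)).aut.inv ⁻¹ᵁ U = U := rfl

/-- A function as a section of the unit bimodule. -/
def uni (r : Γ(X, U)) : Γ((𝟙_ (TwistedBimod X)).sheaf, U) := un r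

theorem ap_whiskerLeft_ta (f : B ⟶ C) (a : Γ(A.sheaf, U)) (b) :
    ap (A ◁ f).hom (ta a b) = ta a (ap f.hom b) :=
  (ap_whiskerLeft ..).trans (by rw [ap_pull_map]; rfl)

theorem ap_whiskerRight_ta (f : A ⟶ B) (a : Γ(A.sheaf, U)) (c) :
    ap (f ▷ C).hom (ta a c) = ta (ap f.hom a) (rs (by rw [f.aut_eq]) c) :=
  (ap_tensorHom ..).trans (by rw [ap_pullCongr_hom]; rfl)

theorem ap_actAct_hom (a : Γ(A.sheaf, U)) (b : Γ(B.sheaf, A.aut.inv ⁻¹ᵁ U)) {F : X.Modules}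
    (c : Γ(F, B.aut.inv ⁻¹ᵁ (A.aut.inv ⁻¹ᵁ U))) :
    ap (actAct A B F).hom (tact a (tact b c)) =
      tact (A := A.tensor B) (ta a b) (rs (preimage_tensor A B U).le c) :=
  ap_pullTrans_assoc a b c

theorem ap_associator_inv_ta (a : Γ(A.sheaf, U)) (b)
    (c : Γ(C.sheaf, B.aut.inv ⁻¹ᵁ (A.aut.inv ⁻¹ᵁ U))) :
    ap (α_ A B C).inv.hom (ta a (ta b c)) =
      ta (A := A ⊗ B) (ta a b) (rs (preimage_tensor A B U).le c) :=
  ap_actAct_hom a b c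

theorem ap_associator_hom_ta (a : Γ(A.sheaf, U)) (b) (c : Γ(C.sheaf, (A ⊗ B).aut.inv ⁻¹ᵁ U)) :
    ap (α_ A B C).hom.hom (ta (ta a b) c) =
      ta a (ta b (rs (preimage_tensor A B U).ge c)) := by
  have h := ap_associator_inv_ta a b (rs (preimage_tensor A B U).ge c)
  rw [rs_rs, rs_self] at h
  exact ap_inv_eq (e := (sheafIso (α_ A B C)).symm) h

theorem ap_leftUnitor_ta (r : Γ(X, U)) (a : Γ(A.sheaf, (𝟙_ (TwistedBimod X)).aut.inv ⁻¹ᵁ U)) :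
    ap (λ_ A).hom.hom (ta (uni r) a) = r • rs (preimage_unit U).ge a := by
  have h (M : X.Modules) (a : Γ(M, (Iso.refl X).inv ⁻¹ᵁ U)) :
      ap (𝟙_ X.Modules ◁ (pullRefl.hom.app M) ≫ (λ_ M).hom) (tm (un r) (pl (Iso.refl X) a)) =
        r • rs (preimage_refl U).ge a := by
    rw [ap_comp, ap_whiskerLeft, ap_pullRefl_hom]
    exact ap_leftUnitor r _
  exact h A.sheaf a

/-- Functions on the right act through `σ`: a function on `A.aut.inv ⁻¹ᵁ U` multiplies `a` only
after being brought back to `U`. By `app_inv_surjective` the form used here covers every section of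
the unit. -/
theorem ap_rightUnitor_ta (r : Γ(X, U)) (a : Γ(A.sheaf, U)) :
    ap (ρ_ A).hom.hom (ta a (uni (A.aut.inv.app U r))) = r • a := by
  have h (M : X.Modules) (σ : X ≅ X) (a : Γ(M, U)) :
      ap (M ◁ (Functor.Monoidal.εIso (pull σ)).inv ≫ (ρ_ M).hom)
        (tm a (pl σ (un (σ.inv.app U r)))) = r • a := by
    rw [ap_comp, ap_whiskerLeft, ap_εIso_inv]
    exact ap_rightUnitor r a
  exact h A.sheaf A.aut a

theorem rs_ta {V : X.Opens} (h : V ≤ U) (a : Γ(A.sheaf, U)) (b : Γ(B.sheaf, A.aut.inv ⁻¹ᵁ U)) :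
    rs h (ta a b) = ta (rs h a) (rs (preimage_mono h) b) := by
  exact (rs_tm ..).trans (congrArg _ (rs_pl ..))

end TwistedBimod

attribute [local instance] TwistedBimod.monoidalStruct

theorem Gen.ta {A B : TwistedBimod X} {S : ∀ U : X.Opens, Set Γ(A.sheaf, U)}
    {T : ∀ U : X.Opens, Set Γ(B.sheaf, U)} (hS : Gen A.sheaf S) (hT : Gen B.sheaf T) :
    Gen (A ⊗ B).sheaf fun U => Set.image2 (fun a b => TwistedBimod.ta a b) (S U) (T _) := by
  have h := hS.tm (hT.pull A.aut)
  have H (U : X.Opens) : Set.image2 (fun a b => TwistedBimod.ta a b) (S U) (T (A.aut.inv ⁻¹ᵁ U)) =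
      (Set.image2 (fun a b => TwistedCoordinateRing.tm a b) (S U) (pl A.aut '' T _) :) :=
    Set.image2_image_right ..|>.symm
  rw [funext H]
  exact h

namespace TwistedBimod
variable {A B C D E : TwistedBimod X} {U : X.Opens}

/-- By `Gen.ta` pure tensors generate. This and its versions for three and four factors make the
coherence axioms a matter of evaluating both sides. -/
theorem hom_ext₂ {f g : A ⊗ B ⟶ E}
    (h : ∀ (U : X.Opens) (a : Γ(A.sheaf, U)) (b), ap f.hom (ta a b) = ap g.hom (ta a b)) :
    f = g := by
  refine hom_ext (((Gen.all A.sheaf).ta (Gen.all B.sheaf)).hom_ext fun U => ?_)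
  rintro _ ⟨a, -, b, -, rfl⟩
  exact h U a b

theorem hom_ext₃ {f g : (A ⊗ B) ⊗ C ⟶ E}
    (h : ∀ (U : X.Opens) (a : Γ(A.sheaf, U)) (b) (c),
      ap f.hom (ta (ta a b) c) = ap g.hom (ta (ta a b) c)) : f = g := by
  refine hom_ext ((((Gen.all A.sheaf).ta (Gen.all B.sheaf)).ta (Gen.all C.sheaf)).hom_ext
    fun U => ?_)
  rintro _ ⟨_, ⟨a, -, b, -, rfl⟩, c, -, rfl⟩
  exact h U a b c

theorem hom_ext₄ {f g : ((A ⊗ B) ⊗ C) ⊗ D ⟶ E}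
    (h : ∀ (U : X.Opens) (a : Γ(A.sheaf, U)) (b) (c) (d),
      ap f.hom (ta (ta (ta a b) c) d) = ap g.hom (ta (ta (ta a b) c) d)) : f = g := by
  refine hom_ext (((((Gen.all A.sheaf).ta (Gen.all B.sheaf)).ta (Gen.all C.sheaf)).ta
    (Gen.all D.sheaf)).hom_ext fun U => ?_)
  rintro _ ⟨_, ⟨_, ⟨a, -, b, -, rfl⟩, c, -, rfl⟩, d, -, rfl⟩
  exact h U a b c d

theorem app_inv_surjective (σ : X ≅ X) (U : X.Opens) : Function.Surjective (σ.inv.app U) :=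
  (ConcreteCategory.bijective_of_isIso (σ.inv.app U)).2

theorem ta_smul (r : Γ(X, U)) (a : Γ(A.sheaf, U)) (b : Γ(B.sheaf, A.aut.inv ⁻¹ᵁ U)) :
    ta a (A.aut.inv.app U r • b) = ta (r • a) b := by
  exact (congrArg (tm a) (pl_smul ..)).trans ((tm_smul ..).trans (smul_tm ..).symm)

end TwistedBimod
end
-- The monoidal category axioms for bimodules.
noncomputable section

variable {X : Scheme.{u}}
attribute [local irreducible] ap rs tm
namespace TwistedBimod

variable {A A' B B' C C' D : TwistedBimod X} {U : X.Opens}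

section
attribute [local instance] monoidalStruct

theorem ap_tensorHom_ta (f : A ⟶ A') (g : B ⟶ B') (a : Γ(A.sheaf, U)) (b) :
    ap (f ⊗ₘ g).hom (ta a b) = ta (ap f.hom a) (rs (by rw [f.aut_eq]) (ap g.hom b)) := by
  change ap (f ▷ B ≫ A' ◁ g).hom _ = _
  rw [comp_hom, ap_comp, ap_whiskerRight_ta, ap_whiskerLeft_ta, ap_rs]

/-- Each extensionality check becomes an equality of explicit pure tensors, in which only
restrictions have to be merged. The unit axioms also need sections of the unit written as pulled
back functions. -/
instance : MonoidalCategory (TwistedBimod X) where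
  toMonoidalCategoryStruct := monoidalStruct
  tensorHom_def := fun _ _ => rfl
  id_tensorHom_id A B := hom_ext₂ fun U a b => by
    rw [ap_tensorHom_ta, id_hom, id_hom, id_hom, ap_id, ap_id, rs_self, ap_id]
  tensorHom_comp_tensorHom f₁ f₂ g₁ g₂ := hom_ext₂ fun U a b => by
    simp only [comp_hom, ap_comp, ap_tensorHom_ta, ap_rs, rs_rs]
  whiskerLeft_id A B := hom_ext₂ fun U a b => by
    simp only [ap_whiskerLeft_ta, id_hom, ap_id]
  id_whiskerRight A B := hom_ext₂ fun U a b => by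
    simp only [ap_whiskerRight_ta, id_hom, ap_id, rs_self]
  associator_naturality f₁ f₂ f₃ := hom_ext₃ fun U a b c => by
    simp only [comp_hom, ap_comp, ap_tensorHom_ta, ap_associator_hom_ta, ap_rs, rs_rs, rs_ta]
  leftUnitor_naturality f := hom_ext₂ fun U a b => by
    simp only [comp_hom, ap_comp]
    obtain ⟨r, hr⟩ : ∃ r, uni r = a := ⟨a, rfl⟩
    rw [← hr]
    simp only [ap_whiskerLeft_ta, ap_leftUnitor_ta, ap_rs, ap_smul]
  rightUnitor_naturality {A B} f := hom_ext₂ fun U a b => by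
    simp only [comp_hom, ap_comp]
    obtain ⟨r, hr⟩ := app_inv_surjective A.aut U b
    obtain rfl : uni (A.aut.inv.app U r) = b := hr
    rw [ap_whiskerRight_ta, ap_rightUnitor_ta, ap_smul]
    -- The unitor formula for `B` expects the function pulled back by the automorphism of `B`;
    -- substituting the equality carried by `f` identifies this with the automorphism of `A`.
    obtain ⟨A, σ⟩ := A
    obtain ⟨B, τ⟩ := B
    obtain ⟨h, f⟩ := f
    dsimp at h f
    subst h
    rw [rs_self]
    exact ap_rightUnitor_ta ..
  pentagon A B C D := hom_ext₄ fun U a b c d => by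
    simp only [comp_hom, ap_comp, ap_whiskerRight_ta, ap_whiskerLeft_ta, ap_associator_hom_ta,
      rs_rs, rs_ta]
  triangle A B := hom_ext₃ fun U a b c => by
    simp only [comp_hom, ap_comp, ap_associator_hom_ta, ap_whiskerLeft_ta]
    obtain ⟨r, hr⟩ := app_inv_surjective A.aut U b
    obtain rfl : uni (A.aut.inv.app U r) = b := hr
    rw [ap_whiskerRight_ta, ap_rightUnitor_ta, ap_leftUnitor_ta, ta_smul, rs_rs]

end

end TwistedBimod
end

/-! ### Coherence of reorderings from the Yang–Baxter equations. -/

section Words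
variable {C : Type*} [Category* C] [MonoidalCategory C]

/-- The morphism `f ⊗ 1 : A ⊗ (B ⊗ P) ⟶ B' ⊗ (A' ⊗ P)` for `f : A ⊗ B ⟶ B' ⊗ A'`. -/
def swapHom {A B A' B' : C} (f : A ⊗ B ⟶ B' ⊗ A') (P : C) : A ⊗ (B ⊗ P) ⟶ B' ⊗ (A' ⊗ P) :=
  (α_ A B P).inv ≫ f ▷ P ≫ (α_ B' A' P).hom

theorem swapHom_naturality {A B A' B' : C} (f : A ⊗ B ⟶ B' ⊗ A') {P Q : C} (g : P ⟶ Q) :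
    A ◁ B ◁ g ≫ swapHom f Q = swapHom f P ≫ B' ◁ A' ◁ g := by
  simp only [swapHom, Category.assoc, associator_inv_naturality_right_assoc,
    whisker_exchange_assoc, associator_naturality_right]

theorem swapHom_naturality_assoc {A B A' B' : C} (f : A ⊗ B ⟶ B' ⊗ A') {P Q : C} (g : P ⟶ Q)
    {Z : C} (h : B' ⊗ A' ⊗ Q ⟶ Z) :
    A ◁ B ◁ g ≫ swapHom f Q ≫ h = swapHom f P ≫ B' ◁ A' ◁ g ≫ h := by
  rw [reassoc_of% swapHom_naturality f g]

/-- Allows the tail behind a swap to be replaced by an isomorphic one; it is applied to the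
structure maps of a `WordProd` and to `append`. -/
theorem swapHom_whiskerLeft_iso {A B A' B' : C} (f : A ⊗ B ⟶ B' ⊗ A') {P Q : C} (e : P ≅ Q) :
    swapHom f Q = A ◁ B ◁ e.inv ≫ swapHom f P ≫ B' ◁ A' ◁ e.hom := by
  rw [← swapHom_naturality, ← whiskerLeft_comp_assoc, whiskerLeft_inv_hom, whiskerLeft_id,
    Category.id_comp]

/-- The hypothesis tensored on the right with `P`; what remains is rebracketing, settled by
coherence of associators. -/
theorem yangBaxter_whiskerRight {I J K : C} {a : J ⊗ I ⟶ I ⊗ J} {b : K ⊗ I ⟶ I ⊗ K}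
    {c : K ⊗ J ⟶ J ⊗ K}
    (h : swapHom c I ≫ J ◁ b ≫ swapHom a K = K ◁ a ≫ swapHom b J ≫ I ◁ c) (P : C) :
    swapHom c (I ⊗ P) ≫ J ◁ swapHom b P ≫ swapHom a (K ⊗ P) =
      K ◁ swapHom a P ≫ swapHom b (J ⊗ P) ≫ I ◁ swapHom c P := by
  have h' := congrArg (fun g => K ◁ (α_ J I P).inv ≫ (α_ K (J ⊗ I) P).inv ≫ g ▷ P ≫
    (α_ I (J ⊗ K) P).hom ≫ I ◁ (α_ J K P).hom) h
  simp only [swapHom, comp_whiskerRight, Category.assoc] at h'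
  calc _ = _ := by simp only [swapHom]; monoidal
    _ = _ := h'
    _ = _ := by simp only [swapHom]; monoidal

theorem swapHom_comp {A B A' B' A'' B'' : C} (f : A ⊗ B ⟶ B' ⊗ A') (g : B' ⊗ A' ⟶ A'' ⊗ B'')
    (P : C) : swapHom f P ≫ swapHom g P = swapHom (f ≫ g) P := by
  simp [swapHom]

theorem swapHom_id (A B P : C) : swapHom (𝟙 (A ⊗ B)) P = 𝟙 _ := by
  simp [swapHom]

/-- The isomorphism `f ⊗ 1 : A ⊗ (B ⊗ P) ≅ B' ⊗ (A' ⊗ P)` for `f : A ⊗ B ≅ B' ⊗ A'`. -/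
def swapIso {A B A' B' : C} (f : A ⊗ B ≅ B' ⊗ A') (P : C) : A ⊗ (B ⊗ P) ≅ B' ⊗ (A' ⊗ P) where
  hom := swapHom f.hom P
  inv := swapHom f.inv P
  hom_inv_id := by rw [swapHom_comp, f.hom_inv_id, swapHom_id]
  inv_hom_id := by rw [swapHom_comp, f.inv_hom_id, swapHom_id]

/-- Products of a family of objects, indexed by words. -/
structure WordProd {ι : Type*} (L : ι → C) where
  /-- the product over a word -/
  obj : List ι → C
  /-- the empty product -/
  nil : 𝟙_ C ≅ obj []
  /-- adding a letter -/
  cons (i : ι) (w : List ι) : L i ⊗ obj w ≅ obj (i :: w)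

namespace WordProd
section
variable {ι : Type*} {L : ι → C} (P : WordProd L)

/-- The isomorphism between the products over equal words. -/
def congr {v w : List ι} (h : v = w) : P.obj v ≅ P.obj w := eqToIso (congrArg P.obj h)

@[simp] theorem congr_refl {v : List ι} (h : v = v) : P.congr h = Iso.refl _ := rfl

@[simp]
theorem congr_hom_congr_hom {u v w : List ι} (h : u = v) (h' : v = w) :
    (P.congr h).hom ≫ (P.congr h').hom = (P.congr (h.trans h')).hom := by
  subst h h'; simp

@[simp]
theorem congr_hom_congr_hom_assoc {u v w : List ι} (h : u = v) (h' : v = w) {Z : C}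
    (g : P.obj w ⟶ Z) :
    (P.congr h).hom ≫ (P.congr h').hom ≫ g = (P.congr (h.trans h')).hom ≫ g := by
  rw [reassoc_of% P.congr_hom_congr_hom h h']

/-- The isomorphism between products over words with a new first letter. -/
def map (i : ι) {v w : List ι} (f : P.obj v ⟶ P.obj w) : P.obj (i :: v) ⟶ P.obj (i :: w) :=
  (P.cons i v).inv ≫ L i ◁ f ≫ (P.cons i w).hom

@[simp]
theorem map_id (i : ι) (v : List ι) : P.map i (𝟙 (P.obj v)) = 𝟙 _ := by simp [map]

theorem map_comp (i : ι) {u v w : List ι} (f : P.obj u ⟶ P.obj v) (g : P.obj v ⟶ P.obj w) :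
    P.map i (f ≫ g) = P.map i f ≫ P.map i g := by simp [map]

theorem map_congr (i : ι) {v w : List ι} (h : v = w) :
    P.map i (P.congr h).hom = (P.congr (congrArg (i :: ·) h)).hom := by subst h; simp

/-- `map` for isomorphisms. -/
@[simps]
def mapIso (i : ι) {v w : List ι} (e : P.obj v ≅ P.obj w) : P.obj (i :: v) ≅ P.obj (i :: w) where
  hom := P.map i e.hom
  inv := P.map i e.inv
  hom_inv_id := by rw [← map_comp, e.hom_inv_id, map_id]
  inv_hom_id := by rw [← map_comp, e.inv_hom_id, map_id]

/-- Interchanging the first two letters of a word. -/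
def swap {i j : ι} (f : L j ⊗ L i ≅ L i ⊗ L j) (w : List ι) :
    P.obj (j :: i :: w) ≅ P.obj (i :: j :: w) :=
  (P.cons j _).symm ≪≫ whiskerLeftIso (L j) (P.cons i w).symm ≪≫ swapIso f (P.obj w) ≪≫
    whiskerLeftIso (L i) (P.cons j w) ≪≫ P.cons i _

theorem swap_hom {i j : ι} (f : L j ⊗ L i ≅ L i ⊗ L j) (w : List ι) :
    (P.swap f w).hom = (P.cons j _).inv ≫ L j ◁ (P.cons i w).inv ≫ swapHom f.hom (P.obj w) ≫
      L i ◁ (P.cons j w).hom ≫ (P.cons i _).hom := rfl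

theorem swap_naturality {i j : ι} (f : L j ⊗ L i ≅ L i ⊗ L j) {v w : List ι}
    (g : P.obj v ⟶ P.obj w) :
    P.map j (P.map i g) ≫ (P.swap f w).hom = (P.swap f v).hom ≫ P.map i (P.map j g) := by
  simp only [swap_hom, map, Category.assoc, Iso.hom_inv_id_assoc, whiskerLeft_comp,
    whiskerLeft_hom_inv_assoc, swapHom_naturality_assoc]

theorem swap_naturality_assoc {i j : ι} (f : L j ⊗ L i ≅ L i ⊗ L j) {v w : List ι}
    (g : P.obj v ⟶ P.obj w) {Z : C} (h : P.obj (i :: j :: w) ⟶ Z) :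
    P.map j (P.map i g) ≫ (P.swap f w).hom ≫ h =
      (P.swap f v).hom ≫ P.map i (P.map j g) ≫ h := by
  rw [reassoc_of% P.swap_naturality f g]

end

variable {s : ℕ} {L : Fin s → C} (P : WordProd L) (c : ∀ i j : Fin s, i < j → (L j ⊗ L i ≅ L i ⊗ L j))

/-- The Yang–Baxter equations for a family of isomorphisms `L j ⊗ L i ≅ L i ⊗ L j`, `i < j`. -/
def _root_.TwistedCoordinateRing.YangBaxter : Prop :=
  ∀ (i j k : Fin s) (hij : i < j) (hjk : j < k),
    swapHom (c j k hjk).hom (L i) ≫ L j ◁ (c i k (hij.trans hjk)).hom ≫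
        swapHom (c i j hij).hom (L k) =
      L k ◁ (c i j hij).hom ≫ swapHom (c i k (hij.trans hjk)).hom (L j) ≫ L i ◁ (c j k hjk).hom

variable {c} in
theorem swap_yangBaxter (hc : YangBaxter c) {i j k : Fin s} (hij : i < j) (hjk : j < k)
    (w : List (Fin s)) :
    (P.swap (c j k hjk) (i :: w)).hom ≫ P.map j (P.swap (c i k (hij.trans hjk)) w).hom ≫
        (P.swap (c i j hij) (k :: w)).hom =
      P.map k (P.swap (c i j hij) w).hom ≫ (P.swap (c i k (hij.trans hjk)) (j :: w)).hom ≫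
        P.map i (P.swap (c j k hjk) w).hom := by
  have hh {A B A₁ A₂ : C} (e : A₁ ≅ A₂) {Z : C} (g : A ⊗ B ⊗ A₁ ⟶ Z) :
      A ◁ B ◁ e.hom ≫ A ◁ B ◁ e.inv ≫ g = g := by
    rw [← whiskerLeft_comp_assoc, whiskerLeft_hom_inv, whiskerLeft_id, Category.id_comp]
  have h := congrArg (fun g => (P.cons k _).inv ≫ L k ◁ (P.cons j _).inv ≫
    L k ◁ L j ◁ (P.cons i w).inv ≫ g ≫ L i ◁ L j ◁ (P.cons k w).hom ≫ L i ◁ (P.cons j _).hom ≫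
      (P.cons i _).hom) (yangBaxter_whiskerRight (hc i j k hij hjk) (P.obj w))
  simp only [Category.assoc] at h
  simp only [swap_hom, map, Category.assoc, Iso.hom_inv_id_assoc, whiskerLeft_comp,
    whiskerLeft_hom_inv_assoc, swapHom_whiskerLeft_iso _ (P.cons _ w), hh]
  exact h

/-- Moving a letter to its place. -/
def insertIso (i : Fin s) : (w : List (Fin s)) →
    P.obj (i :: w) ≅ P.obj (w.orderedInsert (· ≤ ·) i)
  | [] => Iso.refl _
  | j :: w =>
    if h : i ≤ j then P.congr (by rw [List.orderedInsert_cons, if_pos h])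
    else P.swap (c j i (not_le.1 h)) w ≪≫ P.mapIso j (insertIso i w) ≪≫
      P.congr (v := j :: w.orderedInsert (· ≤ ·) i)
        (by rw [List.orderedInsert_cons, if_neg h])

/-- Reordering the factors of a product over a word in nondecreasing order. -/
def sortIso : (w : List (Fin s)) → P.obj w ≅ P.obj (w.insertionSort (· ≤ ·))
  | [] => Iso.refl _
  | i :: w => P.mapIso i (sortIso w) ≪≫ P.insertIso c i (w.insertionSort (· ≤ ·))

variable {c} in
theorem insertIso_eq_congr {i : Fin s} {w : List (Fin s)} (h : ∀ j ∈ w.head?, i ≤ j)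
    (h' : i :: w = w.orderedInsert (· ≤ ·) i) : P.insertIso c i w = P.congr h' := by
  cases w with
  | nil => rfl
  | cons j w => exact dif_pos (h j rfl)

variable {c} in
theorem insertIso_of_lt {i j : Fin s} {w : List (Fin s)} (h : j < i)
    (h' : j :: w.orderedInsert (· ≤ ·) i = (j :: w).orderedInsert (· ≤ ·) i) :
    (P.insertIso c i (j :: w)).hom =
      (P.swap (c j i h) w).hom ≫ P.map j (P.insertIso c i w).hom ≫ (P.congr h').hom :=
  congrArg Iso.hom (dif_neg (not_le.2 h) : P.insertIso c i (j :: w) = _)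

theorem congr_insertIso (i : Fin s) {v w : List (Fin s)} (h : v = w) :
    P.map i (P.congr h).hom ≫ (P.insertIso c i w).hom =
      (P.insertIso c i v).hom ≫ (P.congr (congrArg (List.orderedInsert (· ≤ ·) i) h)).hom := by
  subst h; simp

theorem congr_insertIso_assoc (i : Fin s) {v w : List (Fin s)} (h : v = w) {Z : C}
    (g : P.obj (w.orderedInsert (· ≤ ·) i) ⟶ Z) :
    P.map i (P.congr h).hom ≫ (P.insertIso c i w).hom ≫ g =
      (P.insertIso c i v).hom ≫ (P.congr (congrArg (List.orderedInsert (· ≤ ·) i) h)).hom ≫ g := by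
  rw [reassoc_of% P.congr_insertIso c i h]

variable {c}

/-- The heart of the coherence theorem, by induction on the word. If `i` does not exceed the head,
it stays in front, and inserting `j` behind it costs exactly the one swap on the right. If the head
`l` is smaller than both letters, each has to pass `l`, and Yang–Baxter allows interchanging `i` and
`j` after they have passed instead of before. -/
theorem insertIso_insertIso (hc : YangBaxter c) {i j : Fin s} (h : i < j) (w : List (Fin s))
    (h' : (w.orderedInsert (· ≤ ·) i).orderedInsert (· ≤ ·) j =
      (w.orderedInsert (· ≤ ·) j).orderedInsert (· ≤ ·) i) :
    P.map j (P.insertIso c i w).hom ≫ (P.insertIso c j (w.orderedInsert (· ≤ ·) i)).hom ≫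
        (P.congr h').hom =
      (P.swap (c i j h) w).hom ≫ P.map i (P.insertIso c j w).hom ≫
        (P.insertIso c i (w.orderedInsert (· ≤ ·) j)).hom := by
  induction w with
  | nil =>
    change P.map j (𝟙 _) ≫ (P.insertIso c j [i]).hom ≫ _ =
      _ ≫ P.map i (𝟙 _) ≫ (P.insertIso c i [j]).hom
    rw [P.insertIso_of_lt h (w := []) (by simp [h]),
      P.insertIso_eq_congr (w := [j]) (by simpa using h.le) (by simp [h.le])]
    erw [map_id, map_id, Category.id_comp, Category.id_comp, Category.assoc, Category.id_comp,
      congr_hom_congr_hom]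
    rfl
  | cons l w ih =>
    obtain hl | hl := le_or_gt i l
    · have e : i :: l :: w = (l :: w).orderedInsert (· ≤ ·) i := by
        rw [List.orderedInsert_cons, if_pos hl]
      have e' : i :: (l :: w).orderedInsert (· ≤ ·) j =
          (i :: l :: w).orderedInsert (· ≤ ·) j := by
        rw [List.orderedInsert_cons _ _ i, if_neg (not_le.2 h)]
      have hh : ∀ a ∈ ((l :: w).orderedInsert (· ≤ ·) j).head?, i ≤ a := by
        rw [List.orderedInsert_cons]
        split_ifs <;> simp [h.le, hl]
      rw [P.insertIso_eq_congr (by simpa using hl) e, congr_insertIso_assoc,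
        P.insertIso_of_lt h e', P.insertIso_eq_congr hh (by rw [e', e, h'])]
      simp
    · have e : l :: w.orderedInsert (· ≤ ·) i = (l :: w).orderedInsert (· ≤ ·) i := by
        rw [List.orderedInsert_cons, if_neg (not_le.2 hl)]
      have e' : l :: w.orderedInsert (· ≤ ·) j = (l :: w).orderedInsert (· ≤ ·) j := by
        rw [List.orderedInsert_cons, if_neg (not_le.2 (hl.trans h))]
      have e₁ : l :: (w.orderedInsert (· ≤ ·) i).orderedInsert (· ≤ ·) j =
          (l :: w.orderedInsert (· ≤ ·) i).orderedInsert (· ≤ ·) j := by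
        rw [List.orderedInsert_cons _ _ l, if_neg (not_le.2 (hl.trans h))]
      have e₂ : l :: (w.orderedInsert (· ≤ ·) j).orderedInsert (· ≤ ·) i =
          (l :: w.orderedInsert (· ≤ ·) j).orderedInsert (· ≤ ·) i := by
        rw [List.orderedInsert_cons _ _ l, if_neg (not_le.2 hl)]
      -- The inductive hypothesis needs the equality of the tails, obtained by cancelling the common
      -- head `l`.
      have e₃ : (w.orderedInsert (· ≤ ·) i).orderedInsert (· ≤ ·) j =
          (w.orderedInsert (· ≤ ·) j).orderedInsert (· ≤ ·) i :=
        List.cons_injective (e₁.trans ((congrArg _ e).trans (h'.trans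
          ((congrArg _ e').symm.trans e₂.symm))))
      have ih := congrArg (P.map l) (ih e₃)
      rw [P.insertIso_of_lt hl e, P.insertIso_of_lt (hl.trans h) e', P.map_comp, P.map_comp,
        Category.assoc, Category.assoc, congr_insertIso_assoc, P.insertIso_of_lt (hl.trans h) e₁,
        P.map_comp, P.map_comp, Category.assoc, Category.assoc, Category.assoc, Category.assoc,
        congr_insertIso, P.insertIso_of_lt hl e₂]
      simp only [map_comp, Category.assoc, congr_hom_congr_hom, map_congr, swap_naturality_assoc]
        at ih ⊢
      -- Once both letters are moved past `l`, everything left happens behind `l` and is the image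
      -- of the inductive hypothesis under `P.map l`.
      rw [reassoc_of% P.swap_yangBaxter hc hl h, ← reassoc_of% ih, congr_hom_congr_hom]

variable (c) in
/-- The isomorphisms between products over words generated by the isomorphisms interchanging two
neighbouring letters. -/
inductive Reorder : ∀ {v w : List (Fin s)}, (P.obj v ≅ P.obj w) → Prop
  | refl (v : List (Fin s)) : Reorder (Iso.refl (P.obj v))
  | map (i : Fin s) {v w : List (Fin s)} {e : P.obj v ≅ P.obj w} (he : Reorder e) :
      Reorder (P.mapIso i e)
  | swap {i j : Fin s} (h : i < j) (w : List (Fin s)) : Reorder (P.swap (c i j h) w)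
  | symm {v w : List (Fin s)} {e : P.obj v ≅ P.obj w} (he : Reorder e) : Reorder e.symm
  | trans {u v w : List (Fin s)} {e : P.obj u ≅ P.obj v} {e' : P.obj v ≅ P.obj w}
      (he : Reorder e) (he' : Reorder e') : Reorder (e ≪≫ e')

theorem insertionSort_eq_of_perm {v w : List (Fin s)} (h : v.Perm w) :
    v.insertionSort (· ≤ ·) = w.insertionSort (· ≤ ·) :=
  List.Perm.eq_of_pairwise' (List.pairwise_insertionSort _ v) (List.pairwise_insertionSort _ w)
    ((List.perm_insertionSort _ v).trans (h.trans (List.perm_insertionSort _ w).symm))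

/-- Sorting absorbs each generator: an interchange by `insertIso_insertIso`, a reordering behind a
first letter because the inserted letter sees only the sorted tail. Inverses and composites follow.
-/
theorem Reorder.exists_sortIso (hc : YangBaxter c) {v w : List (Fin s)} {e : P.obj v ≅ P.obj w}
    (he : P.Reorder c e) : ∃ h : v.insertionSort (· ≤ ·) = w.insertionSort (· ≤ ·),
      (P.sortIso c v).hom ≫ (P.congr h).hom = e.hom ≫ (P.sortIso c w).hom := by
  induction he with
  | refl v => exact ⟨rfl, by simp⟩
  | @map i v w e he ih =>
    obtain ⟨h, ih⟩ := ih
    refine ⟨congrArg (List.orderedInsert (· ≤ ·) i) h, ?_⟩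
    change (P.map i _ ≫ _) ≫ _ = P.map i _ ≫ P.map i _ ≫ _
    rw [← Category.assoc, ← map_comp, ← ih, Category.assoc, map_comp, Category.assoc]
    exact congrArg _ (P.congr_insertIso c i h).symm
  | @swap i j h w =>
    have h' := insertionSort_eq_of_perm (List.Perm.swap i j w)
    refine ⟨h', ?_⟩
    change (P.map j (P.map i _ ≫ _) ≫ _) ≫ _ = _ ≫ P.map i (P.map j _ ≫ _) ≫ _
    have := P.insertIso_insertIso hc h (w.insertionSort (· ≤ ·)) h'
    simp only [map_comp, Category.assoc]
    erw [this, swap_naturality_assoc]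
    rfl
  | symm he ih =>
    obtain ⟨h, ih⟩ := ih
    refine ⟨h.symm, ?_⟩
    rw [Iso.symm_hom, Iso.eq_inv_comp, ← reassoc_of% ih, congr_hom_congr_hom, congr_refl]
    exact Category.comp_id _
  | trans he he' ih ih' =>
    obtain ⟨h, ih⟩ := ih
    obtain ⟨h', ih'⟩ := ih'
    exact ⟨h.trans h', by
      rw [Iso.trans_hom, Category.assoc, ← ih', ← reassoc_of% ih, congr_hom_congr_hom]⟩

/-- A reordering equals the sorting of its source followed by the inverse sorting of its target, so
it is determined by the two words. -/
theorem Reorder.unique (hc : YangBaxter c) {v w : List (Fin s)} {e e' : P.obj v ≅ P.obj w}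
    (he : P.Reorder c e) (he' : P.Reorder c e') : e = e' := by
  obtain ⟨h, H⟩ := he.exists_sortIso P hc
  obtain ⟨_, H'⟩ := he'.exists_sortIso P hc
  exact Iso.ext ((cancel_mono (P.sortIso c w).hom).1 (H.symm.trans H'))

theorem Reorder.congr {v w : List (Fin s)} (h : v = w) : P.Reorder c (P.congr h) := by
  subst h
  exact .refl v

theorem reorder_insertIso (i : Fin s) (w : List (Fin s)) : P.Reorder c (P.insertIso c i w) := by
  induction w with
  | nil => exact .refl _
  | cons j w ih =>
    rw [insertIso]
    split_ifs with h
    · exact .congr _ _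
    · exact .trans (.swap _ _) (.trans (.map j ih) (.congr _ _))

theorem reorder_sortIso (w : List (Fin s)) : P.Reorder c (P.sortIso c w) := by
  induction w with
  | nil => exact .refl _
  | cons i w ih => exact .trans (.map i ih) (P.reorder_insertIso i _)

end WordProd
end Words

/-! ### Concatenation of words. -/

section Words
variable {C : Type*} [Category* C] [MonoidalCategory C]

theorem swapHom_tensor {A B A' B' : C} (f : A ⊗ B ⟶ B' ⊗ A') (P Q : C) :
    swapHom f (P ⊗ Q) = A ◁ (α_ B P Q).inv ≫ (α_ A (B ⊗ P) Q).inv ≫ swapHom f P ▷ Q ≫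
      (α_ B' (A' ⊗ P) Q).hom ≫ B' ◁ (α_ A' P Q).hom := by
  simp only [swapHom]; monoidal

namespace WordProd
section
variable {ι : Type*} {L : ι → C} (P : WordProd L)

/-- The product over a concatenation of words is the tensor product. -/
def append : (v w : List ι) → (P.obj v ⊗ P.obj w ≅ P.obj (v ++ w))
  | [], _ => whiskerRightIso P.nil.symm _ ≪≫ λ_ _
  | i :: v, w => whiskerRightIso (P.cons i v).symm _ ≪≫ α_ _ _ _ ≪≫
      whiskerLeftIso _ (append v w) ≪≫ P.cons i (v ++ w)

theorem append_nil_hom (w : List ι) :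
    (P.append [] w).hom = P.nil.inv ▷ P.obj w ≫ (λ_ _).hom := rfl

theorem append_cons_hom (i : ι) (v w : List ι) :
    (P.append (i :: v) w).hom = (P.cons i v).inv ▷ P.obj w ≫ (α_ _ _ _).hom ≫
      L i ◁ (P.append v w).hom ≫ (P.cons i (v ++ w)).hom := rfl

theorem append_cons_inv (i : ι) (v w : List ι) :
    (P.append (i :: v) w).inv = (P.cons i (v ++ w)).inv ≫ L i ◁ (P.append v w).inv ≫
      (α_ _ _ _).inv ≫ (P.cons i v).hom ▷ P.obj w := by
  simp [append]

/-- By induction on `u` this comes down to the compatibility of the left unitor with the associator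
and to the pentagon. -/
theorem append_assoc (u v w : List ι) :
    (P.append u v).hom ▷ P.obj w ≫ (P.append (u ++ v) w).hom ≫
        (P.congr (List.append_assoc u v w)).hom =
      (α_ _ _ _).hom ≫ P.obj u ◁ (P.append v w).hom ≫ (P.append u (v ++ w)).hom := by
  induction u with
  | nil =>
    change (P.nil.inv ▷ P.obj v ≫ (λ_ _).hom) ▷ P.obj w ≫ (P.append v w).hom ≫ 𝟙 _ =
      (α_ _ _ _).hom ≫ P.obj [] ◁ (P.append v w).hom ≫ P.nil.inv ▷ P.obj (v ++ w) ≫ (λ_ _).hom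
    rw [whisker_exchange_assoc, leftUnitor_naturality]
    simp
  | cons i u ih =>
    have h : (P.congr (List.append_assoc (i :: u) v w)).hom =
      (P.cons i _).inv ≫ L i ◁ (P.congr (List.append_assoc u v w)).hom ≫ (P.cons i _).hom :=
      (P.map_congr i (List.append_assoc u v w)).symm
    have h' : (P.append (i :: u ++ v) w).hom = _ := P.append_cons_hom i (u ++ v) w
    have h'' : (P.append (i :: u) (v ++ w)).hom = _ := P.append_cons_hom i u (v ++ w)
    rw [h, h', h'', append_cons_hom]
    have ih := congrArg (L i ◁ ·) ih
    simp only [whiskerLeft_comp] at ih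
    have e : L i ◁ (P.append u v).hom ▷ P.obj w =
      (α_ _ _ _).inv ≫ (L i ◁ (P.append u v).hom) ▷ P.obj w ≫ (α_ _ _ _).hom := by simp
    rw [e] at ih
    simp only [Category.assoc, Iso.hom_inv_id_assoc, comp_whiskerRight,
      hom_inv_whiskerRight_assoc] at ih ⊢
    have ih' := congrArg (fun g => (P.cons i u).inv ▷ P.obj v ▷ P.obj w ≫
      (α_ (L i) (P.obj u) (P.obj v)).hom ▷ P.obj w ≫ (α_ _ _ _).hom ≫ g ≫ (P.cons i _).hom) ih
    simp only [Category.assoc, Iso.hom_inv_id_assoc] at ih'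
    refine ih'.trans ?_
    simp [whisker_exchange_assoc]

theorem append_nil_right (v : List ι) :
    (P.append v []).hom ≫ (P.congr (List.append_nil v)).hom =
      P.obj v ◁ P.nil.inv ≫ (ρ_ _).hom := by
  induction v with
  | nil =>
    change (P.nil.inv ▷ P.obj [] ≫ (λ_ _).hom) ≫ 𝟙 _ = _
    rw [Category.comp_id, ← cancel_mono P.nil.inv, Category.assoc, Category.assoc,
      ← leftUnitor_naturality, ← rightUnitor_naturality, whisker_exchange_assoc, unitors_equal]
  | cons i v ih =>
    have h : (P.congr (List.append_nil (i :: v))).hom =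
      (P.cons i _).inv ≫ L i ◁ (P.congr (List.append_nil v)).hom ≫ (P.cons i _).hom :=
      (P.map_congr i (List.append_nil v)).symm
    have ih := congrArg (L i ◁ ·) ih
    simp only [whiskerLeft_comp] at ih
    have ih' := congrArg (fun g => (P.cons i v).inv ▷ P.obj [] ≫ (α_ _ _ _).hom ≫ g ≫
      (P.cons i v).hom) ih
    rw [h, append_cons_hom]
    simp only [Category.assoc, Iso.hom_inv_id_assoc] at ih' ⊢
    refine ih'.trans ?_
    simp only [whiskerLeft_rightUnitor, Category.assoc]
    rw [← associator_naturality_right_assoc, Iso.hom_inv_id_assoc, ← rightUnitor_naturality,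
      ← whisker_exchange_assoc, inv_hom_whiskerRight_assoc]

/-- The isomorphism of products over words with a common right factor added. -/
def appendRight {v v' : List ι} (e : P.obj v ≅ P.obj v') (w : List ι) :
    P.obj (v ++ w) ≅ P.obj (v' ++ w) :=
  (P.append v w).symm ≪≫ whiskerRightIso e (P.obj w) ≪≫ P.append v' w

/-- The isomorphism of products over words with a common left factor added. -/
def appendLeft (v : List ι) {w w' : List ι} (e : P.obj w ≅ P.obj w') :
    P.obj (v ++ w) ≅ P.obj (v ++ w') :=
  (P.append v w).symm ≪≫ whiskerLeftIso (P.obj v) e ≪≫ P.append v w'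

theorem appendRight_map (i : ι) {v v' : List ι} (e : P.obj v ≅ P.obj v') (w : List ι) :
    P.appendRight (P.mapIso i e) w = P.mapIso i (P.appendRight e w) := by
  ext1
  simp only [appendRight, Iso.trans_hom, Iso.symm_hom, append_cons_inv, append_cons_hom,
    whiskerRightIso_hom, mapIso_hom, map, Category.assoc, comp_whiskerRight,
    hom_inv_whiskerRight_assoc]
  simp

theorem appendRight_swap {i j : ι} (f : L j ⊗ L i ≅ L i ⊗ L j) (v w : List ι) :
    P.appendRight (P.swap f v) w = P.swap f (v ++ w) := by
  ext1
  simp only [appendRight, Iso.trans_hom, Iso.symm_hom, append_cons_inv, append_cons_hom,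
    whiskerRightIso_hom, swap_hom, Category.assoc, comp_whiskerRight,
    hom_inv_whiskerRight_assoc, swapHom_whiskerLeft_iso f.hom (P.append v w),
    swapHom_tensor]
  simp

theorem appendLeft_nil {w w' : List ι} (e : P.obj w ≅ P.obj w') : P.appendLeft [] e = e := by
  ext1
  change ((λ_ _).inv ≫ P.nil.hom ▷ P.obj w) ≫ P.obj [] ◁ e.hom ≫ P.nil.inv ▷ P.obj w' ≫
    (λ_ _).hom = _
  simp [← whisker_exchange_assoc]

theorem appendLeft_cons (i : ι) (v : List ι) {w w' : List ι} (e : P.obj w ≅ P.obj w') :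
    P.appendLeft (i :: v) e = P.mapIso i (P.appendLeft v e) := by
  ext1
  simp only [appendLeft, Iso.trans_hom, Iso.symm_hom, append_cons_inv, append_cons_hom,
    whiskerLeftIso_hom, mapIso_hom, map, Category.assoc]
  simp [← whisker_exchange_assoc]

end
variable {s : ℕ} {L : Fin s → C} {P : WordProd L} {c : ∀ i j : Fin s, i < j → (L j ⊗ L i ≅ L i ⊗ L j)}

/-- Generators work from the front of a word, so letters added on the right only lengthen the tail
behind them. -/
theorem Reorder.appendRight {v v' : List (Fin s)} {e : P.obj v ≅ P.obj v'} (he : P.Reorder c e)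
    (w : List (Fin s)) : P.Reorder c (P.appendRight e w) := by
  induction he with
  | refl v =>
    have : P.appendRight (Iso.refl (P.obj v)) w = Iso.refl _ := by simp [WordProd.appendRight]
    rw [this]
    exact .refl _
  | map i he ih =>
    rw [appendRight_map]
    exact .map i ih
  | swap h v =>
    rw [appendRight_swap]
    exact .swap h _
  | @symm v v' e he ih =>
    have : P.appendRight e.symm w = (P.appendRight e w).symm := by
      ext1; simp [WordProd.appendRight]
    rw [this]
    exact .symm ih
  | @trans _ _ _ e e' he he' ih ih' =>
    have : P.appendRight (e ≪≫ e') w = P.appendRight e w ≪≫ P.appendRight e' w := by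
      ext1; simp [WordProd.appendRight]
    rw [this]
    exact .trans ih ih'

/-- Adding letters on the left is an iteration of the generator `map`. -/
theorem Reorder.appendLeft (v : List (Fin s)) {w w' : List (Fin s)} {e : P.obj w ≅ P.obj w'}
    (he : P.Reorder c e) : P.Reorder c (P.appendLeft v e) := by
  induction v with
  | nil =>
    rw [appendLeft_nil]
    exact he
  | cons i v ih =>
    rw [appendLeft_cons]
    exact .map i ih

end WordProd
end Words

/-! ### Letters at the end of a word, and functors reversing tensor products. -/

section Words
variable {C : Type*} [Category* C] [MonoidalCategory C]

namespace WordProd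
section
variable {ι : Type*} {L : ι → C} (P : WordProd L)

/-- The product over a word with one letter. -/
def single (i : ι) : L i ≅ P.obj [i] := (ρ_ _).symm ≪≫ whiskerLeftIso _ P.nil ≪≫ P.cons i []

/-- Adding a letter at the end. -/
def snoc (v : List ι) (i : ι) : P.obj v ⊗ L i ≅ P.obj (v ++ [i]) :=
  whiskerLeftIso _ (P.single i) ≪≫ P.append v [i]

theorem snoc_hom (v : List ι) (i : ι) :
    (P.snoc v i).hom = P.obj v ◁ (P.single i).hom ≫ (P.append v [i]).hom := rfl

theorem appendRight_snoc_inv {v w : List ι} (e : P.obj v ≅ P.obj w) (i : ι) :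
    (P.appendRight e [i]).hom ≫ (P.snoc w i).inv = (P.snoc v i).inv ≫ e.hom ▷ L i := by
  simp [appendRight, snoc, whisker_exchange]

theorem append_snoc (v w : List ι) (i : ι) :
    P.obj v ◁ (P.snoc w i).hom ≫ (P.append v (w ++ [i])).hom =
      (α_ _ _ _).inv ≫ (P.append v w).hom ▷ L i ≫ (P.snoc (v ++ w) i).hom ≫
        (P.congr (List.append_assoc v w [i])).hom := by
  have h := P.append_assoc v w [i]
  rw [← Iso.inv_comp_eq] at h
  simp only [snoc_hom, whiskerLeft_comp, Category.assoc]
  rw [← h, associator_inv_naturality_right_assoc, whisker_exchange_assoc]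

theorem congr_snoc_inv {v w : List ι} (h : v = w) (i : ι) :
    (P.snoc v i).inv ≫ (P.congr h).hom ▷ L i =
      (P.congr (congrArg (· ++ [i]) h)).hom ≫ (P.snoc w i).inv := by
  subst h; simp

theorem whiskerLeft_congr_append (u : List ι) {v w : List ι} (h : v = w) :
    P.obj u ◁ (P.congr h).hom ≫ (P.append u w).hom =
      (P.append u v).hom ≫ (P.congr (congrArg (u ++ ·) h)).hom := by
  subst h; simp

theorem whiskerLeft_congr_append_assoc (u : List ι) {v w : List ι} (h : v = w) {Z : C}
    (g : P.obj (u ++ w) ⟶ Z) :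
    P.obj u ◁ (P.congr h).hom ≫ (P.append u w).hom ≫ g =
      (P.append u v).hom ≫ (P.congr (congrArg (u ++ ·) h)).hom ≫ g := by
  rw [reassoc_of% P.whiskerLeft_congr_append u h]

/-- The product over a word with two letters. -/
def pair (i j : ι) : L i ⊗ L j ≅ P.obj [i, j] := whiskerLeftIso _ (P.single j) ≪≫ P.cons i [j]

theorem append_single_single (i j : ι) :
    (P.single i).hom ▷ L j ≫ (P.snoc [i] j).hom = (P.pair i j).hom := by
  have h : (P.append [i] [j]).hom = (P.cons i []).inv ▷ P.obj [j] ≫ (α_ _ _ _).hom ≫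
      L i ◁ (P.nil.inv ▷ P.obj [j] ≫ (λ_ _).hom) ≫ (P.cons i [j]).hom := rfl
  rw [snoc_hom, h, ← whisker_exchange_assoc]
  simp [single, pair]

theorem snoc_snoc (v : List ι) (i j : ι) :
    (P.snoc v i).hom ▷ L j ≫ (P.snoc (v ++ [i]) j).hom ≫
        (P.congr (List.append_assoc v [i] [j])).hom =
      (α_ _ _ _).hom ≫ P.obj v ◁ (P.pair i j).hom ≫ (P.append v [i, j]).hom := by
  have h := P.append_snoc v [i] j
  rw [Iso.eq_inv_comp] at h
  rw [snoc_hom, comp_whiskerRight, Category.assoc, ← h, ← append_single_single]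
  simp

theorem pair_swap {i j : ι} (f : L j ⊗ L i ≅ L i ⊗ L j) :
    (P.pair j i).hom ≫ (P.swap f []).hom = f.hom ≫ (P.pair i j).hom := by
  have h := swapHom_whiskerLeft_iso f.hom P.nil
  have h' : swapHom f.hom (𝟙_ C) = L j ◁ (ρ_ (L i)).hom ≫ f.hom ≫ L i ◁ (ρ_ (L j)).inv := by
    simp only [swapHom]; monoidal
  simp [pair, single, swap_hom, h, h']

theorem pair_swap_inv {i j : ι} (f : L j ⊗ L i ≅ L i ⊗ L j) :
    (P.swap f []).inv ≫ (P.pair j i).inv = (P.pair i j).inv ≫ f.inv := by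
  rw [← cancel_mono (P.pair j i).hom, ← cancel_mono (P.swap f []).hom]
  simp [pair_swap]

theorem snoc_inv_snoc_inv (v : List ι) (i j : ι) :
    (P.snoc (v ++ [i]) j).inv ≫ (P.snoc v i).inv ▷ L j ≫ (α_ _ _ _).hom =
      (P.congr (List.append_assoc v [i] [j])).hom ≫ (P.append v [i, j]).inv ≫
        P.obj v ◁ (P.pair i j).inv := by
  have h := (cancel_epi ((P.snoc (v ++ [i]) j).inv ≫ (P.snoc v i).inv ▷ L j)).2
    (P.snoc_snoc v i j)
  simp only [Category.assoc, inv_hom_whiskerRight_assoc, Iso.inv_hom_id_assoc] at h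
  rw [h]
  simp

end
end WordProd

variable (C) in
/-- A functor reversing tensor products. -/
structure ReversingFunctor where
  /-- the functor -/
  functor : C ⥤ C
  /-- the image of a tensor product -/
  tensor (A B : C) : functor.obj (A ⊗ B) ≅ functor.obj B ⊗ functor.obj A
  /-- the image of the unit -/
  unit : functor.obj (𝟙_ C) ≅ 𝟙_ C
  map_whiskerRight {A A' : C} (f : A ⟶ A') (B : C) :
    functor.map (f ▷ B) ≫ (tensor A' B).hom = (tensor A B).hom ≫ functor.obj B ◁ functor.map f
  map_whiskerLeft {A A' : C} (f : A ⟶ A') (B : C) :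
    functor.map (B ◁ f) ≫ (tensor B A').hom = (tensor B A).hom ≫ functor.map f ▷ functor.obj B
  map_associator (A B D : C) :
    functor.map (α_ A B D).hom ≫ (tensor A (B ⊗ D)).hom ≫ (tensor B D).hom ▷ functor.obj A ≫
      (α_ _ _ _).hom = (tensor (A ⊗ B) D).hom ≫ functor.obj D ◁ (tensor A B).hom
  map_rightUnitor (A : C) :
    functor.map (ρ_ A).hom = (tensor A (𝟙_ C)).hom ≫ unit.hom ▷ functor.obj A ≫ (λ_ _).hom

namespace ReversingFunctor

/-- A reversing functor from its action on objects and morphisms. -/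
def ofMap (obj : C → C) (map : ∀ {A B : C}, (A ⟶ B) → (obj A ⟶ obj B))
    (map_id : ∀ A : C, map (𝟙 A) = 𝟙 (obj A))
    (map_comp : ∀ {A B D : C} (f : A ⟶ B) (g : B ⟶ D), map (f ≫ g) = map f ≫ map g)
    (tensor : ∀ A B : C, obj (A ⊗ B) ≅ obj B ⊗ obj A) (unit : obj (𝟙_ C) ≅ 𝟙_ C)
    (map_whiskerRight : ∀ {A A' : C} (f : A ⟶ A') (B : C),
      map (f ▷ B) ≫ (tensor A' B).hom = (tensor A B).hom ≫ obj B ◁ map f)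
    (map_whiskerLeft : ∀ {A A' : C} (f : A ⟶ A') (B : C),
      map (B ◁ f) ≫ (tensor B A').hom = (tensor B A).hom ≫ map f ▷ obj B)
    (map_associator : ∀ A B D : C,
      map (α_ A B D).hom ≫ (tensor A (B ⊗ D)).hom ≫ (tensor B D).hom ▷ obj A ≫ (α_ _ _ _).hom =
        (tensor (A ⊗ B) D).hom ≫ obj D ◁ (tensor A B).hom)
    (map_rightUnitor : ∀ A : C,
      map (ρ_ A).hom = (tensor A (𝟙_ C)).hom ≫ unit.hom ▷ obj A ≫ (λ_ _).hom) :
    ReversingFunctor C where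
  functor := { obj, map, map_id, map_comp }
  tensor := tensor
  unit := unit
  map_whiskerRight := map_whiskerRight
  map_whiskerLeft := map_whiskerLeft
  map_associator := map_associator
  map_rightUnitor := map_rightUnitor

variable (F : ReversingFunctor C)

theorem map_whiskerRight_assoc {A A' : C} (f : A ⟶ A') (B : C) {Z : C}
    (g : F.functor.obj B ⊗ F.functor.obj A' ⟶ Z) :
    F.functor.map (f ▷ B) ≫ (F.tensor A' B).hom ≫ g =
      (F.tensor A B).hom ≫ F.functor.obj B ◁ F.functor.map f ≫ g := by
  rw [reassoc_of% F.map_whiskerRight f B]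

theorem map_whiskerLeft_assoc {A A' : C} (f : A ⟶ A') (B : C) {Z : C}
    (g : F.functor.obj A' ⊗ F.functor.obj B ⟶ Z) :
    F.functor.map (B ◁ f) ≫ (F.tensor B A').hom ≫ g =
      (F.tensor B A).hom ≫ F.functor.map f ▷ F.functor.obj B ≫ g := by
  rw [reassoc_of% F.map_whiskerLeft f B]

theorem map_associator_assoc (A B D : C) {Z : C}
    (g : F.functor.obj D ⊗ F.functor.obj B ⊗ F.functor.obj A ⟶ Z) :
    F.functor.map (α_ A B D).hom ≫ (F.tensor A (B ⊗ D)).hom ≫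
        (F.tensor B D).hom ▷ F.functor.obj A ≫ (α_ _ _ _).hom ≫ g =
      (F.tensor (A ⊗ B) D).hom ≫ F.functor.obj D ◁ (F.tensor A B).hom ≫ g := by
  rw [reassoc_of% F.map_associator A B D]

/-- The isomorphism induced by the inverse of `f` on the images. -/
def swap {A B : C} (f : B ⊗ A ≅ A ⊗ B) :
    F.functor.obj B ⊗ F.functor.obj A ≅ F.functor.obj A ⊗ F.functor.obj B :=
  (F.tensor A B).symm ≪≫ F.functor.mapIso f.symm ≪≫ F.tensor B A

/-- Reversal moves the end of a product to the front, so `f.inv` on the last two factors becomes an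
interchange of the first two. -/
theorem tensor_swapHom {A B : C} (f : B ⊗ A ≅ A ⊗ B) (P : C) :
    (F.tensor P (A ⊗ B)).hom ≫ (F.tensor A B).hom ▷ F.functor.obj P ≫ (α_ _ _ _).hom ≫
        swapHom (F.swap f).hom (F.functor.obj P) =
      F.functor.map (P ◁ f.inv) ≫ (F.tensor P (B ⊗ A)).hom ≫
        (F.tensor B A).hom ▷ F.functor.obj P ≫ (α_ _ _ _).hom := by
  simp [swapHom, swap, map_whiskerLeft_assoc]

theorem tensor_swapHom_assoc {A B : C} (f : B ⊗ A ≅ A ⊗ B) (P : C) {Z : C}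
    (g : F.functor.obj A ⊗ F.functor.obj B ⊗ F.functor.obj P ⟶ Z) :
    (F.tensor P (A ⊗ B)).hom ≫ (F.tensor A B).hom ▷ F.functor.obj P ≫ (α_ _ _ _).hom ≫
        swapHom (F.swap f).hom (F.functor.obj P) ≫ g =
      F.functor.map (P ◁ f.inv) ≫ (F.tensor P (B ⊗ A)).hom ≫
        (F.tensor B A).hom ▷ F.functor.obj P ≫ (α_ _ _ _).hom ≫ g := by
  rw [reassoc_of% F.tensor_swapHom f P]

section
variable {ι : Type*} {L : ι → C} (P : WordProd L) (P' : WordProd fun i => F.functor.obj (L i))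

/-- The image of a product over a word is the product over the reversed word. -/
def prod : (w : List ι) → (F.functor.obj (P.obj w.reverse) ≅ P'.obj w)
  | [] => F.functor.mapIso P.nil.symm ≪≫ F.unit ≪≫ P'.nil
  | i :: v => F.functor.mapIso (P.congr List.reverse_cons ≪≫ (P.snoc v.reverse i).symm) ≪≫
      F.tensor (P.obj v.reverse) (L i) ≪≫ whiskerLeftIso _ (prod v) ≪≫ P'.cons i v

theorem prod_nil_hom : (F.prod P P' []).hom =
    F.functor.map P.nil.inv ≫ F.unit.hom ≫ P'.nil.hom := rfl

theorem prod_cons_hom (i : ι) (v : List ι) : (F.prod P P' (i :: v)).hom =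
    F.functor.map ((P.congr List.reverse_cons).hom ≫ (P.snoc v.reverse i).inv) ≫
      (F.tensor (P.obj v.reverse) (L i)).hom ≫ F.functor.obj (L i) ◁ (F.prod P P' v).hom ≫
      (P'.cons i v).hom := rfl

/-- Induction on `v`, whose first letter is the last letter of its reverse: `append_snoc` splits it
off before applying the functor, and `map_associator` does so afterwards. The empty word is the
axiom `map_rightUnitor`. -/
theorem prod_append (v w : List ι) :
    (F.tensor (P.obj w.reverse) (P.obj v.reverse)).hom ≫
        ((F.prod P P' v).hom ⊗ₘ (F.prod P P' w).hom) ≫ (P'.append v w).hom =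
      F.functor.map ((P.append w.reverse v.reverse).hom ≫
        (P.congr List.reverse_append.symm).hom) ≫ (F.prod P P' (v ++ w)).hom := by
  induction v with
  | nil =>
    have h : (P.append w.reverse ([] : List ι).reverse).hom ≫
      (P.congr (v := w.reverse ++ [].reverse) (w := w.reverse) List.reverse_append.symm).hom = _ :=
      P.append_nil_right w.reverse
    refine Eq.trans ?_ (congrArg (fun g => F.functor.map g ≫ (F.prod P P' w).hom) h).symm
    change (F.tensor (P.obj w.reverse) (P.obj [])).hom ≫
      (F.functor.map P.nil.inv ≫ F.unit.hom ≫ P'.nil.hom ⊗ₘ (F.prod P P' w).hom) ≫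
        P'.nil.inv ▷ P'.obj w ≫ (λ_ _).hom =
      F.functor.map (P.obj w.reverse ◁ P.nil.inv ≫ (ρ_ _).hom) ≫ (F.prod P P' w).hom
    rw [MonoidalCategory.tensorHom_def, Category.assoc, whisker_exchange_assoc,
      leftUnitor_naturality]
    simp only [F.functor.map_comp, Category.assoc, map_rightUnitor, map_whiskerLeft_assoc,
      comp_whiskerRight, hom_inv_whiskerRight_assoc]
  | cons i v ih =>
    have h := P.append_snoc w.reverse v.reverse i
    -- Concatenating and then splitting off the final `i` agrees with splitting it off from the
    -- second factor and then concatenating.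
    have h' : (P.append w.reverse (i :: v).reverse).hom ≫
        (P.congr List.reverse_append.symm).hom ≫
        (P.congr List.reverse_cons).hom ≫ (P.snoc (v ++ w).reverse i).inv =
      P.obj w.reverse ◁ ((P.congr List.reverse_cons).hom ≫ (P.snoc v.reverse i).inv) ≫
        (α_ _ _ _).inv ≫ ((P.append w.reverse v.reverse).hom ≫
          (P.congr List.reverse_append.symm).hom) ▷ L i := by
      rw [whiskerLeft_comp, comp_whiskerRight, Category.assoc,
        ← cancel_mono (P.snoc (v ++ w).reverse i).hom]
      have e : P.obj w.reverse ◁ (P.snoc v.reverse i).inv ≫ (α_ _ _ _).inv ≫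
          (P.append w.reverse v.reverse).hom ▷ L i =
          (P.append w.reverse (v.reverse ++ [i])).hom ≫
            (P.congr (List.append_assoc w.reverse v.reverse [i]).symm).hom ≫
              (P.snoc (w.reverse ++ v.reverse) i).inv := by
        rw [← cancel_epi (P.obj w.reverse ◁ (P.snoc v.reverse i).hom), reassoc_of% h]
        simp
      rw [reassoc_of% e, WordProd.congr_snoc_inv, P.whiskerLeft_congr_append_assoc]
      simp
    have T := congrArg (fun g => F.functor.map g ≫ (F.tensor (P.obj (v ++ w).reverse) (L i)).hom ≫
      F.functor.obj (L i) ◁ (F.prod P P' (v ++ w)).hom ≫ (P'.cons i (v ++ w)).hom) h'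
    have ih := congrArg (F.functor.obj (L i) ◁ ·) ih
    simp only [F.functor.map_comp, Category.assoc] at T
    refine Eq.trans ?_ (T.symm.trans ?_)
    · rw [F.map_whiskerRight_assoc, ← whiskerLeft_comp_assoc, ← ih]
      have a := F.map_associator (P.obj w.reverse) (P.obj v.reverse) (L i)
      rw [← F.functor.mapIso_hom, ← Iso.eq_inv_comp, F.functor.mapIso_inv] at a
      simp only [whiskerLeft_comp, Category.assoc]
      rw [← reassoc_of% a, prod_cons_hom, WordProd.append_cons_hom,
        MonoidalCategory.tensorHom_def, MonoidalCategory.tensorHom_def]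
      simp only [comp_whiskerRight, whiskerLeft_comp, Category.assoc, F.functor.map_comp,
        F.map_whiskerLeft_assoc]
      rw [whisker_exchange_assoc, hom_inv_whiskerRight_assoc, ← associator_naturality_middle_assoc,
        ← associator_naturality_right_assoc]
    · have e : (F.prod P P' (i :: v ++ w)).hom = _ := F.prod_cons_hom P P' i (v ++ w)
      rw [e]
      simp only [F.functor.map_comp, Category.assoc]

/-- The image of a product over a word with two letters added. -/
theorem prod_cons_cons_hom (i j : ι) (w : List ι) : (F.prod P P' (j :: i :: w)).hom =
    F.functor.map ((P.congr (by simp : (j :: i :: w).reverse = w.reverse ++ [i, j])).hom ≫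
      (P.append w.reverse [i, j]).inv ≫ P.obj w.reverse ◁ (P.pair i j).inv) ≫
      (F.tensor (P.obj w.reverse) (L i ⊗ L j)).hom ≫
        (F.tensor (L i) (L j)).hom ▷ F.functor.obj (P.obj w.reverse) ≫ (α_ _ _ _).hom ≫
      F.functor.obj (L j) ◁ F.functor.obj (L i) ◁ (F.prod P P' w).hom ≫
      F.functor.obj (L j) ◁ (P'.cons i w).hom ≫ (P'.cons j (i :: w)).hom := by
  rw [prod_cons_hom, prod_cons_hom, whiskerLeft_comp, Category.assoc,
    ← F.map_whiskerRight_assoc, ← F.functor.map_comp_assoc]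
  have h : ((P.congr List.reverse_cons).hom ≫ (P.snoc (i :: w).reverse j).inv) ≫
      ((P.congr List.reverse_cons).hom ≫ (P.snoc w.reverse i).inv) ▷ L j ≫ (α_ _ _ _).hom =
    (P.congr (by simp : (j :: i :: w).reverse = w.reverse ++ [i, j])).hom ≫
      (P.append w.reverse [i, j]).inv ≫ P.obj w.reverse ◁ (P.pair i j).inv := by
    have h₁ : (P.snoc (i :: w).reverse j).inv ≫ (P.congr List.reverse_cons).hom ▷ L j = _ :=
      P.congr_snoc_inv (List.reverse_cons : (i :: w).reverse = _) j
    rw [comp_whiskerRight, Category.assoc, Category.assoc, reassoc_of% h₁, P.snoc_inv_snoc_inv]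
    simp
  rw [← h]
  simp only [Category.assoc, F.functor.map_comp, F.map_associator_assoc, whiskerLeft_comp]

end

variable {s : ℕ} {L : Fin s → C} {P : WordProd L} {P' : WordProd fun i => F.functor.obj (L i)}
  {c : ∀ i j : Fin s, i < j → (L j ⊗ L i ≅ L i ⊗ L j)}

/-- Generators lift one at a time. A reordering behind a first letter lifts to one in front of a
last letter, and an interchange of the first two letters to the inverse interchange of the last two.
-/
theorem exists_reorder {v w : List (Fin s)} {e : P'.obj v ≅ P'.obj w}
    (he : P'.Reorder (fun i j h => F.swap (c i j h)) e) :
    ∃ e' : P.obj v.reverse ≅ P.obj w.reverse, P.Reorder c e' ∧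
      F.functor.map e'.hom ≫ (F.prod P P' w).hom = (F.prod P P' v).hom ≫ e.hom := by
  induction he with
  | refl v => exact ⟨Iso.refl _, .refl _, by simp⟩
  | @map i v w e he ih =>
    obtain ⟨e', he', h⟩ := ih
    refine ⟨P.congr List.reverse_cons ≪≫ P.appendRight e' [i] ≪≫ P.congr List.reverse_cons.symm,
      .trans (.congr _ _) (.trans (he'.appendRight [i]) (.congr _ _)), ?_⟩
    have H : (P.appendRight e' [i]).hom ≫ _ = _ := P.appendRight_snoc_inv e' i
    rw [prod_cons_hom, prod_cons_hom, ← F.functor.map_comp_assoc]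
    simp only [Iso.trans_hom, Category.assoc, WordProd.congr_hom_congr_hom_assoc,
      WordProd.congr_refl, Iso.refl_hom, Category.id_comp, H, WordProd.mapIso_hom, WordProd.map,
      Iso.hom_inv_id_assoc, ← whiskerLeft_comp_assoc, ← h, F.functor.map_comp,
      F.map_whiskerRight_assoc]
  | @swap i j h w =>
    refine ⟨P.congr (by simp) ≪≫ P.appendLeft w.reverse (P.swap (c i j h) []).symm ≪≫
      P.congr (by simp),
      .trans (.congr _ _) (.trans (.appendLeft _ (.symm (.swap h []))) (.congr _ _)), ?_⟩
    rw [prod_cons_cons_hom, prod_cons_cons_hom, WordProd.swap_hom]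
    simp only [Category.assoc, Iso.hom_inv_id_assoc, whiskerLeft_hom_inv_assoc,
      swapHom_naturality_assoc, F.tensor_swapHom_assoc]
    rw [← F.functor.map_comp_assoc, ← F.functor.map_comp_assoc]
    have H := P.pair_swap_inv (c i j h)
    simp only [Iso.trans_hom, Category.assoc, WordProd.congr_hom_congr_hom_assoc,
      WordProd.congr_refl, Iso.refl_hom, Category.id_comp, WordProd.appendLeft, Iso.symm_hom,
      whiskerLeftIso_hom, Iso.hom_inv_id_assoc, ← whiskerLeft_comp, H]
  | symm he ih =>
    obtain ⟨e', he', h⟩ := ih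
    refine ⟨e'.symm, .symm he', ?_⟩
    rw [Iso.symm_hom, Iso.symm_hom, Iso.eq_comp_inv, Category.assoc, ← h,
      ← F.functor.map_comp_assoc, e'.inv_hom_id, F.functor.map_id, Category.id_comp]
  | trans he he' ih ih' =>
    obtain ⟨f, hf, h⟩ := ih
    obtain ⟨f', hf', h'⟩ := ih'
    refine ⟨f ≪≫ f', .trans hf hf', ?_⟩
    rw [Iso.trans_hom, Iso.trans_hom, F.functor.map_comp, Category.assoc, h', reassoc_of% h]

end ReversingFunctor
end Words
-- Products of bimodules as an instance of the calculus of words.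
noncomputable section

variable {X : Scheme.{u}}

namespace TwistedBimod
variable {A B C : TwistedBimod X}

theorem whiskerRight_hom (f : A ⟶ B) (P : TwistedBimod X) :
    (f ▷ P).hom = f.hom ⊗ₘ (pullCongr f.aut_eq).hom.app P.sheaf := rfl

theorem whiskerLeft_hom (P : TwistedBimod X) (f : A ⟶ B) :
    (P ◁ f).hom = P.sheaf ◁ (pull P.aut).map f.hom := rfl

theorem actMap_hom {F G : X.Modules} (e : F ≅ G) :
    (A.actMap e).hom = A.sheaf ◁ (pull A.aut).map e.hom := rfl

theorem mapAct_hom (e : A.sheaf ≅ B.sheaf) (h : A.aut = B.aut) (F : X.Modules) :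
    (mapAct e h F).hom = e.hom ⊗ₘ (pullCongr h).hom.app F := by
  unfold mapAct
  rw [MonoidalCategory.tensorIso_hom, Iso.app_hom]

theorem associator_inv_hom (A B C : TwistedBimod X) :
    (α_ A B C).inv.hom = (actAct A B C.sheaf).hom := rfl

theorem associator_hom_hom (A B C : TwistedBimod X) :
    (α_ A B C).hom.hom = (actAct A B C.sheaf).inv := rfl

/-- The products of bimodules indexed by words. -/
def words {ι : Type*} (L : ι → TwistedBimod X) : WordProd L where
  obj := prod L
  nil := Iso.refl _
  cons _ _ := Iso.refl _

theorem words_map_hom {ι : Type*} (L : ι → TwistedBimod X) (i : ι) {v w : List ι}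
    (f : (words L).obj v ⟶ (words L).obj w) :
    ((words L).map i f).hom = (L i ◁ f).hom := by
  unfold WordProd.map
  rw [comp_hom, comp_hom]
  exact (Category.id_comp _).trans (Category.comp_id _)

theorem prodCongr_hom {ι : Type*} (L : ι → TwistedBimod X) {v w : List ι} (h : v = w) :
    (prodCongr L h).hom = ((words L).congr h).hom.hom := by
  subst h; rfl

theorem leftUnitor_hom_hom (A : TwistedBimod X) : (λ_ A).hom.hom = (unitAct A.sheaf).hom := rfl

theorem prodAppend_nil_hom {ι : Type*} (L : ι → TwistedBimod X) (w : List ι) :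
    (prodAppend L [] w).hom = (unitAct (prod L w).sheaf).hom := rfl

theorem prodAppend_cons_hom {ι : Type*} (L : ι → TwistedBimod X) (i : ι) (v w : List ι) :
    (prodAppend L (i :: v) w).hom = (actAct (L i) (prod L v) (prod L w).sheaf).inv ≫
      ((L i).actMap (prodAppend L v w)).hom := rfl

/-- The structure maps of `words L` are identities, so the recursion for `append` collapses to the
one for `prodAppend`. -/
theorem prodAppend_hom {ι : Type*} (L : ι → TwistedBimod X) (v w : List ι) :
    (prodAppend L v w).hom = ((words L).append v w).hom.hom := by
  induction v with
  | nil =>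
    rw [WordProd.append_nil_hom, comp_hom, leftUnitor_hom_hom, prodAppend_nil_hom]
    have h : (words L).nil.inv ▷ (words L).obj w = 𝟙 _ := id_whiskerRight _ _
    rw [h]
    exact (Category.id_comp _).symm
  | cons i v ih =>
    rw [WordProd.append_cons_hom, comp_hom, comp_hom, comp_hom, associator_hom_hom,
      prodAppend_cons_hom]
    have h : ((words L).cons i v).inv ▷ (words L).obj w = 𝟙 _ := id_whiskerRight _ _
    rw [h]
    refine Eq.trans ?_ (Category.id_comp _).symm
    refine (congrArg _ ?_).trans (congrArg _ (Category.comp_id _).symm)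
    exact congrArg (fun g => (L i).sheaf ◁ (pull (L i).aut).map g) ih

end TwistedBimod
variable {s : ℕ} {L : Fin s → TwistedBimod X}
open TwistedBimod

namespace CommRel
variable (φ : CommRel L)

/-- The commutation relation `φ_{ij}` as an isomorphism of bimodules. -/
def bimodIso (i j : Fin s) (h : i < j) : L j ⊗ L i ≅ L i ⊗ L j :=
  mkIso (A := L j ⊗ L i) (B := L i ⊗ L j) (φ.comm j i) (φ.iso i j h)

theorem swap_eq {i j : Fin s} (h : i < j) (F : X.Modules) :
    φ.swap h F = actAct (L j) (L i) F ≪≫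
      mapAct (A := L j ⊗ L i) (B := L i ⊗ L j) (φ.iso i j h) (φ.comm j i) F ≪≫
        (actAct (L i) (L j) F).symm := rfl

theorem mapAct_mkIso_hom {A B : TwistedBimod X} (h : A.aut = B.aut) (e : A.sheaf ≅ B.sheaf)
    (P : TwistedBimod X) : (mapAct e h P.sheaf).hom = ((mkIso h e).hom ▷ P).hom := by
  have h₁ : e.hom = (mkIso h e).hom.hom := rfl
  have h₂ : (pullCongr h).hom.app P.sheaf =
    (pullCongr (mkIso h e).hom.aut_eq).hom.app P.sheaf :=
    congrArg (fun i : pull A.aut ≅ pull B.aut => i.hom.app P.sheaf) rfl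
  rw [mapAct_hom, whiskerRight_hom]
  exact congrArg₂ (fun a b => a ⊗ₘ b) h₁ h₂

theorem swap_hom {i j : Fin s} (h : i < j) (P : TwistedBimod X) :
    (φ.swap h P.sheaf).hom = (swapHom (φ.bimodIso i j h).hom P).hom := by
  have h₁ := mapAct_mkIso_hom (A := L j ⊗ L i) (B := L i ⊗ L j) (φ.comm j i) (φ.iso i j h) P
  have h₂ := Iso.trans_hom (actAct (L j) (L i) P.sheaf)
    (mapAct (A := L j ⊗ L i) (B := L i ⊗ L j) (φ.iso i j h) (φ.comm j i) P.sheaf ≪≫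
        (actAct (L i) (L j) P.sheaf).symm)
  have h₃ := Iso.trans_hom
    (mapAct (A := L j ⊗ L i) (B := L i ⊗ L j) (φ.iso i j h) (φ.comm j i) P.sheaf)
        (actAct (L i) (L j) P.sheaf).symm
  rw [swapHom, comp_hom, comp_hom, associator_inv_hom, associator_hom_hom, bimodIso]
  exact (congrArg Iso.hom (φ.swap_eq h P.sheaf)).trans (h₂.trans (congrArg _ (h₃.trans
    (congrArg (fun g => g ≫ _) h₁))))

theorem words_swap {i j : Fin s} (f : L j ⊗ L i ≅ L i ⊗ L j) (w : List (Fin s)) :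
    ((words L).swap f w).hom = swapHom f.hom ((words L).obj w) := by
  have h₁ : L j ◁ ((words L).cons i w).inv = 𝟙 _ := MonoidalCategory.whiskerLeft_id ..
  have h₂ : L i ◁ ((words L).cons j w).hom = 𝟙 _ := MonoidalCategory.whiskerLeft_id ..
  rw [WordProd.swap_hom, h₁, h₂]
  exact (Category.id_comp _).trans ((Category.id_comp _).trans
    ((congrArg _ (Category.id_comp _)).trans (Category.comp_id _)))

theorem words_swap_hom {i j : Fin s} (h : i < j) (w : List (Fin s)) :
    (φ.swap h (prod L w).sheaf).hom = ((words L).swap (φ.bimodIso i j h) w).hom.hom :=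
  (φ.swap_hom h _).trans (congrArg Hom.hom (words_swap (φ.bimodIso i j h) w).symm)

/-- Links the sorting isomorphisms of sheaves, which define the ring, with those of bimodules, to
which coherence applies; both recursions branch on the same comparison of letters. -/
theorem insertIso_hom (i : Fin s) (w : List (Fin s)) :
    (φ.insertIso i w).hom = ((words L).insertIso φ.bimodIso i w).hom.hom := by
  induction w with
  | nil => rfl
  | cons j w ih =>
    rw [insertIso, WordProd.insertIso]
    split_ifs with h
    · exact prodCongr_hom ..
    · rw [Iso.trans_hom, Iso.trans_hom, comp_hom, comp_hom, WordProd.mapIso_hom, words_map_hom]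
      have h₂ : ((L j).actMap (φ.insertIso i w)).hom =
          (L j ◁ ((words L).insertIso φ.bimodIso i w).hom).hom :=
        congrArg (fun g => (L j).sheaf ◁ (pull (L j).aut).map g) ih
      have h₁ := φ.words_swap_hom (not_le.1 h) w
      rw [← h₁, ← h₂, ← prodCongr_hom]
      rfl

theorem sortIso_cons_hom (i : Fin s) (w : List (Fin s)) :
    (φ.sortIso (i :: w)).hom = ((L i).actMap (φ.sortIso w)).hom ≫
      (φ.insertIso i (w.insertionSort (· ≤ ·))).hom := rfl

theorem sortIso_hom (w : List (Fin s)) :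
    (φ.sortIso w).hom = ((words L).sortIso φ.bimodIso w).hom.hom := by
  induction w with
  | nil => rfl
  | cons i w ih =>
    have h₁ : ((words L).sortIso φ.bimodIso (i :: w)).hom =
      (words L).map i ((words L).sortIso φ.bimodIso w).hom ≫
        ((words L).insertIso φ.bimodIso i (w.insertionSort (· ≤ ·))).hom := rfl
    refine Eq.trans ?_ (congrArg Hom.hom h₁).symm
    rw [sortIso_cons_hom, comp_hom, words_map_hom]
    have h₂ : ((L i).actMap (φ.sortIso w)).hom =
        (L i ◁ ((words L).sortIso φ.bimodIso w).hom).hom :=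
      congrArg (fun g => (L i).sheaf ◁ (pull (L i).aut).map g) ih
    rw [← h₂, ← insertIso_hom]
    rfl

/-- `toMultiWord` as an isomorphism of bimodules. -/
def sorted (w : List (Fin s)) (n : Fin s → ℕ) (h : ∀ i, w.count i = n i) :
    (words L).obj w ≅ (words L).obj (multiWord n) :=
  (words L).sortIso φ.bimodIso w ≪≫ (words L).congr (insertionSort_eq_multiWord w n h)

theorem toMultiWord_hom (w : List (Fin s)) (n : Fin s → ℕ) (h : ∀ i, w.count i = n i) :
    (φ.toMultiWord w n h).hom = (φ.sorted w n h).hom.hom := by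
  rw [toMultiWord, sorted, Iso.trans_hom, Iso.trans_hom, comp_hom, sortIso_hom, prodCongr_hom]
  rfl

theorem reorder_sorted (w : List (Fin s)) (n : Fin s → ℕ) (h : ∀ i, w.count i = n i) :
    (words L).Reorder φ.bimodIso (φ.sorted w n h) :=
  .trans ((words L).reorder_sortIso w) (.congr _ _)

theorem actMap_iso_hom (A : TwistedBimod X) {i j : Fin s} (h : i < j) :
    (A.actMap (φ.iso i j h)).hom = (A ◁ (φ.bimodIso i j h).hom).hom := rfl

-- Compatibility is the Yang–Baxter equation for the underlying sheaves, and a morphism of bimodules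
-- is determined by its sheaf part.
variable {φ} in
theorem Compatible.yangBaxter (hφ : φ.Compatible) : YangBaxter φ.bimodIso := fun i j k hij hjk =>
  TwistedBimod.hom_ext (by
    have h := congrArg Iso.hom (hφ i j k hij hjk)
    simp only [Iso.trans_hom] at h
    rw [comp_hom, comp_hom, comp_hom, comp_hom, ← swap_hom, ← swap_hom, ← swap_hom,
      ← actMap_iso_hom, ← actMap_iso_hom, ← actMap_iso_hom]
    exact h)

end CommRel
end
-- Classes of words and the algebra axioms.
noncomputable section

variable {X : Scheme.{u}}

theorem H0map_eq {M N : X.Modules} (g : M ⟶ N) (a : H0 M) : H0map g a = ap g a := rfl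

theorem H0tensor_eq {M N : X.Modules} (a : H0 M) (b : H0 N) : H0tensor M N a b = tm a b := rfl

theorem preimage_top (σ : X ≅ X) : σ.inv ⁻¹ᵁ (⊤ : X.Opens) = ⊤ := rfl

attribute [local irreducible] ap rs tm

namespace TwistedBimod
variable {A A' B B' C : TwistedBimod X}

/-- The map on global sections induced by a morphism of bimodules. -/
def hm (f : A ⟶ B) : H0 A.sheaf →+ H0 B.sheaf := ap f.hom

theorem hm_id (a : H0 A.sheaf) : hm (𝟙 A) a = a := ap_id a

theorem hm_comp (f : A ⟶ B) (g : B ⟶ C) (a : H0 A.sheaf) : hm (f ≫ g) a = hm g (hm f a) :=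
  ap_comp f.hom g.hom a

theorem hm_smul (f : A ⟶ B) (r : Γ(X, ⊤)) (a : H0 A.sheaf) : hm f (r • a) = r • hm f a :=
  ap_smul f.hom r a

theorem hm_hom_inv (e : A ≅ B) (a : H0 A.sheaf) : hm e.inv (hm e.hom a) = a := by
  rw [← hm_comp, e.hom_inv_id, hm_id]

theorem hm_inv_hom (e : A ≅ B) (b : H0 B.sheaf) : hm e.hom (hm e.inv b) = b := by
  rw [← hm_comp, e.inv_hom_id, hm_id]

/-- The product `a ⊗ σ(b)` of global sections of bimodules. -/
def hmul (a : H0 A.sheaf) (b : H0 B.sheaf) : H0 (A ⊗ B).sheaf :=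
  ta a (rs (preimage_top A.aut).le b)

theorem hmul_eq (a : H0 A.sheaf) (b : H0 B.sheaf) :
    H0tensor _ _ a (H0pull A.aut _ b) = hmul a b := by
  rw [H0tensor_eq, H0pull_eq]
  rfl

theorem hm_tensorHom (f : A ⟶ A') (g : B ⟶ B') (a : H0 A.sheaf) (b : H0 B.sheaf) :
    hm (f ⊗ₘ g) (hmul a b) = hmul (hm f a) (hm g b) := by
  refine (ap_tensorHom_ta ..).trans ?_
  rw [ap_rs, rs_rs]
  rfl

theorem hm_associator_hom (a : H0 A.sheaf) (b : H0 B.sheaf) (c : H0 C.sheaf) :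
    hm (α_ A B C).hom (hmul (hmul a b) c) = hmul a (hmul b c) := by
  refine (ap_associator_hom_ta ..).trans ?_
  simp only [hmul, rs_ta, rs_rs]

theorem hm_leftUnitor (a : H0 A.sheaf) : hm (λ_ A).hom (hmul (uni 1) a) = a := by
  refine (ap_leftUnitor_ta ..).trans ?_
  rw [one_smul, rs_rs, rs_self]

theorem hm_rightUnitor (a : H0 A.sheaf) : hm (ρ_ A).hom (hmul a (uni 1)) = a := by
  have h : rs (preimage_top A.aut).le (uni 1) = uni (A.aut.inv.app ⊤ 1) := by
    refine (rs_un ..).trans ?_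
    rw [map_one]
    exact congrArg un (map_one _).symm
  have h' := ap_rightUnitor_ta (U := ⊤) 1 a
  rw [one_smul] at h'
  exact (congrArg (fun x => ap (ρ_ A).hom.hom (ta a x)) h).trans h'

theorem smul_hmul (r : Γ(X, ⊤)) (a : H0 A.sheaf) (b : H0 B.sheaf) :
    hmul (r • a) b = r • hmul a b :=
  smul_tm ..

/-- A function on the right factor reaches the left one through the automorphism of `A`; `hr` says
that this automorphism fixes it. -/
theorem hmul_smul (r : Γ(X, ⊤)) (hr : X.presheaf.map (homOfLE (preimage_top A.aut).le).op r =
    A.aut.inv.app ⊤ r) (a : H0 A.sheaf) (b : H0 B.sheaf) : hmul a (r • b) = r • hmul a b := by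
  rw [← smul_hmul, hmul, rs_smul, hr, ta_smul]
  rfl

end TwistedBimod

section
variable {k : Type u} [Field k] (f : X ⟶ Spec (.of k))

/-- An automorphism over `Spec k` fixes the constants; the restriction map only compares two equal
open sets. -/
theorem app_scalars {σ : X ≅ X} (h : σ.hom ≫ f = f) (c : k) :
    X.presheaf.map (homOfLE (preimage_top σ).le).op (scalars f c) = σ.inv.app ⊤ (scalars f c) := by
  have h' : σ.inv ≫ f = f := by rw [Iso.inv_comp_eq, h]
  have h'' := congrArg (fun g : X ⟶ Spec (.of k) => g.appTop ((Scheme.ΓSpecIso (.of k)).inv c)) h'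
  dsimp only at h''
  rw [Scheme.Hom.comp_appTop] at h''
  refine Eq.trans ?_ h''.symm
  have e : X.presheaf.map (homOfLE (preimage_top σ).le).op = 𝟙 _ := X.presheaf.map_id _
  rw [e]
  rfl

theorem prod_aut_comp {ι : Type*} {L : ι → TwistedBimod X} (hσ : ∀ i, (L i).aut.hom ≫ f = f)
    (w : List ι) : (TwistedBimod.prod L w).aut.hom ≫ f = f := by
  induction w with
  | nil => exact Category.id_comp f
  | cons i w ih =>
    refine (Category.assoc _ _ _).trans ?_
    rw [ih, hσ]

end

section Ring
open TwistedBimod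
variable {k : Type u} [Field k] (f : X ⟶ Spec (.of k)) {s : ℕ} {L : Fin s → TwistedBimod X}
  (φ : CommRel L)

/-- The sections underlying the elements of a homogeneous piece. -/
def sec (n : Fin s → ℕ) : Piece f φ n ≃+ H0 ((words L).obj (multiWord n)).sheaf := AddEquiv.refl _

theorem H0map_prodAppend {m n : Fin s → ℕ} (a : H0 (prod L (multiWord m)).sheaf)
    (b : H0 (prod L (multiWord n)).sheaf) :
    H0map (prodAppend L (multiWord m) (multiWord n) ≪≫
        φ.toMultiWord (multiWord m ++ multiWord n) (m + n) (count_multiWord_append m n)).hom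
      (H0tensor _ _ a (H0pull (prod L (multiWord m)).aut _ b)) =
    hm (φ.sorted (multiWord m ++ multiWord n) (m + n) (count_multiWord_append m n)).hom
      (hm ((words L).append (multiWord m) (multiWord n)).hom
        (hmul (A := (words L).obj _) (B := (words L).obj _) a b)) := by
  have h := congrArg₂ (fun g g' => g ≫ g') (prodAppend_hom L (multiWord m) (multiWord n))
    (φ.toMultiWord_hom (multiWord m ++ multiWord n) (m + n) (count_multiWord_append m n))
  refine (congrArg _ (hmul_eq (A := prod L _) (B := prod L _) a b)).trans ?_
  refine (H0map_eq _ _).trans ((congrArg (fun g => ap g _) ((Iso.trans_hom _ _).trans h)).trans ?_)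
  exact hm_comp ((words L).append (multiWord m) (multiWord n)).hom _ _

theorem sec_pieceMul {m n : Fin s → ℕ} (a : Piece f φ m) (b : Piece f φ n) :
    sec f φ _ (pieceMul f φ a b) = hm (φ.sorted (multiWord m ++ multiWord n) (m + n)
      (count_multiWord_append m n)).hom (hm ((words L).append (multiWord m) (multiWord n)).hom
        (hmul (sec f φ m a) (sec f φ n b))) :=
  H0map_prodAppend φ (sec f φ m a) (sec f φ n b)

/-- The element of the twisted ring given by a section of the product over a word. -/
def ofWord (w : List (Fin s)) : H0 ((words L).obj w).sheaf →+ TwistedRing f φ :=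
  ((TwistedRing.of f φ fun i => w.count i).comp (sec f φ _).symm.toAddMonoidHom).comp (hm (φ.sorted w _ fun _ => rfl).hom)

/-- Frees the degree from being literally the function counting letters, so that no casts between
homogeneous pieces are needed. -/
theorem ofWord_eq (w : List (Fin s)) (n : Fin s → ℕ) (h : ∀ i, w.count i = n i)
    (x : H0 ((words L).obj w).sheaf) :
    ofWord f φ w x = TwistedRing.of f φ n ((sec f φ n).symm (hm (φ.sorted w n h).hom x)) := by
  obtain rfl : (fun i => w.count i) = n := funext h
  rfl

variable {φ}

theorem CommRel.Compatible.sorted_eq (hφ : φ.Compatible) {v w : List (Fin s)}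
    {e : (words L).obj v ≅ (words L).obj w} (he : (words L).Reorder φ.bimodIso e)
    (n : Fin s → ℕ) (h : ∀ i, v.count i = n i) (h' : ∀ i, w.count i = n i) :
    φ.sorted v n h = e ≪≫ φ.sorted w n h' :=
  (φ.reorder_sorted v n h).unique _ hφ.yangBaxter (he.trans (φ.reorder_sorted w n h'))

/-- Sorting an already sorted word is a reordering from the word to itself, hence the identity by
uniqueness. -/
theorem CommRel.Compatible.of_eq (hφ : φ.Compatible) (n : Fin s → ℕ) (a : Piece f φ n) :
    TwistedRing.of f φ n a = ofWord f φ (multiWord n) (sec f φ n a) := by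
  have h : φ.sorted (multiWord n) n (count_multiWord n) = Iso.refl _ :=
    (φ.reorder_sorted _ n _).unique _ hφ.yangBaxter (.refl _)
  rw [ofWord_eq f φ _ n (count_multiWord n), h, Iso.refl_hom, hm_id, AddEquiv.symm_apply_apply]

theorem CommRel.Compatible.ofWord_reorder (hφ : φ.Compatible) {v w : List (Fin s)}
    {e : (words L).obj v ≅ (words L).obj w} (he : (words L).Reorder φ.bimodIso e)
    (x : H0 ((words L).obj v).sheaf) : ofWord f φ v x = ofWord f φ w (hm e.hom x) := by
  obtain ⟨h, -⟩ := he.exists_sortIso _ hφ.yangBaxter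
  -- Both words have the same sorted form, so they have the same letter counts and the two classes
  -- lie in the same degree.
  have hp : v.Perm w := (List.perm_insertionSort (· ≤ ·) v).symm.trans
    (h ▸ List.perm_insertionSort (· ≤ ·) w)
  rw [ofWord_eq f φ v (fun i => w.count i) fun i => hp.count_eq i,
    ofWord_eq f φ w (fun i => w.count i) fun _ => rfl,
    hφ.sorted_eq he _ _ fun _ => rfl, Iso.trans_hom, hm_comp]

theorem of_mul_of (m n : Fin s → ℕ) (a : Piece f φ m) (b : Piece f φ n) :
    TwistedRing.of f φ m a * TwistedRing.of f φ n b =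
      TwistedRing.of f φ (m + n) (pieceMul f φ a b) :=
  DirectSum.of_mul_of (A := Piece f φ) a b

/-- The ring product sorts both factors, concatenates and sorts again. Seen on `v ++ w`, the first
two sortings form the reordering `he`, which does not affect the class. -/
theorem CommRel.Compatible.ofWord_mul (hφ : φ.Compatible) (v w : List (Fin s))
    (x : H0 ((words L).obj v).sheaf) (y : H0 ((words L).obj w).sheaf) :
    ofWord f φ v x * ofWord f φ w y =
      ofWord f φ (v ++ w) (hm ((words L).append v w).hom (hmul x y)) := by
  have he := ((φ.reorder_sorted v _ fun _ => rfl).appendRight w).trans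
    ((φ.reorder_sorted w _ fun _ => rfl).appendLeft (multiWord fun i => v.count i))
  rw [hφ.ofWord_reorder f he, ofWord_eq f φ _ _ (count_multiWord_append _ _),
    ofWord_eq f φ v _ fun _ => rfl, ofWord_eq f φ w _ fun _ => rfl, of_mul_of]
  refine congrArg _ ?_
  rw [AddEquiv.eq_symm_apply, sec_pieceMul, AddEquiv.apply_symm_apply, AddEquiv.apply_symm_apply,
    ← hm_tensorHom, ← hm_comp _ _ (hmul x y), ← hm_comp _ _ (hmul x y), ← hm_comp _ _ (hmul x y),
    ← hm_comp _ _ (hmul x y)]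
  refine congrArg (fun g => hm g (hmul x y)) ?_
  simp [WordProd.appendRight, WordProd.appendLeft, MonoidalCategory.tensorHom_def]

theorem CommRel.Compatible.one_eq (hφ : φ.Compatible) :
    (1 : TwistedRing f φ) = ofWord f φ [] (hm (words L).nil.hom (uni 1)) := by
  have h : (words L).Reorder φ.bimodIso ((words L).congr (multiWord_zero (s := s)).symm) :=
    .congr _ _
  rw [hφ.ofWord_reorder f h, show (1 : TwistedRing f φ) = TwistedRing.of f φ 0
    (show Piece f φ 0 from GradedMonoid.GOne.one) from rfl, hφ.of_eq]
  refine congrArg _ ?_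
  refine (H0map_eq _ _).trans ?_
  rw [prodCongr_hom]
  exact congrArg (hm ((words L).congr _).hom) (hm_id (A := 𝟙_ _) (uni 1)).symm

theorem CommRel.Compatible.induction (hφ : φ.Compatible) {p : TwistedRing f φ → Prop}
    (ofWord : ∀ w x, p (ofWord f φ w x)) (add : ∀ a b, p a → p b → p (a + b))
    (a : TwistedRing f φ) : p a := by
  refine DirectSum.induction_on (β := Piece f φ) a ?_ (fun n x => ?_) add
  · exact (map_zero (TwistedCoordinateRing.ofWord f φ [])) ▸ ofWord [] 0
  · exact (hφ.of_eq f n x).symm ▸ ofWord _ _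

theorem smul_of (c : k) (n : Fin s → ℕ) (a : Piece f φ n) :
    c • TwistedRing.of f φ n a = TwistedRing.of f φ n (c • a) :=
  (DirectSum.of_smul (M := Piece f φ) k n c a).symm

theorem smul_ofWord (c : k) (w : List (Fin s)) (x : H0 ((words L).obj w).sheaf) :
    c • ofWord f φ w x = ofWord f φ w (scalars f c • x) := by
  rw [ofWord_eq f φ w _ fun _ => rfl, ofWord_eq f φ w _ fun _ => rfl, smul_of, hm_smul]
  rfl

theorem scalars_smul_hmul (c : k) (v w : List (Fin s)) (x : H0 ((words L).obj v).sheaf)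
    (y : H0 ((words L).obj w).sheaf) (hσ : ∀ i, (L i).aut.hom ≫ f = f) :
    hmul x (scalars f c • y) = scalars f c • hmul x y :=
  hmul_smul _ (app_scalars f (prod_aut_comp f hσ v) c) x y

/-- On classes of words the product is concatenation, so each ring axiom is a law for `hmul`
combined with the corresponding coherence of `append`. Linearity in the second factor uses that the
automorphism of any word fixes the constants. -/
theorem CommRel.Compatible.isAssocUnitalAlgebra (hφ : φ.Compatible)
    (hσ : ∀ i, (L i).aut.hom ≫ f = f) : IsAssocUnitalAlgebra k (TwistedRing f φ) where
  mul_assoc a b c := by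
    induction a using hφ.induction f with
    | add a a' h h' => rw [add_mul, add_mul, add_mul, h, h']
    | ofWord u x =>
    induction b using hφ.induction f with
    | add b b' h h' => rw [mul_add, add_mul, add_mul, mul_add, h, h']
    | ofWord v y =>
    induction c using hφ.induction f with
    | add c c' h h' => rw [mul_add, mul_add, mul_add, h, h']
    | ofWord w z =>
    rw [hφ.ofWord_mul, hφ.ofWord_mul, hφ.ofWord_mul, hφ.ofWord_mul,
      hφ.ofWord_reorder f (.congr _ (List.append_assoc u v w))]
    refine congrArg _ ?_
    have h₁ : hmul (hm ((words L).append u v).hom (hmul x y)) z =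
        hm (((words L).append u v).hom ▷ (words L).obj w) (hmul (hmul x y) z) := by
      rw [← tensorHom_id, hm_tensorHom, hm_id]
    have h₂ : hmul x (hm ((words L).append v w).hom (hmul y z)) =
        hm ((words L).obj u ◁ ((words L).append v w).hom) (hmul x (hmul y z)) := by
      rw [← id_tensorHom, hm_tensorHom, hm_id]
    rw [h₁, h₂, ← hm_associator_hom, ← hm_comp, ← hm_comp, ← hm_comp, ← hm_comp,
      WordProd.append_assoc]
  one_mul a := by
    induction a using hφ.induction f with
    | add a a' h h' => rw [mul_add, h, h']
    | ofWord w x =>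
    have h₁ : hmul (hm (words L).nil.hom (uni 1)) x =
        hm ((words L).nil.hom ▷ (words L).obj w) (hmul (uni 1) x) := by
      rw [← tensorHom_id, hm_tensorHom, hm_id]
    rw [hφ.one_eq, hφ.ofWord_mul, h₁, ← hm_comp, WordProd.append_nil_hom,
      hom_inv_whiskerRight_assoc]
    exact congrArg _ (hm_leftUnitor x)
  mul_one a := by
    induction a using hφ.induction f with
    | add a a' h h' => rw [add_mul, h, h']
    | ofWord w x =>
    have h₁ : hmul x (hm (words L).nil.hom (uni 1)) =
        hm ((words L).obj w ◁ (words L).nil.hom) (hmul x (uni 1)) := by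
      rw [← id_tensorHom, hm_tensorHom, hm_id]
    rw [hφ.one_eq, hφ.ofWord_mul, hφ.ofWord_reorder f (.congr _ (List.append_nil w)), h₁,
      ← hm_comp, ← hm_comp, WordProd.append_nil_right, whiskerLeft_hom_inv_assoc,
      hm_rightUnitor]
  smul_mul c a b := by
    induction a using hφ.induction f with
    | add a a' h h' => rw [smul_add, add_mul, add_mul, smul_add, h, h']
    | ofWord v x =>
    induction b using hφ.induction f with
    | add b b' h h' => rw [mul_add, mul_add, smul_add, h, h']
    | ofWord w y =>
    rw [smul_ofWord, hφ.ofWord_mul, hφ.ofWord_mul, smul_ofWord, smul_hmul, hm_smul]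
  mul_smul c a b := by
    induction a using hφ.induction f with
    | add a a' h h' => rw [add_mul, add_mul, smul_add, h, h']
    | ofWord v x =>
    induction b using hφ.induction f with
    | add b b' h h' => rw [smul_add, mul_add, mul_add, smul_add, h, h']
    | ofWord w y =>
    rw [smul_ofWord, hφ.ofWord_mul, hφ.ofWord_mul, smul_ofWord, scalars_smul_hmul f c v w x y hσ,
      hm_smul]

end Ring
end
-- The functor `flip` reverses tensor products.
noncomputable section

variable {X : Scheme.{u}}
attribute [local irreducible] ap rs tm

theorem preimage_symm (σ : X ≅ X) (U : X.Opens) : σ.symm.inv ⁻¹ᵁ (σ.inv ⁻¹ᵁ U) = U := by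
  rw [← preimage_trans, σ.self_symm_id]; rfl

namespace TwistedBimod

theorem ap_pullSymm (σ : X ≅ X) {M : X.Modules} {U : X.Opens}
    (a : Γ(M, σ.symm.inv ⁻¹ᵁ (σ.inv ⁻¹ᵁ U))) :
    ap (pullSymm σ M).hom (pl σ (pl σ.symm a)) = rs (preimage_symm σ U).ge a := by
  rw [pullSymm, Iso.trans_hom, Iso.trans_hom, ap_comp, ap_comp, Iso.app_hom, Iso.app_hom,
    Iso.app_hom]
  have h := ap_pullTrans_hom σ σ.symm a
  refine (congrArg (fun b => ap (pullRefl.hom.app M) (ap ((pullCongr _).hom.app M) b)) h).trans ?_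
  rw [ap_pullCongr_hom, ap_pullRefl_hom, rs_rs, rs_rs]

/-- The constituents of `flipTensor` evaluated in turn: pulling back along `σ⁻¹` cancels the `σ` on
`b`, and the braiding puts `b` in front. -/
theorem ap_pullTrans_μ (σ τ : X ≅ X) {M N : X.Modules} {U : X.Opens}
    (a : Γ(M, σ.symm.inv ⁻¹ᵁ (τ.symm.inv ⁻¹ᵁ U)))
    (b : Γ(N, σ.inv ⁻¹ᵁ (σ.symm.inv ⁻¹ᵁ (τ.symm.inv ⁻¹ᵁ U)))) :
    ap ((pullTrans τ.symm σ.symm).inv.app (M ⊗ (pull σ).obj N) ≫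
      (pull τ.symm).map ((Functor.Monoidal.μIso (pull σ.symm) M ((pull σ).obj N)).inv ≫
        (pull σ.symm).obj M ◁ (pullSymm σ.symm N).hom) ≫
      (Functor.Monoidal.μIso (pull τ.symm) ((pull σ.symm).obj M) N).inv ≫ (β_ _ _).hom)
      (pl (τ.symm ≪≫ σ.symm) (rs (preimage_trans τ.symm σ.symm U).le (tm a (pl σ b)))) =
    tm (pl τ.symm (rs (preimage_symm σ.symm (τ.symm.inv ⁻¹ᵁ U)).ge b))
      (pl τ.symm (pl σ.symm a)) := by
  rw [ap_comp, ap_comp, ap_comp, ap_pullTrans_inv, rs_rs, rs_self, ap_pull_map, ap_comp,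
    ap_μIso_inv]
  have h : ap ((pull σ.symm).obj M ◁ (pullSymm σ.symm N).hom)
      (tm (pl σ.symm a) (pl σ.symm (pl σ b))) =
    tm (pl σ.symm a) (rs (preimage_symm σ.symm (τ.symm.inv ⁻¹ᵁ U)).ge b) :=
    (ap_whiskerLeft ..).trans (congrArg _ (ap_pullSymm σ.symm b))
  rw [h, ap_μIso_inv, ap_braiding]

variable {A A' B B' C : TwistedBimod X} {U : X.Opens}

/-- The section of `(σ⁻¹)^* L` given by a section of `L`. -/
def fl (a : Γ(A.sheaf, A.aut.symm.inv ⁻¹ᵁ U)) : Γ(A.flip.sheaf, U) := pl A.aut.symm a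

theorem rs_fl {V : X.Opens} (h : V ≤ U) (a : Γ(A.sheaf, A.aut.symm.inv ⁻¹ᵁ U)) :
    rs h (fl a) = fl (rs (preimage_mono h) a) := rs_pl ..

theorem preimage_tensor_symm (A B : TwistedBimod X) (U : X.Opens) :
    (A ⊗ B).aut.symm.inv ⁻¹ᵁ U = A.aut.symm.inv ⁻¹ᵁ (B.flip.aut.inv ⁻¹ᵁ U) := rfl

theorem preimage_tensor_symm' (A B : TwistedBimod X) (U : X.Opens) :
    A.aut.inv ⁻¹ᵁ ((A ⊗ B).aut.symm.inv ⁻¹ᵁ U) = B.aut.symm.inv ⁻¹ᵁ U := by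
  rw [preimage_tensor_symm]
  exact preimage_symm A.aut.symm (B.aut.symm.inv ⁻¹ᵁ U)

theorem ap_flipTensor (a : Γ(A.sheaf, (A ⊗ B).aut.symm.inv ⁻¹ᵁ U))
    (b : Γ(B.sheaf, A.aut.inv ⁻¹ᵁ ((A ⊗ B).aut.symm.inv ⁻¹ᵁ U))) :
    ap (flipTensor A B).hom (fl (A := A ⊗ B) (ta a b)) =
      ta (A := B.flip) (B := A.flip) (fl (rs (preimage_tensor_symm' A B U).ge b))
        (fl (rs (preimage_tensor_symm A B U).ge a)) := by
  have h := ap_pullTrans_μ A.aut B.aut (U := U) (rs (preimage_tensor_symm A B U).ge a)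
    (rs (preimage_mono (preimage_tensor_symm A B U).ge) b)
  refine Eq.trans (congrArg _ (congrArg _ ?_)) (h.trans (congrArg (fun c => tm (pl B.aut.symm c) _) (rs_rs ..)))
  refine Eq.symm ((rs_tm ..).trans ?_)
  exact congrArg₂ (fun a b => tm a b) ((rs_rs ..).trans (rs_self ..))
    ((rs_pl ..).trans (congrArg _ ((rs_rs ..).trans (rs_self ..))))

/-- The image of a morphism of bimodules under `flip`. -/
@[simps]
def flipHom (f : A ⟶ B) : A.flip ⟶ B.flip where
  aut_eq := congrArg Iso.symm f.aut_eq
  hom := (pull A.aut.symm).map f.hom ≫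
    (pullCongr (congrArg Iso.symm f.aut_eq)).hom.app B.sheaf

theorem ap_flipHom (f : A ⟶ B) (a : Γ(A.sheaf, A.aut.symm.inv ⁻¹ᵁ U)) :
    ap (flipHom f).hom (fl a) = fl (rs (by rw [f.aut_eq]) (ap f.hom a)) := by
  refine (ap_comp ((pull A.aut.symm).map f.hom) ((pullCongr (congrArg Iso.symm f.aut_eq)).hom.app
    B.sheaf) (pl A.aut.symm a)).trans ?_
  refine (congrArg _ (ap_pull_map ..)).trans ?_
  exact ap_pullCongr_hom ..

theorem hom_ext_fl {f g : A.flip ⟶ B}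
    (h : ∀ (U : X.Opens) (a : Γ(A.sheaf, A.aut.symm.inv ⁻¹ᵁ U)), ap f.hom (fl a) = ap g.hom (fl a)) :
    f = g :=
  hom_ext (hom_ext_ap h)

theorem hom_ext_fl₂ {f g : (A ⊗ B).flip ⟶ C}
    (h : ∀ (U : X.Opens) (a : Γ(A.sheaf, (A ⊗ B).aut.symm.inv ⁻¹ᵁ U)) (b),
      ap f.hom (fl (A := A ⊗ B) (ta a b)) = ap g.hom (fl (A := A ⊗ B) (ta a b))) : f = g := by
  refine hom_ext ((((Gen.all A.sheaf).ta (Gen.all B.sheaf)).pull (A ⊗ B).aut.symm).hom_ext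
    fun U => ?_)
  rintro _ ⟨_, ⟨a, -, b, -, rfl⟩, rfl⟩
  exact h U a b

theorem hom_ext_fl₃ {D : TwistedBimod X} {f g : ((A ⊗ B) ⊗ C).flip ⟶ D}
    (h : ∀ (U : X.Opens) (a : Γ(A.sheaf, ((A ⊗ B) ⊗ C).aut.symm.inv ⁻¹ᵁ U)) (b) (c),
      ap f.hom (fl (A := (A ⊗ B) ⊗ C) (ta (ta a b) c)) =
        ap g.hom (fl (A := (A ⊗ B) ⊗ C) (ta (ta a b) c))) : f = g := by
  refine hom_ext (((((Gen.all A.sheaf).ta (Gen.all B.sheaf)).ta (Gen.all C.sheaf)).pull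
    ((A ⊗ B) ⊗ C).aut.symm).hom_ext fun U => ?_)
  rintro _ ⟨_, ⟨_, ⟨a, -, b, -, rfl⟩, c, -, rfl⟩, rfl⟩
  exact h U a b c

theorem flipHom_id (A : TwistedBimod X) : flipHom (𝟙 A) = 𝟙 A.flip :=
  hom_ext_fl fun U a => by rw [ap_flipHom, id_hom, id_hom, ap_id, ap_id, rs_self]

theorem flipHom_comp (f : A ⟶ B) (g : B ⟶ C) : flipHom (f ≫ g) = flipHom f ≫ flipHom g :=
  hom_ext_fl fun U a => by
    rw [comp_hom, ap_comp, ap_flipHom, ap_flipHom, ap_flipHom, comp_hom, ap_comp, ap_rs, rs_rs]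

/-- `flip` reverses tensor products. -/
def flipTensorIso (A B : TwistedBimod X) : (A ⊗ B).flip ≅ B.flip ⊗ A.flip :=
  mkIso (A := (A ⊗ B).flip) (B := B.flip ⊗ A.flip) rfl (flipTensor A B)

/-- `flip` preserves the unit. -/
def flipUnitIso : (𝟙_ (TwistedBimod X)).flip ≅ 𝟙_ (TwistedBimod X) :=
  mkIso (A := (𝟙_ (TwistedBimod X)).flip) (B := 𝟙_ (TwistedBimod X)) rfl
    (pullRefl.app (𝟙_ X.Modules))

theorem ap_flipTensorIso (a : Γ(A.sheaf, (A ⊗ B).aut.symm.inv ⁻¹ᵁ U))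
    (b : Γ(B.sheaf, A.aut.inv ⁻¹ᵁ ((A ⊗ B).aut.symm.inv ⁻¹ᵁ U))) :
    ap (flipTensorIso A B).hom.hom (fl (A := A ⊗ B) (ta a b)) =
      ta (A := B.flip) (B := A.flip) (fl (rs (preimage_tensor_symm' A B U).ge b))
        (fl (rs (preimage_tensor_symm A B U).ge a)) :=
  ap_flipTensor a b

theorem preimage_unit_symm (U : X.Opens) : (𝟙_ (TwistedBimod X)).aut.symm.inv ⁻¹ᵁ U = U := rfl

theorem ap_flipUnitIso (a : Γ((𝟙_ (TwistedBimod X)).sheaf, (𝟙_ (TwistedBimod X)).aut.symm.inv ⁻¹ᵁ U)) :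
    ap (flipUnitIso (X := X)).hom.hom (fl a) = rs (preimage_unit_symm U).ge a :=
  ap_pullRefl_hom a

/-- This and the other conditions on a reversing functor are checked on pure tensors, like the
monoidal axioms. -/
theorem flipHom_whiskerRight (f : A ⟶ A') (B : TwistedBimod X) :
    flipHom (f ▷ B) ≫ (flipTensorIso A' B).hom = (flipTensorIso A B).hom ≫ B.flip ◁ flipHom f := by
  refine hom_ext_fl₂ fun U a b => ?_
  simp only [comp_hom, ap_comp, ap_flipTensorIso, ap_flipHom, ap_whiskerLeft_ta,
    ap_whiskerRight_ta, ap_rs, rs_rs, rs_ta]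

theorem flipHom_whiskerLeft (f : A ⟶ A') (B : TwistedBimod X) :
    flipHom (B ◁ f) ≫ (flipTensorIso B A').hom = (flipTensorIso B A).hom ≫ flipHom f ▷ B.flip := by
  refine hom_ext_fl₂ fun U a b => ?_
  simp only [comp_hom, ap_comp, ap_flipTensorIso, ap_flipHom, ap_whiskerLeft_ta,
    ap_whiskerRight_ta, ap_rs, rs_rs, rs_ta, rs_fl]

theorem flipHom_associator (A B D : TwistedBimod X) :
    flipHom (α_ A B D).hom ≫ (flipTensorIso A (B ⊗ D)).hom ≫ (flipTensorIso B D).hom ▷ A.flip ≫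
      (α_ _ _ _).hom = (flipTensorIso (A ⊗ B) D).hom ≫ D.flip ◁ (flipTensorIso A B).hom := by
  refine hom_ext_fl₃ fun U a b c => ?_
  simp only [comp_hom, ap_comp, ap_flipTensorIso, ap_flipHom, ap_whiskerLeft_ta,
    ap_whiskerRight_ta, ap_associator_hom_ta, rs_rs, rs_ta, rs_fl]

/-- Serves the unit condition: a function carried through `σ` by the right unitor has to be
recovered after pulling back along `σ⁻¹`. -/
theorem symm_inv_app (σ : X ≅ X) (U : X.Opens) (r : Γ(X, σ.symm.inv ⁻¹ᵁ U)) :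
    σ.symm.inv.app U (X.presheaf.map (homOfLE (preimage_symm σ.symm U).ge).op
      (σ.inv.app (σ.symm.inv ⁻¹ᵁ U) r)) = r := by
  have h := Scheme.Hom.congr_app σ.hom_inv_id (σ.symm.inv ⁻¹ᵁ U)
  rw [Scheme.Hom.comp_app, Scheme.Hom.id_app] at h
  have h' := congrArg (fun g => σ.inv.app (σ.symm.inv ⁻¹ᵁ U) ≫ g)
    (σ.symm.inv.naturality (homOfLE (preimage_symm σ.symm U).ge).op)
  have h'' : σ.inv.app (σ.symm.inv ⁻¹ᵁ U) ≫
      X.presheaf.map (homOfLE (preimage_symm σ.symm U).ge).op ≫ σ.symm.inv.app U = 𝟙 _ := by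
    refine h'.trans ((Category.assoc _ _ _).symm.trans ((congrArg (fun g => g ≫ _) h).trans ?_))
    refine (congrArg (fun g => g ≫ _) (Category.id_comp _)).trans ?_
    exact (X.presheaf.map_comp _ _).symm.trans (X.presheaf.map_id _)
  exact congrArg (fun g => g r) h''

theorem fl_smul (r : Γ(X, U)) (a : Γ(A.sheaf, A.aut.symm.inv ⁻¹ᵁ U)) :
    fl (A.aut.symm.inv.app U r • a) = r • fl a := pl_smul ..

theorem rs_uni {V : X.Opens} (h : V ≤ U) (r : Γ(X, U)) :
    rs h (uni r) = uni (X.presheaf.map (homOfLE h).op r) := rs_un ..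

theorem flipHom_rightUnitor (A : TwistedBimod X) : flipHom (ρ_ A).hom =
    (flipTensorIso A (𝟙_ (TwistedBimod X))).hom ≫ flipUnitIso.hom ▷ A.flip ≫ (λ_ _).hom := by
  refine hom_ext_fl₂ fun U a b => ?_
  obtain ⟨r, hr⟩ := app_inv_surjective A.aut _ b
  obtain rfl : uni (A.aut.inv.app _ r) = b := hr
  simp only [comp_hom, ap_comp, ap_flipTensorIso, ap_flipHom, ap_whiskerRight_ta,
    ap_rightUnitor_ta, ap_flipUnitIso, rs_rs]
  have h := rs_uni (preimage_symm A.aut.symm U).ge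
    (A.aut.inv.app (A.aut.symm.inv ⁻¹ᵁ U) r)
  refine Eq.trans ?_ (congrArg (fun c => ap (λ_ A.flip).hom.hom (ta c _)) h).symm
  refine Eq.trans ?_ (ap_leftUnitor_ta ..).symm
  refine Eq.trans ?_ (congrArg (_ • ·) (congrArg (rs _) (rs_fl ..))).symm
  refine Eq.trans ?_ (congrArg (_ • ·) (rs_fl ..)).symm
  refine Eq.trans ?_ (fl_smul ..)
  refine congrArg fl ?_
  refine Eq.trans ?_ (congrArg (fun c => c • _) (symm_inv_app A.aut U r)).symm
  refine (rs_self ..).trans (congrArg (r • ·) ?_)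
  exact (((rs_rs ..).trans (rs_rs ..)).trans (rs_self ..)).symm

/-- `flip` as a functor reversing tensor products. -/
def flipReversing : ReversingFunctor (TwistedBimod X) :=
  .ofMap flip flipHom flipHom_id flipHom_comp flipTensorIso flipUnitIso flipHom_whiskerRight
    flipHom_whiskerLeft flipHom_associator flipHom_rightUnitor

end TwistedBimod
end
-- Reversal on global sections and on products over words.
noncomputable section

variable {X : Scheme.{u}}
attribute [local irreducible] ap rs tm

namespace TwistedBimod
variable {A B : TwistedBimod X}

/-- Global sections of `L` are the same as global sections of `(σ⁻¹)^* L`. -/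
def gfl : H0 A.sheaf ≃+ H0 A.flip.sheaf where
  toFun x := fl (rs (preimage_top A.aut.symm).le x)
  invFun x := rs (preimage_top A.aut.symm).ge ((pl A.aut.symm).symm x)
  left_inv _ := (rs_rs ..).trans (rs_self ..)
  right_inv _ := congrArg fl ((rs_rs ..).trans (rs_self ..))
  map_add' a b := (congrArg fl (map_add _ a b)).trans (map_add (pl A.aut.symm) _ _)

theorem gfl_apply (a : H0 A.sheaf) : gfl a = fl (rs (preimage_top A.aut.symm).le a) := rfl

theorem hm_flipHom (f : A ⟶ B) (a : H0 A.sheaf) : hm (flipHom f) (gfl a) = gfl (hm f a) := by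
  refine (ap_flipHom f (rs (preimage_top A.aut.symm).le a)).trans (congrArg fl ?_)
  rw [ap_rs, rs_rs]
  rfl

/-- The origin of the opposite multiplication: `flipTensor` exchanges the factors of a pure tensor.
-/
theorem gfl_hmul (a : H0 A.sheaf) (b : H0 B.sheaf) :
    hm (flipTensorIso A B).hom (gfl (hmul a b)) = hmul (gfl b) (gfl a) := by
  refine (congrArg (fun c => ap (flipTensorIso A B).hom.hom (fl c)) (rs_ta ..)).trans
    ((ap_flipTensorIso ..).trans ?_)
  rw [rs_rs, rs_rs, rs_rs]
  refine congrArg₂ (fun a b => ta a b) rfl ?_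
  exact ((rs_fl ..).trans (congrArg fl (rs_rs ..))).symm

/-- Since `gfl` is pullback along `σ⁻¹`, pulling back along `σ` undoes it; this is how the pullback
in `twist` is removed. -/
theorem H0map_pullSymm (a : H0 A.sheaf) :
    H0map (pullSymm A.aut A.sheaf).hom (H0pull A.aut _ (gfl a)) = a := by
  have h : rs (preimage_top A.aut).le (gfl a) = pl A.aut.symm
      (rs (preimage_mono (preimage_top A.aut).le) (rs (preimage_top A.aut.symm).le a)) := rs_fl ..
  refine (H0map_eq _ _).trans ((congrArg _ ((H0pull_eq ..).trans (congrArg (pl A.aut) h))).trans ?_)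
  refine (ap_pullSymm (U := ⊤) A.aut _).trans ?_
  rw [rs_rs, rs_rs, rs_self]

theorem gfl_smul {k : Type u} [Field k] {f : X ⟶ Spec (.of k)} (h : A.aut.hom ≫ f = f) (c : k)
    (a : H0 A.sheaf) : gfl (scalars f c • a) = scalars f c • gfl a := by
  have h' : A.aut.symm.hom ≫ f = f := by rw [Iso.symm_hom, Iso.inv_comp_eq, h]
  rw [gfl_apply, rs_smul, app_scalars f h' c, fl_smul]
  rfl

end TwistedBimod

open TwistedBimod
variable {s : ℕ} {L : Fin s → TwistedBimod X}

/-- Both sides are the pullback of `φ_{ij}⁻¹` conjugated by `flipTensor`. This makes the induced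
relations accessible to the theory of reversing functors. -/
theorem CommRel.flip_bimodIso (φ : CommRel L) (i j : Fin s) (h : i < j) :
    φ.flip.bimodIso i j h = flipReversing.swap (φ.bimodIso i j h) :=
  Iso.ext (TwistedBimod.hom_ext rfl)

namespace TwistedBimod

variable (L) in
/-- The products over words of the bimodules `((σ_i⁻¹)^* L_i)_{σ_i⁻¹}`. -/
def flipWords : WordProd fun i => flipReversing.functor.obj (L i) := words fun i => (L i).flip

theorem rightUnitor_inv_hom (A : TwistedBimod X) : (ρ_ A).inv.hom =
    ((ρ_ A.sheaf).symm ≪≫ whiskerLeftIso _ (Functor.Monoidal.εIso (pull A.aut))).hom := rfl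

theorem prodSnoc_eq (v : List (Fin s)) (i : Fin s) : (prodSnoc L v i).hom =
    ((prod L v).actMap ((ρ_ _).symm ≪≫
      whiskerLeftIso _ (Functor.Monoidal.εIso (pull (L i).aut)))).hom ≫
      (prodAppend L v [i]).hom := rfl

theorem words_single (i : Fin s) : ((words L).single i).hom = (ρ_ (L i)).inv := by
  have h₁ : L i ◁ (words L).nil.hom = 𝟙 _ := MonoidalCategory.whiskerLeft_id ..
  have h : ((words L).single i).hom =
    (ρ_ (L i)).inv ≫ L i ◁ (words L).nil.hom ≫ ((words L).cons i []).hom := rfl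
  rw [h, h₁]
  exact (congrArg _ (Category.id_comp _)).trans (Category.comp_id _)

theorem prodSnoc_hom (v : List (Fin s)) (i : Fin s) :
    (prodSnoc L v i).hom = ((words L).snoc v i).hom.hom := by
  rw [prodSnoc_eq, WordProd.snoc_hom, comp_hom, ← prodAppend_hom, actMap_hom, whiskerLeft_hom,
    words_single, rightUnitor_inv_hom]
  rfl

theorem prodSnoc_inv (v : List (Fin s)) (i : Fin s) :
    (prodSnoc L v i).inv = ((words L).snoc v i).inv.hom :=
  congrArg Iso.inv (Iso.ext (prodSnoc_hom v i) : prodSnoc L v i = sheafIso ((words L).snoc v i))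

variable (L) in
/-- `flipProd` as an isomorphism of bimodules. -/
def flipProdIso (w : List (Fin s)) :
    ((words L).obj w.reverse).flip ≅ (words fun i => (L i).flip).obj w :=
  flipReversing.prod (words L) (flipWords L) w

theorem flipMap_hom {A B : TwistedBimod X} {e : A.sheaf ≅ B.sheaf} (h : A.aut = B.aut) (f : A ⟶ B) (hf : f.hom = e.hom) :
    (flipMap e h).hom = (flipHom f).hom := by
  rw [flipHom_hom, hf]
  rfl

theorem flipProd_cons_hom (i : Fin s) (v : List (Fin s)) : (flipProd L (i :: v)).hom =
    (flipMap (prodCongr L List.reverse_cons ≪≫ (prodSnoc L v.reverse i).symm)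
        (prod_reverse_cons_aut L i v)).hom ≫ (flipTensor (prod L v.reverse) (L i)).hom ≫
      ((L i).flip.actMap (flipProd L v)).hom := rfl

theorem flipProdIso_nil_hom : (flipProdIso L []).hom =
    flipHom (words L).nil.inv ≫ flipUnitIso.hom ≫ (words fun i => (L i).flip).nil.hom :=
  flipReversing.prod_nil_hom (words L) (flipWords L)

theorem flipProdIso_cons_hom (i : Fin s) (v : List (Fin s)) : (flipProdIso L (i :: v)).hom =
    flipHom (((words L).congr List.reverse_cons).hom ≫ ((words L).snoc v.reverse i).inv) ≫
      (flipTensorIso ((words L).obj v.reverse) (L i)).hom ≫ (L i).flip ◁ (flipProdIso L v).hom ≫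
      ((words fun i => (L i).flip).cons i v).hom :=
  flipReversing.prod_cons_hom (words L) (flipWords L) i v

/-- Matches the recursion used in `twist` with `ReversingFunctor.prod`; they differ by identities
coming from the structure maps of `words`. -/
theorem flipProd_hom (w : List (Fin s)) : (flipProd L w).hom = (flipProdIso L w).hom.hom := by
  induction w with
  | nil =>
    have h : flipHom (𝟙 (𝟙_ (TwistedBimod X))) ≫ flipUnitIso.hom ≫ 𝟙 (𝟙_ (TwistedBimod X)) =
        flipUnitIso.hom := by rw [flipHom_id, Category.id_comp, Category.comp_id]
    exact (congrArg Hom.hom (flipProdIso_nil_hom.trans h)).symm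
  | cons i v ih =>
    have h : (((words L).congr List.reverse_cons).hom ≫
        ((words L).snoc v.reverse i).inv).hom =
        (prodCongr L List.reverse_cons ≪≫ (prodSnoc L v.reverse i).symm).hom := by
      rw [comp_hom, ← prodCongr_hom, ← prodSnoc_inv]
      rfl
    have h' : ((L i).flip.actMap (flipProd L v)).hom =
        ((L i).flip ◁ (flipProdIso L v).hom).hom :=
      congrArg (fun g => (L i).flip.sheaf ◁ (pull (L i).flip.aut).map g) ih
    have h'' : (L i).flip ◁ (flipProdIso L v).hom ≫
        ((words fun i => (L i).flip).cons i v).hom = (L i).flip ◁ (flipProdIso L v).hom :=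
      Category.comp_id _
    rw [flipProdIso_cons_hom, h'', comp_hom]
    refine (flipProd_cons_hom i v).trans ?_
    exact congrArg₂ (fun p q => p ≫ q) (flipMap_hom _ _ h) (congrArg (fun q => _ ≫ q) h')

end TwistedBimod
end
-- The anti-isomorphism.
noncomputable section

variable {X : Scheme.{u}}
attribute [local irreducible] ap rs tm

section
open TwistedBimod
variable {s : ℕ} {L : Fin s → TwistedBimod X}

namespace TwistedBimod

/-- The isomorphism of global sections induced by an isomorphism of bimodules. -/
def hmEquiv {A B : TwistedBimod X} (e : A ≅ B) : H0 A.sheaf ≃+ H0 B.sheaf where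
  toFun := hm e.hom
  invFun := hm e.inv
  left_inv := hm_hom_inv e
  right_inv := hm_inv_hom e
  map_add' := map_add _

variable (L) in
/-- Global sections of the product over the reversed word, as global sections of the product of
the bimodules `((σ_i⁻¹)^* L_i)_{σ_i⁻¹}`. -/
def unpull (w : List (Fin s)) :
    H0 ((words L).obj w.reverse).sheaf ≃+ H0 ((words fun i => (L i).flip).obj w).sheaf :=
  gfl.trans (hmEquiv (flipProdIso L w))

theorem unpull_apply (w : List (Fin s)) (a : H0 ((words L).obj w.reverse).sheaf) :
    unpull L w a = hm (flipProdIso L w).hom (gfl a) := rfl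

theorem flipProd_inv (w : List (Fin s)) : (flipProd L w).inv = (flipProdIso L w).inv.hom :=
  congrArg Iso.inv (Iso.ext (flipProd_hom w) : flipProd L w = sheafIso (flipProdIso L w))

theorem H0map_H0pull {M N : X.Modules} (σ : X ≅ X) (g : M ⟶ N) (a : H0 M) :
    H0map ((pull σ).map g) (H0pull σ M a) = H0pull σ N (H0map g a) := by
  simp only [H0map_eq, H0pull_eq, ap_pull_map, ap_rs]

/-- Naturality of pullback moves `flipProd` inside, where it cancels against its inverse, and
`H0map_pullSymm` removes what is left. -/
theorem H0map_H0pull_unpull (w : List (Fin s)) (a : H0 ((words L).obj w.reverse).sheaf) :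
    H0map (pullSymm (prod L w.reverse).aut _).hom
      (H0map ((pull (prod L w.reverse).aut).map (flipProd L w).inv)
        (H0pull (prod L w.reverse).aut _ (unpull L w a))) = a := by
  have h : H0map (flipProd L w).inv (unpull L w a) = gfl a := by
    rw [flipProd_inv]
    exact (H0map_eq _ _).trans (hm_hom_inv (flipProdIso L w) (gfl a))
  refine (congrArg _ (H0map_H0pull ..)).trans ?_
  exact (congrArg (fun b => H0map _ (H0pull _ _ b)) h).trans (H0map_pullSymm a)

/-- This is `ReversingFunctor.prod_append` for `flip`, evaluated on `gfl (hmul b a)`. -/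
theorem unpull_mul (v w : List (Fin s)) (a : H0 ((words L).obj v.reverse).sheaf)
    (b : H0 ((words L).obj w.reverse).sheaf) :
    hm ((words fun i => (L i).flip).append v w).hom (hmul (unpull L v a) (unpull L w b)) =
      unpull L (v ++ w) (hm ((words L).congr List.reverse_append.symm).hom
        (hm ((words L).append w.reverse v.reverse).hom (hmul b a))) := by
  have h : (flipTensorIso ((words L).obj w.reverse) ((words L).obj v.reverse)).hom ≫
        ((flipProdIso L v).hom ⊗ₘ (flipProdIso L w).hom) ≫
        ((words fun i => (L i).flip).append v w).hom =
      flipHom (((words L).append w.reverse v.reverse).hom ≫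
        ((words L).congr List.reverse_append.symm).hom) ≫ (flipProdIso L (v ++ w)).hom :=
    flipReversing.prod_append (words L) (flipWords L) v w
  have h' := congrArg (fun g => hm g (gfl (hmul b a))) h
  simp only [hm_comp, gfl_hmul, hm_tensorHom, hm_flipHom] at h'
  exact h'

theorem exists_reorder_unpull (φ : CommRel L) {v w : List (Fin s)}
    {e : (words fun i => (L i).flip).obj v ≅ (words fun i => (L i).flip).obj w}
    (he : (words fun i => (L i).flip).Reorder φ.flip.bimodIso e) :
    ∃ e' : (words L).obj v.reverse ≅ (words L).obj w.reverse,
      (words L).Reorder φ.bimodIso e' ∧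
        ∀ a, hm e.hom (unpull L v a) = unpull L w (hm e'.hom a) := by
  have hφ : φ.flip.bimodIso = fun i j h => flipReversing.swap (φ.bimodIso i j h) := by
    funext i j h
    exact φ.flip_bimodIso i j h
  rw [hφ] at he
  obtain ⟨e', he', h⟩ := flipReversing.exists_reorder (P := words L) (P' := flipWords L) he
  refine ⟨e', he', fun a => ?_⟩
  have h' : flipHom e'.hom ≫ (flipProdIso L w).hom = (flipProdIso L v).hom ≫ e.hom := h
  rw [unpull_apply, unpull_apply, ← hm_comp, ← h', hm_comp, hm_flipHom]

end TwistedBimod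
end

section Ring
open TwistedBimod
variable {k : Type u} [Field k] (f : X ⟶ Spec (.of k)) {s : ℕ} {L : Fin s → TwistedBimod X}
  (φ : CommRel L)

/-- For sections written as `unpull a`, the pullback and the canonical isomorphisms in `twist`
cancel, and only the reordering of the reversed word survives. -/
theorem twist_eq (n : Fin s → ℕ) (a : H0 ((words L).obj (multiWord n).reverse).sheaf) :
    twist f φ n ((sec f φ.flip n).symm (unpull L (multiWord n) a)) =
      (sec f φ n).symm
        (hm (φ.sorted (multiWord n).reverse n (count_multiWord_reverse n)).hom a) := by
  have h (M N P Q : X.Modules) (e : M ≅ N) (e' : N ≅ P) (e'' : P ≅ Q) (b : H0 M) :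
      H0map (e ≪≫ e' ≪≫ e'').hom b = H0map e''.hom (H0map e'.hom (H0map e.hom b)) := by
    simp only [H0map_eq, Iso.trans_hom, ap_comp]
  refine (h ..).trans ?_
  refine (congrArg _ (H0map_H0pull_unpull (multiWord n) a)).trans ?_
  exact (H0map_eq _ _).trans (congrArg (fun g => ap g a) (φ.toMultiWord_hom _ n _))

/-- `twist` as an isomorphism. -/
def twistEquiv (n : Fin s → ℕ) : Piece f φ.flip n ≃+ Piece f φ n :=
  ((sec f φ.flip n).trans (unpull L (multiWord n)).symm).trans
    ((hmEquiv (φ.sorted (multiWord n).reverse n (count_multiWord_reverse n))).trans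
      (sec f φ n).symm)

theorem twistEquiv_apply (n : Fin s → ℕ) (a : Piece f φ.flip n) :
    twistEquiv f φ n a = twist f φ n a := by
  obtain ⟨b, rfl⟩ := ((sec f φ.flip n).trans (unpull L (multiWord n)).symm).symm.surjective a
  refine Eq.trans ?_ (twist_eq f φ n b).symm
  simp only [twistEquiv, AddEquiv.trans_apply, AddEquiv.symm_trans_apply,
    AddEquiv.apply_symm_apply, AddEquiv.symm_apply_apply, AddEquiv.symm_symm]
  rfl

/-- The isomorphism of twisted rings given by `twist` in each degree. -/
def twistRing : TwistedRing f φ.flip ≃+ TwistedRing f φ :=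
  DFinsupp.mapRange.addEquiv (twistEquiv f φ)

theorem twistRing_of (n : Fin s → ℕ) (a : Piece f φ.flip n) :
    twistRing f φ (TwistedRing.of f φ.flip n a) = TwistedRing.of f φ n (twist f φ n a) :=
  (DFinsupp.mapRange_single (hf := fun _ => map_zero _)).trans (congrArg (DFinsupp.single n) (twistEquiv_apply f φ n a))

variable {φ}

/-- Sorting `w` by the induced relations corresponds under `unpull` to a reordering of the reversed
word by `φ`, which does not change the class. -/
theorem CommRel.Compatible.twistRing_ofWord (hφ : φ.Compatible) (w : List (Fin s))
    (a : H0 ((words L).obj w.reverse).sheaf) :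
    twistRing f φ (ofWord f φ.flip w (unpull L w a)) = ofWord f φ w.reverse a := by
  have hw : ∀ i, w.count i = w.count i := fun _ => rfl
  obtain ⟨e', he', h⟩ := exists_reorder_unpull φ (φ.flip.reorder_sorted w _ hw)
  rw [ofWord_eq f φ.flip w _ hw, h, twistRing_of, twist_eq, hφ.ofWord_reorder f he',
    ofWord_eq f φ _ _ (count_multiWord_reverse fun i => w.count i)]

/-- With both sections in the form `unpull`, their product is `unpull` of the product in the
opposite order, up to the identification of the reversed concatenation with the concatenation of the
reversed words. -/
theorem CommRel.Compatible.twistRing_mul (hφ : φ.Compatible) (hψ : φ.flip.Compatible)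
    (a b : TwistedRing f φ.flip) : twistRing f φ (a * b) = twistRing f φ b * twistRing f φ a := by
  induction a using hψ.induction f with
  | add a a' h h' => rw [add_mul, map_add, map_add, mul_add, h, h']
  | ofWord v x =>
  induction b using hψ.induction f with
  | add b b' h h' => rw [mul_add, map_add, map_add, add_mul, h, h']
  | ofWord w y =>
  obtain ⟨x, rfl⟩ := (unpull L v).surjective x
  obtain ⟨y, rfl⟩ := (unpull L w).surjective y
  rw [hψ.ofWord_mul, unpull_mul, hφ.twistRing_ofWord, hφ.twistRing_ofWord, hφ.twistRing_ofWord,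
    hφ.ofWord_mul, ← hφ.ofWord_reorder f (.congr _ _)]

theorem CommRel.Compatible.twistRing_smul (hφ : φ.Compatible) (hψ : φ.flip.Compatible)
    (hσ : ∀ i, (L i).aut.hom ≫ f = f) (c : k) (a : TwistedRing f φ.flip) :
    twistRing f φ (c • a) = c • twistRing f φ a := by
  induction a using hψ.induction f with
  | add a a' h h' => rw [smul_add, map_add, map_add, smul_add, h, h']
  | ofWord w x =>
  obtain ⟨x, rfl⟩ := (unpull L w).surjective x
  have h : scalars f c • unpull L w x = unpull L w (scalars f c • x) := by
    rw [unpull_apply, unpull_apply, ← hm_smul]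
    exact congrArg _ (gfl_smul (A := (words L).obj w.reverse) (prod_aut_comp f hσ w.reverse) c
      x).symm
  rw [smul_ofWord, h, hφ.twistRing_ofWord, hφ.twistRing_ofWord, smul_ofWord]

end Ring
end
end TwistedCoordinateRing

theorem lemma2p3 {k : Type u} [Field k] {X : Scheme.{u}} (f : X ⟶ Spec (.of k))
    (hX : IsProjectiveOver f) {s : ℕ} (L : Fin s → TwistedBimod X)
    (hL : ∀ i, IsInvertible (L i).sheaf) (hσ : ∀ i, (L i).aut.hom ≫ f = f)
    (φ : CommRel L) (hφ : φ.Compatible) (hψ : φ.flip.Compatible) :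
    IsAssocUnitalAlgebra k (TwistedRing f φ) ∧
      IsAssocUnitalAlgebra k (TwistedRing f φ.flip) ∧
      ∃ τ : TwistedRing f φ.flip ≃+* (TwistedRing f φ)ᵐᵒᵖ,
        (∀ (c : k) (a : TwistedRing f φ.flip), τ (c • a) = c • τ a) ∧
        ∀ (n : Fin s → ℕ) (a : Piece f φ.flip n),
          τ (TwistedRing.of f φ.flip n a) = MulOpposite.op (TwistedRing.of f φ n (twist f φ n a)) :=
  ⟨hφ.isAssocUnitalAlgebra f hσ,
    -- The inverse automorphisms are again automorphisms over `Spec k`.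
    hψ.isAssocUnitalAlgebra f fun i => (Iso.inv_comp_eq _).2 (hσ i).symm,
    { (twistRing f φ).trans MulOpposite.opAddEquiv with
      map_mul' := fun a b => congrArg MulOpposite.op (hφ.twistRing_mul f hψ a b) },
    fun c a => congrArg MulOpposite.op (hφ.twistRing_smul f hψ hσ c a),
    fun n a => congrArg MulOpposite.op (twistRing_of f φ n a)⟩
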